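/- **Setting.** Let $\mathcal M=(\mathcal S,\mathcal A,\mathbb P,r,\gamma)$ be a discounted MDP with measurable state space, rewards in $[0,1]$, $\gamma\in[0,1)$ and a finite product action set $\mathcal A=\mathcal A^{(1)}\times\dots\times\mathcal A^{(m)}$, $m\ge 1$. Let $\phi_i:\mathcal S\times\mathcal A^{(i)}\to\mathbb R^d$ ($d\ge1$) be feature maps, measurable in the state, and $\phi(s,a)=\sum_{i=1}^m\phi_i(s,a^{(i)})$, with $\|\phi(s,a)\|_2\le 1$ for all $(s,a)$. For $b>0$ and $\epsilon\ge 0$ call $\mathcal M$ $\epsilon$-realizable if for every stationary policy $\pi$ there is $w_\pi\in\mathbb R^d$ with $\|w_\pi\|_2\le b$ and $|Q_\pi(s,a)-w_\pi^\top\phi(s,a)|\le\epsilon$ for all $(s,a)$. Fix an initial state $\rho$, an initial policy $\pi_0$, a default action vector $\bar a\in\mathcal A$ and $\delta\in(0,1)$. **Algorithm** (Confident MC-LSPI with the default-action-vector check; inputs $K,n,H\in\mathbb N$, $\tau,\lambda>0$). It has access to a simulator that, when queried at a pair $(s,a)$ with $s=\rho$ or $s$ returned before, gives $r(s,a)$ and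 $s'\sim\mathbb P(\cdot\mid s,a)$. It keeps a core set $\mathcal C$ of state-action pairs, initially $\{(\rho,\bar a)\}$; $\Phi_{\mathcal C}$ is the matrix with rows $\phi(z)^\top$, $z\in\mathcal C$, and $V_{\mathcal C}=\Phi_{\mathcal C}^\top\Phi_{\mathcal C}+\lambda I$. The *check* of a state $s$ searches for an action vector $\tilde a$ that differs from $\bar a$ in at most one component and satisfies $\phi(s,\tilde a)^\top V_{\mathcal C}^{-1}\phi(s,\tilde a)>\tau$. First, as long as the check of $\rho$ finds such an $\tilde a$, $(\rho,\tilde a)$ is added to $\mathcal C$. Then policy iteration is run: for $k=1,\dots,K$, each $z\in\mathcal C$ gets as value $q_z$ the average of the returns $\sum_{t=0}^H\gamma^t r_t$ of $n$ simulated rollouts that start with $z$ and then follow $\pi_{k-1}$, where each of the states $s_1,\dots,s_H$ is checked before the action is chosen; if a check finds an uncertain pair, this pair is added to $\mathcal C$ and policy iteration restarts from $\pi_0$; otherwise $w_k=V_{\mathcal C}^{-1}\Phi_{\mathcal C}^\top q$, and $\pi_k$ is greedy with respect to $w_k^\top\phi$, computed componentwise. After $K$ iterations without restart the output is $\pi_{K-1}$.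 **Parameters.** For $\kappa>0$ put $\tau=1$, $\lambda=\frac{\kappa^2(1-\gamma)^4}{1024b^2(2m-1)^2}$, $C_{\max}=\frac{e}{e-1}\cdot\frac{1+\tau}{\tau}\,d\,\big(\log(1+\frac1\tau)+\log(1+\frac1\lambda)\big)$, $\theta=\frac{\kappa(1-\gamma)^2}{32(2m-1)\sqrt{C_{\max}}}$, $K=\max\big\{1,\big\lceil\frac{\log\frac{1}{\kappa(1-\gamma)^2}+\log 8}{1-\gamma}+1\big\rceil\big\}$, $H=\max\big\{0,\big\lceil\frac{\log(32\sqrt{C_{\max}}(2m-1))-\log(\kappa(1-\gamma)^3)}{1-\gamma}-1\big\rceil\big\}$, $n=\big\lceil\frac{\log(4KC_{\max}^2)-\log\delta}{2\theta^2(1-\gamma)^2}\big\rceil$. **Theorem.** There are universal constants $c,p$ and universal polynomials $T_1,T_2$ such that the following holds. (1) If $\mathcal M$ is $0$-realizable, then for every $\kappa>0$ the algorithm with these parameters always terminates, and with probability at least $1-\delta$ its output satisfies $V^*(\rho)-V_{\pi_{K-1}}(\rho)\le\kappa$. The number of simulator queries is $\tilde{\mathcal O}\big(\frac{m^2d^3}{\kappa^2(1-\gamma)^8}\big)$: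 with $\bar\kappa=\min\{\kappa,\frac1{1-\gamma}\}$ it is always at most $$c\,\frac{m^2d^3}{\bar\kappa^2(1-\gamma)^8}\Big(1+\log m+\log d+\log(1+b)+\log(1+\tfrac1\kappa)+\log\tfrac1{1-\gamma}+\log\tfrac1\delta\Big)^p .$$ The number of elementary steps (real arithmetic operations and comparisons, evaluations of feature coordinates, draws from $\pi_0$, simulator queries, loop passes) is always at most $T_1\big(\sum_i|\mathcal A^{(i)}|,d,\frac1{1-\gamma},\frac1\kappa,\log\frac1\delta,\log(1+b)\big)$. (2) If $\epsilon>0$ and $\mathcal M$ is $\epsilon$-realizable, then the algorithm with the parameters for $\kappa=\frac{32\epsilon\sqrt d\,m}{(1-\gamma)^2}\big(1+\log(1+b^2\epsilon^{-2}d^{-1})\big)^{1/2}$ always terminates, and with probability at least $1-\delta$ $$V^*(\rho)-V_{\pi_{K-1}}(\rho)\le\frac{128\,\epsilon\sqrt d\,m}{(1-\gamma)^2}\big(1+\log(1+b^2\epsilon^{-2}d^{-1})\big)^{1/2}.$$ The number of queries is $\tilde{\mathcal O}\big(\frac{d^2}{\epsilon^2(1-\gamma)^4}\big)$: with $\bar\epsilon=\min\{\epsilon,\frac1{1-\gamma}\}$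 it is always at most $$c\,\frac{d^2}{\bar\epsilon^2(1-\gamma)^4}\Big(1+\log d+\log(1+b)+\log(1+\tfrac1\epsilon)+\log\tfrac1{1-\gamma}+\log\tfrac1\delta\Big)^p .$$ The number of elementary steps is always at most $T_2\big(\sum_i|\mathcal A^{(i)}|,d,\frac1{1-\gamma},\frac1\epsilon,\log\frac1\delta,\log(1+b)\big)$. -/

import Mathlib

open MeasureTheory ProbabilityTheory
open scoped ENNReal

noncomputable section

namespace MCLSPI

universe u v w

/-! ### Markov decision processes, policies and value functions -/

/-- A discounted Markov decision process with measurable state space `S` and action space `A`. -/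
structure MDP (S : Type u) (A : Type v) [MeasurableSpace S] [MeasurableSpace A] where
  /-- the transition kernel -/
  trans : Kernel (S × A) S
  isMarkov : IsMarkovKernel trans
  /-- the reward function -/
  reward : S × A → ℝ
  measurable_reward : Measurable reward
  reward_nonneg : ∀ x, 0 ≤ reward x
  reward_le_one : ∀ x, reward x ≤ 1
  /-- the discount factor -/
  disc : ℝ
  disc_nonneg : 0 ≤ disc
  disc_lt_one : disc < 1

/-- A stationary (possibly randomized) policy. -/
structure Policy (S : Type u) (A : Type v) [MeasurableSpace S] [MeasurableSpace A] where
  kernel : Kernel S A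
  isMarkov : IsMarkovKernel kernel

attribute [instance] MDP.isMarkov Policy.isMarkov

section Values

variable {S : Type u} {A : Type v} [MeasurableSpace S] [MeasurableSpace A]

/-- From a state `s`, the law of the pair `(s, a)` with `a ∼ π(· | s)`. -/
def Policy.pair (π : Policy S A) : Kernel S (S × A) := Kernel.id ×ₖ π.kernel

instance (π : Policy S A) : IsMarkovKernel π.pair := by
  unfold Policy.pair; infer_instance

/-- The law of the next state-action pair given the history of state-action pairs: the next state
is drawn from the transition kernel at the last pair, the next action from the policy. -/
def MDP.pairKernel (M : MDP S A) (π : Policy S A) (n : ℕ) :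
    Kernel (∀ _ : Finset.Iic n, S × A) (S × A) :=
  (π.pair ∘ₖ M.trans).comap (fun h => h ⟨n, Finset.mem_Iic.2 le_rfl⟩) (measurable_pi_apply _)

instance (M : MDP S A) (π : Policy S A) (n : ℕ) : IsMarkovKernel (M.pairKernel π n) := by
  unfold MDP.pairKernel; infer_instance

/-- The law of the infinite trajectory of state-action pairs that starts in `s` and follows `π`. -/
def MDP.trajectory (M : MDP S A) (π : Policy S A) (s : S) : Measure (ℕ → S × A) :=
  Kernel.trajMeasure (X := fun _ => S × A) (π.pair s) (M.pairKernel π)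

/-- The state value function `V_π`. -/
def MDP.value (M : MDP S A) (π : Policy S A) (s : S) : ℝ :=
  ∫ ω, ∑' t : ℕ, M.disc ^ t * M.reward (ω t) ∂(M.trajectory π s)

/-- The action value function `Q_π`. -/
def MDP.qValue (M : MDP S A) (π : Policy S A) (s : S) (a : A) : ℝ :=
  M.reward (s, a) + M.disc * ∫ s', M.value π s' ∂(M.trans (s, a))

/-- The optimal state value function `V^*`. -/
def MDP.optValue (M : MDP S A) (s : S) : ℝ := ⨆ π : Policy S A, M.value π s

end Values

/-! ### Product action sets and additive features -/

/-- Action vectors: the `i`-th component ranges over a set of `N i` actions, labelled by `Fin`. -/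
abbrev Act {m : ℕ} (N : Fin m → ℕ) : Type := ∀ i, Fin (N i)

/-- Component feature maps `φ_i : S × A^{(i)} → ℝ^d`. -/
abbrev Features (S : Type u) {m : ℕ} (N : Fin m → ℕ) (d : ℕ) : Type u :=
  ∀ i : Fin m, S → Fin (N i) → EuclideanSpace ℝ (Fin d)

section Additive

variable {S : Type u} {m : ℕ} {N : Fin m → ℕ} {d : ℕ}

/-- The additive feature map `φ(s, a) = ∑ i, φ_i(s, a_i)`. -/
def Features.total (φ : Features S N d) (s : S) (a : Act N) : EuclideanSpace ℝ (Fin d) :=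
  ∑ i, φ i s (a i)

/-- Bounded features: `‖φ(s, a)‖₂ ≤ 1`. -/
def Features.Bounded (φ : Features S N d) : Prop := ∀ s a, ‖φ.total s a‖ ≤ 1

/-- The action-value function of every policy is, up to `ε`, linear in the additive features, with
a weight vector of norm at most `b`. -/
def Realizable [MeasurableSpace S] (M : MDP S (Act N)) (φ : Features S N d) (b ε : ℝ) : Prop :=
  ∀ π : Policy S (Act N), ∃ w : EuclideanSpace ℝ (Fin d), ‖w‖ ≤ b ∧
    ∀ s a, |M.qValue π s a - inner ℝ w (φ.total s a)| ≤ ε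

/-- The first index at which a finite family of reals attains its maximum. -/
def firstArgmax {n : ℕ} [NeZero n] (f : Fin n → ℝ) : Fin n :=
  (Finset.univ.filter fun a => ∀ a', f a' ≤ f a).min' (by
    obtain ⟨a, -, ha⟩ := Finset.exists_max_image Finset.univ f ⟨0, Finset.mem_univ _⟩
    exact ⟨a, by simpa using fun a' => ha a' (Finset.mem_univ _)⟩)

theorem measurable_firstArgmax {n : ℕ} [NeZero n] :
    Measurable (firstArgmax : (Fin n → ℝ) → Fin n) := by
  refine measurable_to_countable' fun a => ?_
  have h : (firstArgmax : (Fin n → ℝ) → Fin n) ⁻¹' {a} =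
      {f | (∀ a', f a' ≤ f a) ∧ ∀ c, (∀ a', f a' ≤ f c) → a ≤ c} := by
    ext f
    simp only [Set.mem_preimage, Set.mem_singleton_iff, Set.mem_ofPred_eq, firstArgmax]
    rw [Finset.min'_eq_iff]
    simp
  rw [h]
  have h1 : ∀ c : Fin n, MeasurableSet {f : Fin n → ℝ | ∀ a', f a' ≤ f c} := fun c => by
    simp only [Set.ofPred_forall]
    exact MeasurableSet.iInter fun a' =>
      measurableSet_le (measurable_pi_apply a') (measurable_pi_apply c)
  simp only [Set.ofPred_and, Set.ofPred_forall]
  refine (by simpa only [Set.ofPred_forall] using h1 a : MeasurableSet _).inter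
    (MeasurableSet.iInter fun c => ?_)
  by_cases hc : a ≤ c
  · simp [hc]
  · simpa [hc, Set.compl_ofPred] using (h1 c).compl

/-- The greedy action vector for `w`. As the features are additive it is computed componentwise:
its `i`-th entry maximizes `wᵀ φ_i(s, ·)`, so that the vector maximizes `wᵀ φ(s, ·)`. -/
def greedyAction [∀ i, NeZero (N i)] (φ : Features S N d) (w : Fin d → ℝ) (s : S) : Act N :=
  fun i => firstArgmax fun a => ∑ j, w j * φ i s a j

theorem measurable_greedyAction [MeasurableSpace S] [∀ i, NeZero (N i)] (φ : Features S N d)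
    (hφ : ∀ i a, Measurable fun s => φ i s a) (w : Fin d → ℝ) :
    Measurable (greedyAction φ w) := by
  refine measurable_pi_iff.2 fun i => measurable_firstArgmax.comp (measurable_pi_iff.2 fun a => ?_)
  refine Finset.measurable_sum _ fun j _ => Measurable.const_mul ?_ _
  exact (by fun_prop : Measurable fun x : EuclideanSpace ℝ (Fin d) => x j).comp (hφ i a)

end Additive

/-! ### A machine model with real arithmetic and access to a simulator

A program is a tree of elementary instructions. Each instruction costs one unit of time. Programs
are polymorphic in the state space `S`: the only states a program can get hold of are its inputs
and the states returned by the simulator (local access). -/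

/-- Arithmetic instructions. -/
inductive Arith
  | add
  | sub
  | mul
  | div

/-- The result of an arithmetic instruction. -/
def Arith.eval : Arith → ℝ → ℝ → ℝ
  | add, x, y => x + y
  | sub, x, y => x - y
  | mul, x, y => x * y
  | div, x, y => x / y

/-- Programs that return an element of `α`. Apart from returning a result, a program executes one
elementary instruction and continues with its outcome:
* `step`: a bookkeeping instruction (one pass of a loop, for instance),
* `arith`: one arithmetic operation on real numbers,
* `less`: one comparison of real numbers,
* `feature s i a j`: evaluation of the `j`-th coordinate of `φ_i(s, a)`,
* `sampleInit s`: a draw of an action vector from the initial policy at `s`,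
* `simulate s a`: one query to the simulator, which returns the next state and the reward. -/
inductive Prog (S : Type u) {m : ℕ} (N : Fin m → ℕ) (d : ℕ) (α : Type v) : Type (max u v)
  | ret (x : α)
  | step (k : Prog S N d α)
  | arith (o : Arith) (x y : ℝ) (k : ℝ → Prog S N d α)
  | less (x y : ℝ) (k : Bool → Prog S N d α)
  | feature (s : S) (i : Fin m) (a : Fin (N i)) (j : Fin d) (k : ℝ → Prog S N d α)
  | sampleInit (s : S) (k : Act N → Prog S N d α)
  | simulate (s : S) (a : Act N) (k : S → ℝ → Prog S N d α)

namespace Prog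

variable {S : Type u} {m : ℕ} {N : Fin m → ℕ} {d : ℕ} {α : Type v} {β : Type w}

/-- Sequential composition. -/
def bind : Prog S N d α → (α → Prog S N d β) → Prog S N d β
  | ret x, f => f x
  | step k, f => step (k.bind f)
  | arith o x y k, f => arith o x y fun z => (k z).bind f
  | less x y k, f => less x y fun c => (k c).bind f
  | feature s i a j k, f => feature s i a j fun z => (k z).bind f
  | sampleInit s k, f => sampleInit s fun a => (k a).bind f
  | simulate s a k, f => simulate s a fun s' r => (k s' r).bind f

/-- `p.Always M φ R`: on every execution of `p`, whatever states the simulator and whatever actions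
the initial policy return, `R t q x` holds, where `t` is the number of instructions that were
executed, `q` the number of queries to the simulator and `x` the result. -/
def Always [MeasurableSpace S] (M : MDP S (Act N)) (φ : Features S N d) :
    Prog S N d α → (ℕ → ℕ → α → Prop) → Prop
  | ret x, R => R 0 0 x
  | step k, R => k.Always M φ fun t q x => R (t + 1) q x
  | arith o x y k, R => (k (o.eval x y)).Always M φ fun t q x => R (t + 1) q x
  | less x y k, R => (k (decide (x < y))).Always M φ fun t q x => R (t + 1) q x
  | feature s i a j k, R => (k (φ i s a j)).Always M φ fun t q x => R (t + 1) q x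
  | sampleInit _ k, R => ∀ a, (k a).Always M φ fun t q x => R (t + 1) q x
  | simulate s a k, R =>
      ∀ s', (k s' (M.reward (s, a))).Always M φ fun t q x => R (t + 1) (q + 1) x

/-- The probability that the result of `p` lies in `E`, when the simulator answers with independent
draws from the transition kernel and the initial policy is `π₀`: the iterated integral of the
indicator of `E` over these draws. (For integrands that are not measurable, `∫⁻` is the lower
integral, so that lower bounds on `prob` need no measurability of `E`.) -/
def prob [MeasurableSpace S] (M : MDP S (Act N)) (φ : Features S N d) (π₀ : Policy S (Act N))
    (E : Set α) : Prog S N d α → ℝ≥0∞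
  | ret x => E.indicator 1 x
  | step k => k.prob M φ π₀ E
  | arith o x y k => (k (o.eval x y)).prob M φ π₀ E
  | less x y k => (k (decide (x < y))).prob M φ π₀ E
  | feature s i a j k => (k (φ i s a j)).prob M φ π₀ E
  | sampleInit s k => ∫⁻ a, (k a).prob M φ π₀ E ∂(π₀.kernel s)
  | simulate s a k => ∫⁻ s', (k s' (M.reward (s, a))).prob M φ π₀ E ∂(M.trans (s, a))

/-- Bounded loop over `Fin n` with a loop variable of type `α`. -/
def loop : (n : ℕ) → (Fin n → α → Prog S N d α) → α → Prog S N d α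
  | 0, _, x => ret x
  | n + 1, body, x => step ((body 0 x).bind fun y => loop n (fun i => body i.succ) y)

/-- Computes a vector entry by entry. -/
def tabulate : (n : ℕ) → (β : Fin n → Type) → (∀ i, Prog S N d (β i)) → Prog S N d (∀ i, β i)
  | 0, _, _ => ret fun i => i.elim0
  | n + 1, β, f => step ((f 0).bind fun x =>
      (tabulate n (fun i => β i.succ) fun i => f i.succ).bind fun g => ret (Fin.cons x g))

/-- Loop over `Fin n` that stops with the first result different from `none`. -/
def firstSome : (n : ℕ) → (Fin n → Prog S N d (Option α)) → Prog S N d (Option α)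
  | 0, _ => ret none
  | n + 1, f => step ((f 0).bind fun o =>
      match o with
      | some x => ret (some x)
      | none => firstSome n fun i => f i.succ)

/-! #### Linear algebra -/

/-- `∑ i, x i * y i` -/
def dot {n : ℕ} (x y : Fin n → ℝ) : Prog S N d ℝ :=
  loop n (fun i acc => arith .mul (x i) (y i) fun p => arith .add acc p ret) 0

/-- The product of a matrix and a vector. -/
def mulVec (B : Fin d → Fin d → ℝ) (x : Fin d → ℝ) : Prog S N d (Fin d → ℝ) :=
  tabulate d (fun _ => ℝ) fun i => dot (B i) x

/-- The matrix `λ⁻¹ I`. -/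
def scalarInv (lam : ℝ) : Prog S N d (Fin d → Fin d → ℝ) :=
  arith .div 1 lam fun c =>
    tabulate d (fun _ => Fin d → ℝ) fun i => tabulate d (fun _ => ℝ) fun j =>
      step (ret (if i = j then c else 0))

/-- Rank-one update of an inverse: for symmetric `B = V⁻¹` the result is
`B - (B x) (B x)ᵀ / (1 + xᵀ B x) = (V + x xᵀ)⁻¹`. -/
def rankOne (B : Fin d → Fin d → ℝ) (x : Fin d → ℝ) : Prog S N d (Fin d → Fin d → ℝ) :=
  (mulVec B x).bind fun y => (dot x y).bind fun c => arith .add 1 c fun c' =>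
    tabulate d (fun _ => Fin d → ℝ) fun i => tabulate d (fun _ => ℝ) fun j =>
      arith .mul (y i) (y j) fun p => arith .div p c' fun p' => arith .sub (B i j) p' ret

/-- The additive feature vector `φ(s, a)`. -/
def featureVec (s : S) (a : Act N) : Prog S N d (Fin d → ℝ) :=
  tabulate d (fun _ => ℝ) fun j =>
    loop m (fun i acc => feature s i (a i) j fun x => arith .add acc x ret) 0

end Prog

/-! ### Confident MC-LSPI with the default-action-vector uncertainty check -/

/-- An element of the core set: a state, an action vector and their feature vector. -/
structure CoreElem (S : Type u) {m : ℕ} (N : Fin m → ℕ) (d : ℕ) : Type u where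
  state : S
  action : Act N
  feat : Fin d → ℝ

/-- The core set `C`, together with the matrix `(Φ_Cᵀ Φ_C + λ I)⁻¹`. -/
structure CoreSet (S : Type u) {m : ℕ} (N : Fin m → ℕ) (d : ℕ) : Type u where
  elems : List (CoreElem S N d)
  inv : Fin d → Fin d → ℝ

/-- The policies that occur in the algorithm: the initial policy, and the greedy policy with respect
to `wᵀ φ`. -/
inductive PolicyCode (d : ℕ)
  | init
  | greedy (w : Fin d → ℝ)

/-- A routine either comes across an uncertain state-action pair or is done. -/
inductive Status (ζ : Type u) (α : Type v)
  | uncertain (z : ζ)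
  | done (x : α)

/-- The numerical inputs of the algorithm. -/
structure Params where
  /-- number of iterations of policy iteration -/
  K : ℕ
  /-- number of rollouts -/
  n : ℕ
  /-- length of the rollouts -/
  H : ℕ
  /-- threshold of the uncertainty check -/
  τ : ℝ
  /-- regularization coefficient -/
  lam : ℝ
  /-- discount factor -/
  disc : ℝ

/-- The policy that a code stands for. -/
def PolicyCode.policy {S : Type u} [MeasurableSpace S] {m : ℕ} {N : Fin m → ℕ} {d : ℕ}
    [∀ i, NeZero (N i)] (φ : Features S N d) (hφ : ∀ i a, Measurable fun s => φ i s a)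
    (π₀ : Policy S (Act N)) : PolicyCode d → Policy S (Act N)
  | .init => π₀
  | .greedy w => ⟨Kernel.deterministic (greedyAction φ w) (measurable_greedyAction φ hφ w),
      inferInstance⟩

section Algorithm

open Prog

variable {S : Type u} {m : ℕ} {N : Fin m → ℕ} {d : ℕ}

/-- Adds an element to the core set. -/
def CoreSet.insert (C : CoreSet S N d) (z : CoreElem S N d) : Prog S N d (CoreSet S N d) :=
  (rankOne C.inv z.feat).bind fun B => ret ⟨C.elems ++ [z], B⟩

/-- The uncertainty check with default action vector `abar`: looks for an action vector `a` that
differs from `abar` in at most one component and has `φ(s, a)ᵀ (Φ_Cᵀ Φ_C + λ I)⁻¹ φ(s, a) > τ`. The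
result `none` means that there is none (certain). -/
def uncertaintyCheck (abar : Act N) (τ : ℝ) (C : CoreSet S N d) (s : S) :
    Prog S N d (Option (CoreElem S N d)) :=
  firstSome m fun i => firstSome (N i) fun a =>
    (featureVec s (Function.update abar i a)).bind fun x =>
    (mulVec C.inv x).bind fun y => (dot x y).bind fun g =>
    less τ g fun c => ret (if c then some ⟨s, Function.update abar i a, x⟩ else none)

/-- Computes the greedy action vector at `s` by one pass over each of the component sets. -/
def greedyProg [∀ i, NeZero (N i)] (w : Fin d → ℝ) (s : S) : Prog S N d (Act N) :=
  tabulate m (fun i => Fin (N i)) fun i =>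
    let score (a : Fin (N i)) : Prog S N d ℝ :=
      loop d (fun j acc => feature s i a j fun x => arith .mul (w j) x fun p =>
        arith .add acc p ret) 0
    (score 0).bind fun v₀ =>
    (loop (N i) (fun a (best : Fin (N i) × ℝ) =>
      (score a).bind fun v => less best.2 v fun c => ret (if c then (a, v) else best))
      (0, v₀)).bind fun best => ret best.1

/-- Draws an action vector from a policy. -/
def PolicyCode.draw [∀ i, NeZero (N i)] (s : S) : PolicyCode d → Prog S N d (Act N)
  | .init => sampleInit s ret
  | .greedy w => greedyProg w s

variable [∀ i, NeZero (N i)] (abar : Act N) (P : Params)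

/-- The last `h` steps of a rollout, from the state `s`; `g` is the power of the discount factor
and `G` the discounted return so far. -/
def rolloutFrom (π : PolicyCode d) (C : CoreSet S N d) :
    (h : ℕ) → (s : S) → (g G : ℝ) → Prog S N d (Status (CoreElem S N d) ℝ)
  | 0, _, _, G => ret (.done G)
  | h + 1, s, g, G => step ((uncertaintyCheck abar P.τ C s).bind fun o =>
      match o with
      | some z => ret (.uncertain z)
      | none => (π.draw s).bind fun a => simulate s a fun s' r =>
          arith .mul g P.disc fun g' => arith .mul g' r fun x => arith .add G x fun G' =>
            rolloutFrom π C h s' g' G')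

/-- The sum of `G` and the returns of `n` rollouts from the core set element `z`. -/
def rolloutSum (π : PolicyCode d) (C : CoreSet S N d) (z : CoreElem S N d) :
    (n : ℕ) → (G : ℝ) → Prog S N d (Status (CoreElem S N d) ℝ)
  | 0, G => ret (.done G)
  | n + 1, G => step (simulate z.state z.action fun s₁ r₀ =>
      (rolloutFrom abar P π C P.H s₁ 1 r₀).bind fun o =>
      match o with
      | .uncertain z' => ret (.uncertain z')
      | .done x => arith .add G x fun G' => rolloutSum π C z n G')

/-- The rollout routine: the average return of `n` rollouts of length `H` from `z`, unless an
uncertain state is met. -/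
def rollout (π : PolicyCode d) (C : CoreSet S N d) (z : CoreElem S N d) :
    Prog S N d (Status (CoreElem S N d) ℝ) :=
  (rolloutSum abar P π C z P.n 0).bind fun o =>
    match o with
    | .uncertain z' => ret (.uncertain z')
    | .done G => arith .div G (P.n : ℝ) fun q => ret (.done q)

/-- Attaches a value estimate to each of the listed core set elements, unless an uncertain state
is met. -/
def evaluate (π : PolicyCode d) (C : CoreSet S N d) :
    List (CoreElem S N d) → Prog S N d (Status (CoreElem S N d) (List (CoreElem S N d × ℝ)))
  | [] => ret (.done [])
  | z :: l => step ((rollout abar P π C z).bind fun o =>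
      match o with
      | .uncertain z' => ret (.uncertain z')
      | .done q => (evaluate π C l).bind fun o' =>
          match o' with
          | .uncertain z' => ret (.uncertain z')
          | .done l' => ret (.done ((z, q) :: l')))

/-- The vector `Φ_Cᵀ q_C`, the sum of the vectors `z_q z_φ`. -/
def momentVec : List (CoreElem S N d × ℝ) → Prog S N d (Fin d → ℝ)
  | [] => tabulate d (fun _ => ℝ) fun _ => ret 0
  | (z, q) :: l => step ((momentVec l).bind fun y =>
      tabulate d (fun _ => ℝ) fun j => arith .mul q (z.feat j) fun p => arith .add (y j) p ret)

/-- `k` further iterations of policy iteration. The current policy is `cur`, the one before it is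
`prev`. The result is the policy before the last one. -/
def policyIteration (C : CoreSet S N d) :
    (k : ℕ) → (prev cur : PolicyCode d) → Prog S N d (Status (CoreElem S N d) (PolicyCode d))
  | 0, prev, _ => ret (.done prev)
  | k + 1, _, cur => step ((evaluate abar P cur C C.elems).bind fun o =>
      match o with
      | .uncertain z => ret (.uncertain z)
      | .done l => (momentVec l).bind fun y => (mulVec C.inv y).bind fun w =>
          policyIteration C k cur (.greedy w))

/-- Initialization: as long as the uncertainty check at `ρ` returns an uncertain pair, this pair is
added to the core set. The result is `none` if `fuel` passes are not enough. -/
def initCore (ρ : S) : (fuel : ℕ) → CoreSet S N d → Prog S N d (Option (CoreSet S N d))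
  | 0, _ => ret none
  | f + 1, C => step ((uncertaintyCheck abar P.τ C ρ).bind fun o =>
      match o with
      | none => ret (some C)
      | some z => (C.insert z).bind fun C' => initCore ρ f C')

/-- Policy iteration with `K` iterations, restarted with a larger core set whenever an uncertain
pair is met. The result is `none` if `fuel` runs are not enough. -/
def mainLoop : (fuel : ℕ) → CoreSet S N d → Prog S N d (Option (PolicyCode d))
  | 0, _ => ret none
  | f + 1, C => step ((policyIteration abar P C P.K .init .init).bind fun o =>
      match o with
      | .uncertain z => (C.insert z).bind fun C' => mainLoop f C'
      | .done π => ret (some π))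

/-- Confident MC-LSPI with the default-action-vector uncertainty check. The result is the policy
`π_{K-1}`, or `none` if one of the two unbounded loops does not end within `fuel` passes. -/
def confidentMCLSPI (ρ : S) (fuel : ℕ) : Prog S N d (Option (PolicyCode d)) :=
  (scalarInv P.lam).bind fun B₀ => (featureVec ρ abar).bind fun x =>
  (CoreSet.insert ⟨[], B₀⟩ ⟨ρ, abar, x⟩).bind fun C =>
  (initCore abar P ρ fuel C).bind fun o =>
    match o with
    | none => ret none
    | some C' => mainLoop abar P fuel C'

end Algorithm

/-! ### Parameter settings -/

/-- The bound `C_max` on the size of the core set. -/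
def coreBound (d : ℕ) (τ lam : ℝ) : ℝ :=
  Real.exp 1 / (Real.exp 1 - 1) * ((1 + τ) / τ) * d * (Real.log (1 + 1 / τ) + Real.log (1 + 1 / lam))

/-- The regularization coefficient. -/
def lamOf (m : ℕ) (b γ κ : ℝ) : ℝ :=
  κ ^ 2 * (1 - γ) ^ 4 / (1024 * b ^ 2 * (2 * (m : ℝ) - 1) ^ 2)

/-- The value of `C_max` for the threshold `τ = 1`. -/
def cmaxOf (m d : ℕ) (b γ κ : ℝ) : ℝ := coreBound d 1 (lamOf m b γ κ)

/-- The accuracy of the value estimates. -/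
def thetaOf (m d : ℕ) (b γ κ : ℝ) : ℝ :=
  κ * (1 - γ) ^ 2 / (32 * (2 * (m : ℝ) - 1) * √(cmaxOf m d b γ κ))

/-- The number of iterations. -/
def itersOf (γ κ : ℝ) : ℕ :=
  max 1 ⌈(Real.log (1 / (κ * (1 - γ) ^ 2)) + Real.log 8) / (1 - γ) + 1⌉₊

/-- The parameter settings for the target accuracy `κ` and the failure probability `δ`. -/
def settings (m d : ℕ) (b γ κ δ : ℝ) : Params where
  K := itersOf γ κ
  n := ⌈(Real.log (4 * itersOf γ κ * cmaxOf m d b γ κ ^ 2) - Real.log δ) /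
    (2 * thetaOf m d b γ κ ^ 2 * (1 - γ) ^ 2)⌉₊
  H := ⌈(Real.log (32 * √(cmaxOf m d b γ κ) * (2 * (m : ℝ) - 1)) - Real.log (κ * (1 - γ) ^ 3)) /
    (1 - γ) - 1⌉₊
  τ := 1
  lam := lamOf m b γ κ
  disc := γ

/-- The factor `(1 + log (1 + b² ε⁻² d⁻¹))^{1/2}`. -/
def missFactor (d : ℕ) (b ε : ℝ) : ℝ := √(1 + Real.log (1 + b ^ 2 / (ε ^ 2 * d)))

/-- The target accuracy that is used for the misspecification level `ε`. -/
def kappaOf (m d : ℕ) (b γ ε : ℝ) : ℝ := 32 * ε * √d * m / (1 - γ) ^ 2 * missFactor d b ε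

end MCLSPI

end

/-! The core set stays small. An added pair has uncertainty above 1, so by the matrix determinant
lemma it more than doubles det V, while AM-GM on the eigenvalues bounds det V by (tr V / d)^d and
the trace grows by at most 1 per element. Hence every core set that occurs has at most C_max
elements (`CoreSet.Valid.length_le`). This bounds the passes of both unbounded loops, and
termination and the costs follow by deterministic counting.

In a state that passes the check, ridge regression on values with error 2θ + ε has error at most
√C_max (2θ + ε) + √λ b on every vector φ(s, a) whose a deviates from ā in at most one component
(`abs_leastSquares_sub_le`). By additivity each φ(s, a) is a sum of m such vectors minus (m - 1)
φ(s, ā), which costs a factor 2m - 1 (`abs_vec_dotProduct_le`). Together with one more ε this gives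
an error η for all actions.

In the other states the estimates are uncontrolled. The analysis therefore follows virtual policies:
`virtualPolicy` acts like the real greedy policy in certain states and maximizes the true Q-function
of the preceding virtual policy elsewhere. Rollouts that meet no uncertain state cannot tell the two
apart. `le_wp_rolloutFrom` expresses this without a coupling: when an uncertain outcome counts as a
success, the program does at least as well as the return law of any policy that agrees in the
certain states. So with high probability the same averages estimate the Q-functions of both the real
and the virtual policy. The virtual policies then perform approximate policy iteration on the whole
state space, and after k steps their gap is at most γ^k/(1-γ) + 2η/(1-γ)²
(`MDP.gap_of_approx_greedy`). The initial state ρ is certain, so there the real and the virtual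
policy have the same action law, and a single w approximates both Q-functions; their values at ρ
differ by at most 2η (`value_sub_le_of_agree`). This comparison uses up the K-th evaluation, which
is why π_{K-1} is returned.

The failure probability comes from Hoeffding's inequality and a union bound over at most C_max runs,
K iterations, C_max elements and two policies (`likely_confidentMCLSPI`, `fail_le`). The rest is
arithmetic: λ and θ are tuned so that the regularization bias and the estimation error are multiples
of κ(1-γ)²/32. In the misspecified case κ is proportional to εm√d/(1-γ)² up to a logarithm, so that
m cancels from the query bound. -/

open MeasureTheory ProbabilityTheory
open scoped ENNReal

namespace MCLSPI

universe u v w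

namespace Prog

variable {S : Type u} [MeasurableSpace S] {m : ℕ} {N : Fin m → ℕ} {d : ℕ} {α : Type v} {β : Type w}
  {M : MDP S (Act N)} {φ : Features S N d} {π₀ : Policy S (Act N)}

/-! ### Expectations of functions of the result -/

/-- The (lower) expectation of `F` at the result of a program. -/
noncomputable def wp (M : MDP S (Act N)) (φ : Features S N d) (π₀ : Policy S (Act N))
    (F : α → ℝ≥0∞) : Prog S N d α → ℝ≥0∞
  | ret x => F x
  | step k => k.wp M φ π₀ F
  | arith o x y k => (k (o.eval x y)).wp M φ π₀ F
  | less x y k => (k (decide (x < y))).wp M φ π₀ F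
  | feature s i a j k => (k (φ i s a j)).wp M φ π₀ F
  | sampleInit s k => ∫⁻ a, (k a).wp M φ π₀ F ∂(π₀.kernel s)
  | simulate s a k => ∫⁻ s', (k s' (M.reward (s, a))).wp M φ π₀ F ∂(M.trans (s, a))

theorem prob_eq_wp (E : Set α) (p : Prog S N d α) :
    p.prob M φ π₀ E = p.wp M φ π₀ (E.indicator 1) := by
  induction p with
  | ret x => rfl
  | step k ih => exact ih
  | arith o x y k ih => exact ih _
  | less x y k ih => exact ih _
  | feature s i a j k ih => exact ih _
  | sampleInit s k ih => simp only [prob, wp, ih]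
  | simulate s a k ih => simp only [prob, wp, ih]

theorem wp_bind (p : Prog S N d α) (f : α → Prog S N d β) (F : β → ℝ≥0∞) :
    (p.bind f).wp M φ π₀ F = p.wp M φ π₀ fun x => (f x).wp M φ π₀ F := by
  induction p with
  | ret x => rfl
  | step k ih => exact ih
  | arith o x y k ih => exact ih _
  | less x y k ih => exact ih _
  | feature s i a j k ih => exact ih _
  | sampleInit s k ih => simp only [bind, wp, ih]
  | simulate s a k ih => simp only [bind, wp, ih]

theorem always_bind (p : Prog S N d α) (f : α → Prog S N d β) (R : ℕ → ℕ → β → Prop) :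
    (p.bind f).Always M φ R ↔
      p.Always M φ fun t q x => (f x).Always M φ fun t' q' y => R (t + t') (q + q') y := by
  induction p generalizing R with
  | ret x => simp [bind, Always]
  | step k ih => simp [bind, Always, ih, Nat.add_right_comm]
  | arith o x y k ih => simp [bind, Always, ih, Nat.add_right_comm]
  | less x y k ih => simp [bind, Always, ih, Nat.add_right_comm]
  | feature s i a j k ih => simp [bind, Always, ih, Nat.add_right_comm]
  | sampleInit s k ih => simp [bind, Always, ih, Nat.add_right_comm]
  | simulate s a k ih => simp [bind, Always, ih, Nat.add_right_comm]

theorem Always.mono {p : Prog S N d α} {R R' : ℕ → ℕ → α → Prop} (h : p.Always M φ R)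
    (hR : ∀ t q x, R t q x → R' t q x) : p.Always M φ R' := by
  induction p generalizing R R' with
  | ret x => exact hR _ _ _ h
  | step k ih => exact ih h fun t q x => hR _ _ _
  | arith o x y k ih => exact ih _ h fun t q x => hR _ _ _
  | less x y k ih => exact ih _ h fun t q x => hR _ _ _
  | feature s i a j k ih => exact ih _ h fun t q x => hR _ _ _
  | sampleInit s k ih => exact fun a => ih _ (h a) fun t q x => hR _ _ _
  | simulate s a k ih => exact fun s' => ih _ _ (h s') fun t q x => hR _ _ _

/-- `Always` ranges over every possible answer of the simulator, so the comparison holds pointwise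
under each integral and no null sets occur. -/
theorem wp_mono_of_always {p : Prog S N d α} {F G : α → ℝ≥0∞} {A : α → Prop}
    (h : p.Always M φ fun _ _ x => A x) (hFG : ∀ x, A x → F x ≤ G x) :
    p.wp M φ π₀ F ≤ p.wp M φ π₀ G := by
  induction p with
  | ret x => exact hFG _ h
  | step k ih => exact ih h
  | arith o x y k ih => exact ih _ h
  | less x y k ih => exact ih _ h
  | feature s i a j k ih => exact ih _ h
  | sampleInit s k ih => exact lintegral_mono fun a => ih _ (h a)
  | simulate s a k ih => exact lintegral_mono fun s' => ih _ _ (h s')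

theorem wp_mono {p : Prog S N d α} {F G : α → ℝ≥0∞} (hFG : ∀ x, F x ≤ G x) :
    p.wp M φ π₀ F ≤ p.wp M φ π₀ G := by
  induction p with
  | ret x => exact hFG _
  | step k ih => exact ih
  | arith o x y k ih => exact ih _
  | less x y k ih => exact ih _
  | feature s i a j k ih => exact ih _
  | sampleInit s k ih => exact lintegral_mono fun a => ih _
  | simulate s a k ih => exact lintegral_mono fun s' => ih _ _

/-- An equality even for lower integrals, because the constant summand is measurable and the kernels
are Markov. It replaces the passage to complements in the union bound. -/
theorem wp_const_add (p : Prog S N d α) (c : ℝ≥0∞) (F : α → ℝ≥0∞) :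
    p.wp M φ π₀ (fun x => c + F x) = c + p.wp M φ π₀ F := by
  induction p with
  | ret x => rfl
  | step k ih => exact ih
  | arith o x y k ih => exact ih _
  | less x y k ih => exact ih _
  | feature s i a j k ih => exact ih _
  | sampleInit s k ih =>
    simp only [wp, ih]
    rw [lintegral_add_left measurable_const, lintegral_const, measure_univ, mul_one]
  | simulate s a k ih =>
    simp only [wp, ih]
    rw [lintegral_add_left measurable_const, lintegral_const, measure_univ, mul_one]

theorem wp_const (p : Prog S N d α) (c : ℝ≥0∞) : p.wp M φ π₀ (fun _ => c) = c := by
  induction p with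
  | ret x => rfl
  | step k ih => exact ih
  | arith o x y k ih => exact ih _
  | less x y k ih => exact ih _
  | feature s i a j k ih => exact ih _
  | sampleInit s k ih => simp [wp, ih]
  | simulate s a k ih => simp [wp, ih]

/-- No measurability is assumed, so only an inequality is claimed, here and for sums. Both point in
the direction that lower bounds on probabilities need. -/
theorem const_mul_wp_le (p : Prog S N d α) (c : ℝ≥0∞) (F : α → ℝ≥0∞) :
    c * p.wp M φ π₀ F ≤ p.wp M φ π₀ fun x => c * F x := by
  induction p with
  | ret x => exact le_rfl
  | step k ih => exact ih
  | arith o x y k ih => exact ih _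
  | less x y k ih => exact ih _
  | feature s i a j k ih => exact ih _
  | sampleInit s k ih =>
    exact (lintegral_const_mul_le _ _).trans (lintegral_mono fun a => ih a)
  | simulate s a k ih =>
    exact (lintegral_const_mul_le _ _).trans (lintegral_mono fun a => ih a _)

theorem wp_add_le (p : Prog S N d α) (F G : α → ℝ≥0∞) :
    p.wp M φ π₀ F + p.wp M φ π₀ G ≤ p.wp M φ π₀ fun x => F x + G x := by
  induction p with
  | ret x => exact le_rfl
  | step k ih => exact ih
  | arith o x y k ih => exact ih _
  | less x y k ih => exact ih _
  | feature s i a j k ih => exact ih _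
  | sampleInit s k ih =>
    exact (le_lintegral_add _ _).trans (lintegral_mono fun a => ih a)
  | simulate s a k ih =>
    exact (le_lintegral_add _ _).trans (lintegral_mono fun a => ih a _)

/-- If a program always returns `v`, then it can be replaced by `v` in expectations. -/
theorem wp_eq_of_always {p : Prog S N d α} {v : α} (h : p.Always M φ fun _ _ x => x = v)
    (F : α → ℝ≥0∞) : p.wp M φ π₀ F = F v := by
  rw [← wp_const (M := M) (φ := φ) (π₀ := π₀) p (F v)]
  exact le_antisymm (wp_mono_of_always h fun x hx => by rw [hx])
    (wp_mono_of_always h fun x hx => by rw [hx])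

/-! ### Lower bounds on probabilities -/

/-- The result of `p` has the property `A` with probability at least `1 - ε`. -/
def Likely (M : MDP S (Act N)) (φ : Features S N d) (π₀ : Policy S (Act N)) (p : Prog S N d α)
    (ε : ℝ) (A : α → Prop) : Prop :=
  ENNReal.ofReal (1 - ε) ≤ p.wp M φ π₀ ({x | A x}.indicator 1)

theorem Likely.mono {p : Prog S N d α} {ε ε' : ℝ} {A A' : α → Prop} (h : p.Likely M φ π₀ ε A)
    (hε : ε ≤ ε') (hA : ∀ x, A x → A' x) : p.Likely M φ π₀ ε' A' :=
  (ENNReal.ofReal_le_ofReal (by linarith)).trans <| h.trans <| wp_mono fun x =>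
    Set.indicator_le_indicator_of_subset (fun _ hx => hA _ hx) (fun _ => zero_le) x

theorem Likely.and_always {p : Prog S N d α} {ε : ℝ} {A B : α → Prop} (h : p.Likely M φ π₀ ε A)
    (hB : p.Always M φ fun _ _ x => B x) : p.Likely M φ π₀ ε fun x => A x ∧ B x := by
  refine h.trans (wp_mono_of_always hB fun x hx => ?_)
  by_cases hA : A x <;> simp [Set.indicator, hA, hx]

theorem likely_of_always {p : Prog S N d α} {A : α → Prop}
    (h : p.Always M φ fun _ _ x => A x) : p.Likely M φ π₀ 0 A := by
  have h1 : p.Likely M φ π₀ 0 fun _ => True := by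
    simp only [Likely, sub_zero, ENNReal.ofReal_one]
    refine le_trans (le_of_eq (wp_const (M := M) (φ := φ) (π₀ := π₀) p 1).symm) (wp_mono fun x => ?_)
    simp
  exact (h1.and_always h).mono le_rfl fun x hx => hx.2

/-- Union bound without complements: 1_A + 1_B ≤ 1 + 1_{A ∧ B} pointwise, and lower expectations are
superadditive. -/
theorem Likely.and {p : Prog S N d α} {ε ε' : ℝ} {A B : α → Prop} (h : p.Likely M φ π₀ ε A)
    (h' : p.Likely M φ π₀ ε' B) (hε : 0 ≤ ε) (hε' : 0 ≤ ε') :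
    p.Likely M φ π₀ (ε + ε') fun x => A x ∧ B x := by
  have h1 : ENNReal.ofReal (1 - ε) + ENNReal.ofReal (1 - ε') ≤
      1 + p.wp M φ π₀ ({x | A x ∧ B x}.indicator 1) := by
    rw [← wp_const_add]
    refine (add_le_add h h').trans ((wp_add_le _ _ _).trans (wp_mono fun x => ?_))
    by_cases hA : A x <;> by_cases hB : B x <;> simp [Set.indicator, hA, hB]
  unfold Likely
  by_cases h1' : 1 - (ε + ε') ≤ 0
  · rw [ENNReal.ofReal_of_nonpos h1']; exact zero_le
  push Not at h1'
  rw [← ENNReal.ofReal_add (by linarith) (by linarith)] at h1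
  have h2 : (1 : ℝ≥0∞) + ENNReal.ofReal (1 - (ε + ε')) ≤
      1 + p.wp M φ π₀ ({x | A x ∧ B x}.indicator 1) := by
    refine le_trans (le_of_eq ?_) h1
    rw [← ENNReal.ofReal_one, ← ENNReal.ofReal_add zero_le_one h1'.le]
    congr 1; ring
  exact (ENNReal.add_le_add_iff_left ENNReal.one_ne_top).1 h2

/-- Rests on (1 - ε)(1 - ε') ≥ 1 - (ε + ε'). Failure probabilities therefore add up along a program.
-/
theorem Likely.bind {p : Prog S N d α} {f : α → Prog S N d β} {ε ε' : ℝ} {A : α → Prop}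
    {B : β → Prop} (h : p.Likely M φ π₀ ε A) (h' : ∀ x, A x → (f x).Likely M φ π₀ ε' B)
    (hε : 0 ≤ ε) (hε' : 0 ≤ ε') : (p.bind f).Likely M φ π₀ (ε + ε') B := by
  unfold Likely
  rw [wp_bind]
  have h1 : ENNReal.ofReal (1 - ε') * ENNReal.ofReal (1 - ε) ≤
      p.wp M φ π₀ fun x => (f x).wp M φ π₀ ({x | B x}.indicator 1) := by
    refine (mul_le_mul_right h _).trans ((const_mul_wp_le _ _ _).trans (wp_mono fun x => ?_))
    by_cases hA : A x
    · have h3 := h' x hA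
      unfold Likely at h3
      simpa only [Set.indicator, Set.mem_ofPred_eq, hA, if_true, Pi.one_apply, mul_one] using h3
    · simp [Set.indicator, hA]
  refine le_trans ?_ h1
  by_cases h2 : 1 - (ε + ε') ≤ 0
  · rw [ENNReal.ofReal_of_nonpos h2]; exact zero_le
  push Not at h2
  rw [← ENNReal.ofReal_mul (by linarith)]
  exact ENNReal.ofReal_le_ofReal (by nlinarith)

/-! ### Specifications with bounds on the cost -/

/-- `p` always executes at most `T` instructions and `Q` queries, and returns an element with the
property `A`. -/
def Spec (M : MDP S (Act N)) (φ : Features S N d) (p : Prog S N d α) (T Q : ℕ) (A : α → Prop) :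
    Prop :=
  p.Always M φ fun t q x => t ≤ T ∧ q ≤ Q ∧ A x

theorem Spec.mono {p : Prog S N d α} {T Q T' Q' : ℕ} {A A' : α → Prop} (h : p.Spec M φ T Q A)
    (hT : T ≤ T') (hQ : Q ≤ Q') (hA : ∀ x, A x → A' x) : p.Spec M φ T' Q' A' :=
  Always.mono h fun _ _ _ hx => ⟨hx.1.trans hT, hx.2.1.trans hQ, hA _ hx.2.2⟩

theorem Spec.always {p : Prog S N d α} {T Q : ℕ} {A : α → Prop} (h : p.Spec M φ T Q A) :
    p.Always M φ fun _ _ x => A x :=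
  Always.mono h fun _ _ _ hx => hx.2.2

theorem spec_ret {x : α} {A : α → Prop} (h : A x) (T Q : ℕ) :
    (ret x : Prog S N d α).Spec M φ T Q A := ⟨zero_le, zero_le, h⟩

theorem Spec.step {k : Prog S N d α} {T Q : ℕ} {A : α → Prop} (h : k.Spec M φ T Q A) :
    (step k).Spec M φ (T + 1) Q A :=
  Always.mono (p := k) (R' := fun t q x => t + 1 ≤ T + 1 ∧ q ≤ Q ∧ A x) h
    fun _ _ _ hx => ⟨Nat.succ_le_succ hx.1, hx.2⟩

theorem spec_arith {o : Arith} {x y : ℝ} {k : ℝ → Prog S N d α} {T Q : ℕ} {A : α → Prop}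
    (h : (k (o.eval x y)).Spec M φ T Q A) : (arith o x y k).Spec M φ (T + 1) Q A :=
  Always.mono (p := k (o.eval x y)) (R' := fun t q x => t + 1 ≤ T + 1 ∧ q ≤ Q ∧ A x) h
    fun _ _ _ hx => ⟨Nat.succ_le_succ hx.1, hx.2⟩

theorem spec_less {x y : ℝ} {k : Bool → Prog S N d α} {T Q : ℕ} {A : α → Prop}
    (h : (k (decide (x < y))).Spec M φ T Q A) : (less x y k).Spec M φ (T + 1) Q A :=
  Always.mono (p := k (decide (x < y))) (R' := fun t q x => t + 1 ≤ T + 1 ∧ q ≤ Q ∧ A x) h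
    fun _ _ _ hx => ⟨Nat.succ_le_succ hx.1, hx.2⟩

theorem spec_feature {s : S} {i : Fin m} {a : Fin (N i)} {j : Fin d} {k : ℝ → Prog S N d α}
    {T Q : ℕ} {A : α → Prop} (h : (k (φ i s a j)).Spec M φ T Q A) :
    (feature s i a j k).Spec M φ (T + 1) Q A :=
  Always.mono (p := k (φ i s a j)) (R' := fun t q x => t + 1 ≤ T + 1 ∧ q ≤ Q ∧ A x) h
    fun _ _ _ hx => ⟨Nat.succ_le_succ hx.1, hx.2⟩

theorem spec_sampleInit {s : S} {k : Act N → Prog S N d α} {T Q : ℕ} {A : α → Prop}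
    (h : ∀ a, (k a).Spec M φ T Q A) : (sampleInit s k).Spec M φ (T + 1) Q A :=
  fun a => Always.mono (R' := fun t q x => t + 1 ≤ T + 1 ∧ q ≤ Q ∧ A x) (h a)
    fun _ _ _ hx => ⟨Nat.succ_le_succ hx.1, hx.2⟩

theorem spec_simulate {s : S} {a : Act N} {k : S → ℝ → Prog S N d α} {T Q : ℕ} {A : α → Prop}
    (h : ∀ s', (k s' (M.reward (s, a))).Spec M φ T Q A) :
    (simulate s a k).Spec M φ (T + 1) (Q + 1) A :=
  fun s' => Always.mono (R' := fun t q x => t + 1 ≤ T + 1 ∧ q + 1 ≤ Q + 1 ∧ A x) (h s')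
    fun _ _ _ hx =>
    ⟨Nat.succ_le_succ hx.1, Nat.succ_le_succ hx.2.1, hx.2.2⟩

theorem Spec.bind {p : Prog S N d α} {f : α → Prog S N d β} {T Q T' Q' : ℕ} {A : α → Prop}
    {B : β → Prop} (h : p.Spec M φ T Q A) (h' : ∀ x, A x → (f x).Spec M φ T' Q' B) :
    (p.bind f).Spec M φ (T + T') (Q + Q') B := by
  unfold Spec
  rw [always_bind]
  refine Always.mono h fun t q x hx => Always.mono (h' x hx.2.2) fun t' q' y hy => ?_
  exact ⟨add_le_add hx.1 hy.1, add_le_add hx.2.1 hy.2.1, hy.2.2⟩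

theorem spec_loop {n : ℕ} {body : Fin n → α → Prog S N d α} {T Q : ℕ} (I : ℕ → α → Prop)
    (h : ∀ (i : Fin n) x, I i x → (body i x).Spec M φ T Q (I (i + 1))) {x : α} (hx : I 0 x) :
    (loop n body x).Spec M φ (n * (T + 1)) (n * Q) (I n) := by
  induction n generalizing I x with
  | zero => exact spec_ret hx _ _
  | succ n ih =>
    refine (((h 0 x (by simpa using hx)).bind fun y hy =>
      ih (fun k => I (k + 1)) (fun i z hz => ?_) (by simpa using hy)).step).mono ?_ ?_ fun _ h => h
    · simpa using h i.succ z (by simpa using hz)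
    · ring_nf; exact le_rfl
    · ring_nf; exact le_rfl

theorem spec_loop_add {n : ℕ} {body : Fin n → ℝ → Prog S N d ℝ} {T : ℕ} (f : Fin n → ℝ)
    (h : ∀ i x, (body i x).Spec M φ T 0 fun y => y = x + f i) (x : ℝ) :
    (loop n body x).Spec M φ (n * (T + 1)) 0 fun y => y = x + ∑ i, f i := by
  induction n generalizing x with
  | zero => exact spec_ret (by simp) _ _
  | succ n ih =>
    refine (((h 0 x).bind (B := fun y => y = x + ∑ i, f i) fun y hy =>
      (ih (fun i => f i.succ) (fun i z => h i.succ z) y).mono le_rfl le_rfl fun z hz => ?_).step).mono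
      (by ring_nf; exact le_rfl) le_rfl fun _ h => h
    rw [hz, hy, Fin.sum_univ_succ, add_assoc]

theorem spec_tabulate {n : ℕ} {β : Fin n → Type} {f : ∀ i, Prog S N d (β i)} {T : ℕ}
    {R : ∀ i, β i → Prop} (h : ∀ i, (f i).Spec M φ T 0 (R i)) :
    (tabulate n β f).Spec M φ (n * (T + 1)) 0 fun g => ∀ i, R i (g i) := by
  induction n with
  | zero => exact spec_ret (fun i => i.elim0) _ _
  | succ n ih =>
    have h1 : ∀ x, R 0 x → ((tabulate n (fun i => β i.succ) fun i => f i.succ).bind fun g =>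
        ret (Fin.cons x g) : Prog S N d (∀ i, β i)).Spec M φ (n * (T + 1) + 0) (0 + 0)
          fun g => ∀ i, R i (g i) := fun x hx =>
      (ih fun i => h i.succ).bind fun g hg => spec_ret (Fin.cases hx hg) _ _
    exact ((h 0).bind h1).step.mono (by ring_nf; exact le_rfl) le_rfl fun _ h => h

theorem spec_firstSome {n : ℕ} {f : Fin n → Prog S N d (Option α)} {T : ℕ}
    {R : Fin n → Option α → Prop} (h : ∀ i, (f i).Spec M φ T 0 (R i)) :
    (firstSome n f).Spec M φ (n * (T + 1)) 0 fun o =>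
      (o = none ∧ ∀ i, R i none) ∨ ∃ i x, o = some x ∧ R i (some x) := by
  induction n with
  | zero =>
    exact spec_ret (M := M) (φ := φ) (x := none) (Or.inl ⟨rfl, fun i => i.elim0⟩) _ _
  | succ n ih =>
    have h1 : ∀ o, R 0 o → Spec (S := S) (N := N) (d := d) M φ (match o with
        | some x => ret (some x)
        | none => firstSome n fun i => f i.succ) (n * (T + 1)) 0
          fun o => (o = none ∧ ∀ i, R i none) ∨ ∃ i x, o = some x ∧ R i (some x) := by
      intro o ho
      match o, ho with
      | some x, ho => exact spec_ret (M := M) (φ := φ) (x := some x) (Or.inr ⟨0, x, rfl, ho⟩) _ _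
      | none, ho =>
        refine (ih fun i => h i.succ).mono le_rfl le_rfl fun o ho' => ?_
        rcases ho' with ⟨h1, h2⟩ | ⟨i, x, h1, h2⟩
        · exact Or.inl ⟨h1, fun i => Fin.cases ho h2 i⟩
        · exact Or.inr ⟨i.succ, x, h1, h2⟩
    exact ((h 0).bind h1).step.mono (by ring_nf; exact le_rfl) le_rfl fun _ h => h

end Prog

section Subroutines

open Prog Matrix

variable {S : Type u} [MeasurableSpace S] {m : ℕ} {N : Fin m → ℕ} {d : ℕ}
  {M : MDP S (Act N)} {φ : Features S N d}

/-! ### Linear algebra -/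

theorem spec_dot {n : ℕ} (x y : Fin n → ℝ) :
    (dot x y : Prog S N d ℝ).Spec M φ (n * 3) 0 fun z => z = x ⬝ᵥ y := by
  refine Spec.mono (spec_loop_add (T := 2) (fun i => x i * y i) (fun i acc => ?_) 0) le_rfl le_rfl
    fun z hz => by rw [hz, zero_add]; rfl
  exact spec_arith (spec_arith (spec_ret (by rfl) 0 0))

theorem spec_mulVec (B : Fin d → Fin d → ℝ) (x : Fin d → ℝ) :
    (Prog.mulVec B x : Prog S N d _).Spec M φ (d * (d * 3 + 1)) 0 fun y => y = of B *ᵥ x :=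
  (spec_tabulate fun i => spec_dot (B i) x).mono le_rfl le_rfl fun _ hy => funext hy

theorem spec_scalarInv (lam : ℝ) :
    (scalarInv lam : Prog S N d _).Spec M φ (d * (d * 2 + 1) + 1) 0
      fun B => of B = lam⁻¹ • (1 : Matrix (Fin d) (Fin d) ℝ) := by
  refine spec_arith ((spec_tabulate fun i => spec_tabulate fun j =>
    (spec_ret (A := fun x => x = if i = j then 1 / lam else 0) rfl 0 0).step).mono le_rfl le_rfl
      fun B hB => ?_)
  ext i j
  simp [hB, Matrix.one_apply]

/-- The rank-one update `B - (B x) (B x)ᵀ / (1 + xᵀ B x)`. -/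
noncomputable def rankOneUpdate (B : Fin d → Fin d → ℝ) (x : Fin d → ℝ) : Fin d → Fin d → ℝ :=
  fun i j => B i j - (of B *ᵥ x) i * (of B *ᵥ x) j / (1 + x ⬝ᵥ of B *ᵥ x)

theorem spec_rankOne (B : Fin d → Fin d → ℝ) (x : Fin d → ℝ) :
    (rankOne B x : Prog S N d _).Spec M φ
      (d * (d * 3 + 1) + (d * 3 + (d * (d * 4 + 1) + 1))) 0 fun B' => B' = rankOneUpdate B x := by
  refine Spec.bind (Q' := 0) (spec_mulVec B x) fun y hy => ?_
  refine Spec.bind (Q' := 0) (spec_dot x y) fun c hc => spec_arith ?_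
  subst hy hc
  refine Spec.mono (spec_tabulate (R := fun i y => y = rankOneUpdate B x i) fun i => Spec.mono
    (spec_tabulate (R := fun j z => z = rankOneUpdate B x i j) (T := 3) fun j => ?_) le_rfl le_rfl
    fun _ h => funext h) le_rfl le_rfl fun _ h => funext h
  exact spec_arith (spec_arith (spec_arith (spec_ret (by rfl) 0 0)))

/-- The coordinates of the feature vector `φ(s, a)`. -/
noncomputable def Features.vec (φ : Features S N d) (s : S) (a : Act N) : Fin d → ℝ :=
  fun j => ∑ i, φ i s (a i) j

theorem spec_featureVec (s : S) (a : Act N) :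
    (featureVec s a : Prog S N d _).Spec M φ (d * (m * 3 + 1)) 0 fun x => x = φ.vec s a := by
  refine Spec.mono (spec_tabulate (R := fun j x => x = φ.vec s a j) fun j => ?_) le_rfl le_rfl
    fun _ h => funext h
  refine Spec.mono (spec_loop_add (T := 2) (fun i => φ i s (a i) j) (fun i acc => ?_) 0) le_rfl
    le_rfl fun x hx => by rw [hx, zero_add]; rfl
  exact spec_feature (spec_arith (spec_ret (by rfl) 0 0))

/-! ### Core sets -/

/-- The core set with one more element. -/
noncomputable def CoreSet.push (C : CoreSet S N d) (z : CoreElem S N d) : CoreSet S N d :=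
  ⟨C.elems ++ [z], rankOneUpdate C.inv z.feat⟩

/-- The cost of a rank-one update. -/
def insertCost (d : ℕ) : ℕ := d * (d * 3 + 1) + (d * 3 + (d * (d * 4 + 1) + 1))

theorem spec_insert (C : CoreSet S N d) (z : CoreElem S N d) :
    (C.insert z).Spec M φ (insertCost d) 0 fun C' => C' = C.push z :=
  (spec_rankOne C.inv z.feat).bind (T' := 0) (Q' := 0) fun B hB =>
    spec_ret (by rw [hB]; rfl) _ _

/-- All action vectors that differ from `abar` in at most one component have small uncertainty. -/
def Certain (φ : Features S N d) (abar : Act N) (τ : ℝ) (C : CoreSet S N d) (s : S) : Prop :=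
  ∀ i a, φ.vec s (Function.update abar i a) ⬝ᵥ of C.inv *ᵥ φ.vec s (Function.update abar i a) ≤ τ

/-- A core set element that is tagged with its feature vector and has large uncertainty. -/
def IsUncertain (φ : Features S N d) (τ : ℝ) (C : CoreSet S N d) (z : CoreElem S N d) : Prop :=
  z.feat = φ.vec z.state z.action ∧ τ < z.feat ⬝ᵥ of C.inv *ᵥ z.feat

/-- The cost of an uncertainty check, when there are `A` actions. -/
def checkCost (m d A : ℕ) : ℕ :=
  m * (A * (d * (m * 3 + 1) + (d * (d * 3 + 1) + (d * 3 + 1)) + 1) + 1)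

/-- The outcome decides certainty exactly. That `none` implies certainty is needed for accuracy at
ρ; that a pair is found only in states that are not certain is needed so that rollouts never stop in
certain states. -/
theorem spec_uncertaintyCheck {A : ℕ} (hA : ∀ i, N i ≤ A) (abar : Act N) (τ : ℝ)
    (C : CoreSet S N d) (s : S) :
    (uncertaintyCheck abar τ C s).Spec M φ (checkCost m d A) 0 fun o =>
      (o = none ∧ Certain φ abar τ C s) ∨
        ∃ z, o = some z ∧ IsUncertain φ τ C z ∧ ¬ Certain φ abar τ C s := by
  have h1 : ∀ i a, ((featureVec s (Function.update abar i a)).bind fun x =>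
      (Prog.mulVec C.inv x).bind fun y => (dot x y).bind fun g =>
      less τ g fun c => ret (if c then some ⟨s, Function.update abar i a, x⟩ else none) :
        Prog S N d (Option (CoreElem S N d))).Spec M φ
      (d * (m * 3 + 1) + (d * (d * 3 + 1) + (d * 3 + 1))) 0 fun o =>
        (o = none ∧ φ.vec s (Function.update abar i a) ⬝ᵥ
          of C.inv *ᵥ φ.vec s (Function.update abar i a) ≤ τ) ∨
        (∃ z, o = some z ∧ IsUncertain φ τ C z ∧ ¬ Certain φ abar τ C s) := by
    intro i a
    refine (spec_featureVec s _).bind (Q' := 0) fun x hx => ?_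
    refine (spec_mulVec C.inv x).bind (Q' := 0) fun y hy => ?_
    refine (spec_dot x y).bind (Q' := 0) fun g hg => spec_less ?_
    refine spec_ret ?_ 0 0
    subst hx hy hg
    by_cases h : τ < φ.vec s (Function.update abar i a) ⬝ᵥ
        of C.inv *ᵥ φ.vec s (Function.update abar i a)
    · refine Or.inr ⟨_, by rw [if_pos (by simpa using h)], ⟨rfl, h⟩, fun hc => ?_⟩
      exact absurd (hc i a) (not_le.2 h)
    · exact Or.inl ⟨by rw [if_neg (by simpa using h)], not_lt.1 h⟩
  refine (spec_firstSome fun i => (spec_firstSome (h1 i)).mono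
    (Nat.mul_le_mul_right _ (hA i)) le_rfl fun _ h => h).mono le_rfl le_rfl ?_
  rintro o (⟨rfl, h⟩ | ⟨i, x, rfl, h⟩)
  · refine Or.inl ⟨rfl, fun i a => ?_⟩
    rcases h i with ⟨-, h⟩ | ⟨i, x, h, -⟩
    · rcases h a with ⟨-, h⟩ | ⟨z, h, -⟩
      · exact h
      · cases h
    · cases h
  · rcases h with ⟨h, -⟩ | ⟨a, x', h, h'⟩
    · cases h
    · cases h
      rcases h' with ⟨h', -⟩ | ⟨z, h', h2⟩
      · cases h'
      · exact Or.inr ⟨z, h', h2⟩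

/-! ### Greedy actions -/

theorem firstArgmax_spec {n : ℕ} [NeZero n] (f : Fin n → ℝ) (a : Fin n) :
    f a ≤ f (firstArgmax f) := by
  have h := Finset.min'_mem (Finset.univ.filter fun a => ∀ a', f a' ≤ f a) (by
    obtain ⟨a, -, ha⟩ := Finset.exists_max_image Finset.univ f ⟨0, Finset.mem_univ _⟩
    exact ⟨a, by simpa using fun a' => ha a' (Finset.mem_univ _)⟩)
  exact (Finset.mem_filter.1 h).2 a

theorem eq_firstArgmax {n : ℕ} [NeZero n] {f : Fin n → ℝ} {a : Fin n} (h : ∀ c, f c ≤ f a)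
    (h' : ∀ c < a, f c < f a) : a = firstArgmax f := by
  refine (le_antisymm ?_ ?_)
  · by_contra hlt
    exact absurd (firstArgmax_spec f a) (not_le.2 (h' _ (not_le.1 hlt)))
  · exact Finset.min'_le _ _ (by simpa using h)

/-- The cost of computing a greedy action vector, when there are `A` actions. -/
def greedyCost (m d A : ℕ) : ℕ := m * (d * 4 + (A * (d * 4 + 1 + 1)) + 1)

theorem spec_greedyProg [∀ i, NeZero (N i)] {A : ℕ} (hA : ∀ i, N i ≤ A) (w : Fin d → ℝ) (s : S) :
    (greedyProg w s : Prog S N d (Act N)).Spec M φ (greedyCost m d A) 0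
      fun a => a = greedyAction φ w s := by
  refine (spec_tabulate (R := fun i a => a = greedyAction φ w s i) fun i => ?_).mono le_rfl le_rfl
    fun a ha => funext ha
  set f : Fin (N i) → ℝ := fun a => ∑ j, w j * φ i s a j with hf
  have hscore : ∀ a : Fin (N i), (loop d (fun j acc => feature s i a j fun x =>
      arith .mul (w j) x fun p => arith .add acc p ret) 0 : Prog S N d ℝ).Spec M φ (d * 4) 0
      fun v => v = f a := by
    intro a
    refine Spec.mono (spec_loop_add (T := 3) (fun j => w j * φ i s a j) (fun j acc => ?_) 0) le_rfl
      le_rfl fun v hv => by rw [hv, zero_add]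
    exact spec_feature (spec_arith (spec_arith (spec_ret (by rfl) 0 0)))
  refine (hscore 0).bind (Q' := 0) fun v₀ hv₀ => ?_
  -- Loop invariant: the stored score belongs to the stored action, bounds all scores seen so far,
  -- and strictly exceeds those of smaller indices. The last clause, kept up by the strict
  -- comparison, makes the program break ties like `firstArgmax`.
  refine (Spec.bind (T' := 0) (Q' := 0) (spec_loop (T := d * 4 + 1) (Q := 0)
    (fun k best => best.2 = f best.1 ∧ (∀ c : Fin (N i), (c : ℕ) < k → f c ≤ best.2) ∧
      ∀ c < best.1, f c < best.2) (fun a best hb => ?_) ?_) fun best hb => spec_ret ?_ _ _).mono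
      (Nat.mul_le_mul_right _ (hA i)) (by simp) fun _ h => h
  · refine (hscore a).bind (Q' := 0) fun v hv => spec_less (spec_ret ?_ 0 0)
    subst hv
    obtain ⟨h1, h2, h3⟩ := hb
    by_cases h : best.2 < f a
    · rw [if_pos (by simpa using h)]
      refine ⟨rfl, fun c hc => ?_, fun c hc => (h2 c hc).trans_lt h⟩
      rcases Nat.lt_succ_iff_lt_or_eq.1 hc with hc | hc
      · exact (h2 c hc).trans h.le
      · rw [Fin.ext hc]
    · rw [if_neg (by simpa using h)]
      refine ⟨h1, fun c hc => ?_, h3⟩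
      rcases Nat.lt_succ_iff_lt_or_eq.1 hc with hc | hc
      · exact h2 c hc
      · rw [Fin.ext hc]; exact not_lt.1 h
  · exact ⟨hv₀, fun c hc => absurd hc (Nat.not_lt_zero _), fun c hc => absurd hc (Fin.not_lt_zero c)⟩
  · obtain ⟨h1, h2, h3⟩ := hb
    rw [h1] at h2 h3
    exact eq_firstArgmax (fun c => h2 c c.2) h3

theorem spec_draw [∀ i, NeZero (N i)] {A : ℕ} (hA : ∀ i, N i ≤ A) (π : PolicyCode d) (s : S) :
    (π.draw s : Prog S N d (Act N)).Spec M φ (greedyCost m d A + 1) 0 fun _ => True := by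
  cases π with
  | init => exact (spec_sampleInit fun a => by exact spec_ret trivial 0 0).mono (by omega) le_rfl fun _ h => h
  | greedy w => exact (spec_greedyProg hA w s).mono (by omega) le_rfl fun _ _ => trivial

/-! ### The moment vector -/

theorem spec_momentVec (l : List (CoreElem S N d × ℝ)) :
    (momentVec l : Prog S N d _).Spec M φ (d + l.length * (d * 3 + 1)) 0
      fun y => y = (l.map fun p => p.2 • p.1.feat).sum := by
  induction l with
  | nil =>
    refine Spec.mono (spec_tabulate (T := 0) (R := fun _ x => x = 0) fun i => ?_)
      (by simp) le_rfl fun y hy => ?_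
    · exact spec_ret (by rfl) 0 0
    ext i; simp [hy]
  | cons p l ih =>
    obtain ⟨z, q⟩ := p
    refine ((ih.bind (Q' := 0) fun y hy => ?_).step).mono (T := d + l.length * (d * 3 + 1) + d * 3 + 1)
      (by simp only [List.length_cons]; ring_nf; exact le_rfl) le_rfl fun _ h => h
    refine (spec_tabulate fun j => spec_arith (spec_arith
      (spec_ret (A := fun x => x = y j + q * z.feat j) (by rfl) 0 0))).mono le_rfl le_rfl fun y' hy' => ?_
    ext j
    rw [hy' j, hy]
    simp [add_comm]

end Subroutines

/-! ### Values through the marginal laws of the state-action chain, and the Bellman equation -/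

section Values

variable {S : Type u} {A : Type v} [MeasurableSpace S] [MeasurableSpace A] (M : MDP S A)
  (π : Policy S A)

theorem integrable_of_abs_le {Ω : Type*} [MeasurableSpace Ω] {μ : Measure Ω} [IsFiniteMeasure μ]
    {f : Ω → ℝ} (hf : Measurable f) {B : ℝ} (hB : ∀ x, |f x| ≤ B) : Integrable f μ :=
  Integrable.of_bound hf.aestronglyMeasurable B (Filter.Eventually.of_forall hB)

theorem abs_integral_le_of_abs_le {Ω : Type*} [MeasurableSpace Ω] {μ : Measure Ω}
    [IsProbabilityMeasure μ] {f : Ω → ℝ} {B : ℝ} (hB : ∀ x, |f x| ≤ B) : |∫ x, f x ∂μ| ≤ B := by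
  simpa using norm_integral_le_of_norm_le_const (μ := μ) (f := f) (C := B)
    (Filter.Eventually.of_forall hB)

/-- One step of the Markov chain of state-action pairs. -/
noncomputable def MDP.stepKernel : Kernel (S × A) (S × A) := π.pair ∘ₖ M.trans

instance : IsMarkovKernel (M.stepKernel π) := by unfold MDP.stepKernel; infer_instance

/-- The law of the state-action pair at time `t`, as a function of the initial state. -/
noncomputable def MDP.law : ℕ → Kernel S (S × A)
  | 0 => π.pair
  | t + 1 => M.stepKernel π ∘ₖ MDP.law t

instance (t : ℕ) : IsMarkovKernel (M.law π t) := by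
  induction t with
  | zero => unfold MDP.law; infer_instance
  | succ t ih => unfold MDP.law; infer_instance

/-- `law` appends the last transition; the Bellman equation has to split off the first one. -/
theorem MDP.law_succ' (t : ℕ) : M.law π (t + 1) = M.law π t ∘ₖ (M.trans ∘ₖ π.pair) := by
  induction t with
  | zero => simp only [MDP.law, MDP.stepKernel, Kernel.comp_assoc]
  | succ t ih =>
    change M.stepKernel π ∘ₖ M.law π (t + 1) = (M.stepKernel π ∘ₖ M.law π t) ∘ₖ _
    rw [ih, Kernel.comp_assoc]

/-- The value involves the trajectory one time at a time, so marginals suffice. As `pairKernel`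
reads only the last entry of the history, the marginal at time t + 1 is one kernel step applied to
the marginal at time t. -/
theorem MDP.trajectory_map (s : S) (t : ℕ) :
    (M.trajectory π s).map (fun ω => ω t) = M.law π t s := by
  induction t with
  | zero =>
    rw [MDP.trajectory, Kernel.trajMeasure]
    have h1 : (fun ω : ℕ → S × A => ω 0) = (fun h : (∀ _ : Finset.Iic 0, S × A) =>
        h ⟨0, Finset.mem_Iic.2 le_rfl⟩) ∘ Preorder.frestrictLe (π := fun _ => S × A) 0 := rfl
    rw [h1, ← Measure.map_map (by fun_prop) (by fun_prop), Measure.map_comp _ _ (by fun_prop),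
      Kernel.traj_map_frestrictLe, Kernel.partialTraj_self, Measure.id_comp,
      Measure.map_map (by fun_prop) (by fun_prop)]
    exact Measure.map_id
  | succ t ih =>
    have h := congrArg Measure.snd (Kernel.map_frestrictLe_trajMeasure_compProd_eq_map_trajMeasure
      (X := fun _ => S × A) (μ₀ := π.pair s) (κ := M.pairKernel π) (a := t))
    rw [Measure.snd_compProd, Measure.snd, Measure.map_map (by fun_prop) (by fun_prop)] at h
    have h2 : (Prod.snd ∘ fun x : ℕ → S × A =>
        (Preorder.frestrictLe (π := fun _ => S × A) t x, x (t + 1))) = fun ω => ω (t + 1) := rfl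
    rw [h2] at h
    change Measure.map (fun ω : ℕ → S × A => ω (t + 1)) (Kernel.trajMeasure _ _) = _
    rw [← h, MDP.law, Kernel.comp_apply, ← ih, MDP.trajectory]
    have h3 : (fun ω : ℕ → S × A => ω t) = (fun h : (∀ _ : Finset.Iic t, S × A) =>
        h ⟨t, Finset.mem_Iic.2 le_rfl⟩) ∘ Preorder.frestrictLe (π := fun _ => S × A) t := rfl
    rw [h3, ← Measure.map_map (by fun_prop) (by fun_prop)]
    set μ := Measure.map (Preorder.frestrictLe (π := fun _ => S × A) t)
      (Kernel.trajMeasure (X := fun _ => S × A) (π.pair s) (M.pairKernel π))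
    ext B hB
    rw [Measure.bind_apply hB (Kernel.aemeasurable _), Measure.bind_apply hB (Kernel.aemeasurable _)]
    have h4 : Measurable fun h : (∀ _ : Finset.Iic t, S × A) => h ⟨t, Finset.mem_Iic.2 le_rfl⟩ :=
      measurable_pi_apply _
    exact (lintegral_map (Kernel.measurable_coe (M.stepKernel π) hB) h4).symm

theorem MDP.abs_reward_le (x : S × A) : |M.reward x| ≤ 1 :=
  abs_le.2 ⟨by linarith [M.reward_nonneg x], M.reward_le_one x⟩

theorem MDP.one_sub_disc_pos : 0 < 1 - M.disc := sub_pos.2 M.disc_lt_one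

/-- The expected reward at time `t`. -/
noncomputable def MDP.meanReward (t : ℕ) (s : S) : ℝ := ∫ x, M.reward x ∂(M.law π t s)

theorem MDP.measurable_meanReward (t : ℕ) : Measurable (M.meanReward π t) :=
  (M.measurable_reward.stronglyMeasurable.integral_kernel).measurable

theorem MDP.meanReward_nonneg (t : ℕ) (s : S) : 0 ≤ M.meanReward π t s :=
  integral_nonneg M.reward_nonneg

theorem MDP.meanReward_le_one (t : ℕ) (s : S) : M.meanReward π t s ≤ 1 :=
  (le_abs_self _).trans (abs_integral_le_of_abs_le M.abs_reward_le)

theorem MDP.summable_meanReward (s : S) : Summable fun t => M.disc ^ t * M.meanReward π t s :=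
  Summable.of_nonneg_of_le
    (fun t => mul_nonneg (pow_nonneg M.disc_nonneg _) (M.meanReward_nonneg π t s))
    (fun t => mul_le_of_le_one_right (pow_nonneg M.disc_nonneg _) (M.meanReward_le_one π t s))
    (summable_geometric_of_lt_one M.disc_nonneg M.disc_lt_one)

/-- Fubini, with the geometric series as dominating series. Boundedness and measurability of the
value are read off from this form. -/
theorem MDP.value_eq_tsum (s : S) : M.value π s = ∑' t, M.disc ^ t * M.meanReward π t s := by
  have : IsProbabilityMeasure (M.trajectory π s) := by unfold MDP.trajectory; infer_instance
  have hm : ∀ t, Measurable fun ω : ℕ → S × A => M.disc ^ t * M.reward (ω t) := fun t =>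
    (M.measurable_reward.comp (measurable_pi_apply t)).const_mul _
  have hb : ∀ t, ∀ ω : ℕ → S × A, |M.disc ^ t * M.reward (ω t)| ≤ M.disc ^ t := fun t ω => by
    rw [abs_mul, abs_of_nonneg (pow_nonneg M.disc_nonneg t)]
    exact mul_le_of_le_one_right (pow_nonneg M.disc_nonneg _) (M.abs_reward_le _)
  rw [MDP.value, ← integral_tsum_of_summable_integral_norm]
  · refine tsum_congr fun t => ?_
    rw [integral_const_mul, MDP.meanReward, ← MDP.trajectory_map, integral_map
      (measurable_pi_apply t).aemeasurable M.measurable_reward.aestronglyMeasurable]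
  · exact fun t => integrable_of_abs_le (hm t) (hb t)
  · refine Summable.of_nonneg_of_le (fun t => integral_nonneg fun _ => norm_nonneg _) (fun t => ?_)
      (summable_geometric_of_lt_one M.disc_nonneg M.disc_lt_one)
    refine (le_abs_self _).trans (abs_integral_le_of_abs_le fun ω => ?_)
    rw [abs_norm]; exact hb t ω

theorem MDP.value_nonneg (s : S) : 0 ≤ M.value π s := by
  rw [MDP.value_eq_tsum]
  exact tsum_nonneg fun t => mul_nonneg (pow_nonneg M.disc_nonneg _) (M.meanReward_nonneg π t s)

theorem MDP.value_le (s : S) : M.value π s ≤ 1 / (1 - M.disc) := by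
  rw [MDP.value_eq_tsum, one_div, ← tsum_geometric_of_lt_one M.disc_nonneg M.disc_lt_one]
  exact Summable.tsum_le_tsum
    (fun t => mul_le_of_le_one_right (pow_nonneg M.disc_nonneg _) (M.meanReward_le_one π t s))
    (M.summable_meanReward π s) (summable_geometric_of_lt_one M.disc_nonneg M.disc_lt_one)

theorem MDP.abs_value_le (s : S) : |M.value π s| ≤ 1 / (1 - M.disc) := by
  rw [abs_of_nonneg (M.value_nonneg π s)]; exact M.value_le π s

theorem MDP.measurable_value : Measurable (M.value π) := by
  have h : M.value π = fun s => ∑' t, M.disc ^ t * M.meanReward π t s :=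
    funext fun s => M.value_eq_tsum π s
  rw [h]
  refine measurable_of_tendsto_metrizable (f := fun n s => ∑ t ∈ Finset.range n,
    M.disc ^ t * M.meanReward π t s) (fun n => ?_) ?_
  · exact Finset.measurable_sum _ fun t _ => (M.measurable_meanReward π t).const_mul _
  · exact tendsto_pi_nhds.2 fun s => (M.summable_meanReward π s).hasSum.tendsto_sum_nat

theorem MDP.measurable_qValue : Measurable fun x : S × A => M.qValue π x.1 x.2 :=
  M.measurable_reward.add
    ((((M.measurable_value π).stronglyMeasurable.integral_kernel (κ := M.trans)).measurable).const_mul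
      M.disc)

theorem MDP.qValue_nonneg (s : S) (a : A) : 0 ≤ M.qValue π s a :=
  add_nonneg (M.reward_nonneg _)
    (mul_nonneg M.disc_nonneg (integral_nonneg fun s' => M.value_nonneg π s'))

theorem MDP.qValue_le (s : S) (a : A) : M.qValue π s a ≤ 1 / (1 - M.disc) := by
  have h1 : ∫ s', M.value π s' ∂(M.trans (s, a)) ≤ 1 / (1 - M.disc) :=
    (le_abs_self _).trans (abs_integral_le_of_abs_le (M.abs_value_le π))
  have h2 := mul_le_mul_of_nonneg_left h1 M.disc_nonneg
  have h3 : 1 + M.disc * (1 / (1 - M.disc)) = 1 / (1 - M.disc) := by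
    have := M.one_sub_disc_pos.ne'
    field_simp; ring
  unfold MDP.qValue
  linarith [M.reward_le_one (s, a)]

theorem MDP.abs_qValue_le (s : S) (a : A) : |M.qValue π s a| ≤ 1 / (1 - M.disc) := by
  rw [abs_of_nonneg (M.qValue_nonneg π s a)]; exact M.qValue_le π s a

theorem Policy.pair_apply (s : S) : π.pair s = (π.kernel s).map (Prod.mk s) := by
  rw [Policy.pair, Kernel.prod_apply, Kernel.id_apply, Measure.dirac_prod]

/-- The Bellman equation. -/
theorem MDP.value_eq_integral_qValue (s : S) :
    M.value π s = ∫ a, M.qValue π s a ∂(π.kernel s) := by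
  have h1 : ∫ a, M.qValue π s a ∂(π.kernel s) = ∫ x, M.qValue π x.1 x.2 ∂(π.pair s) := by
    rw [Policy.pair_apply, integral_map (by fun_prop) (M.measurable_qValue π).aestronglyMeasurable]
  have h2 : ∫ x, M.qValue π x.1 x.2 ∂(π.pair s) = ∫ x, M.reward x ∂(π.pair s) +
      M.disc * ∫ s', M.value π s' ∂((M.trans ∘ₖ π.pair) s) := by
    rw [Kernel.integral_comp (integrable_of_abs_le (M.measurable_value π) (M.abs_value_le π)),
      ← integral_const_mul]
    refine integral_add (integrable_of_abs_le M.measurable_reward M.abs_reward_le)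
      (Integrable.const_mul (integrable_of_abs_le (B := 1 / (1 - M.disc)) ?_ fun x => ?_) _)
    · exact ((M.measurable_value π).stronglyMeasurable.integral_kernel (κ := M.trans)).measurable
    · exact abs_integral_le_of_abs_le (M.abs_value_le π)
  -- The expected value after one transition is the series of mean rewards shifted by one.
  have h3 : ∫ s', M.value π s' ∂((M.trans ∘ₖ π.pair) s) =
      ∑' t, M.disc ^ t * M.meanReward π (t + 1) s := by
    simp_rw [MDP.value_eq_tsum]
    rw [← integral_tsum_of_summable_integral_norm]
    · refine tsum_congr fun t => ?_
      rw [integral_const_mul, MDP.meanReward, MDP.law_succ', Kernel.integral_comp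
        (integrable_of_abs_le M.measurable_reward M.abs_reward_le)]
      rfl
    · exact fun t => (integrable_of_abs_le (B := 1) (M.measurable_meanReward π t) fun s => by
        rw [abs_of_nonneg (M.meanReward_nonneg π t s)]
        exact M.meanReward_le_one π t s).const_mul _
    · refine Summable.of_nonneg_of_le (fun t => integral_nonneg fun _ => norm_nonneg _) (fun t => ?_)
        (summable_geometric_of_lt_one M.disc_nonneg M.disc_lt_one)
      refine (le_abs_self _).trans (abs_integral_le_of_abs_le fun s => ?_)
      rw [abs_norm, Real.norm_eq_abs, abs_mul, abs_of_nonneg (pow_nonneg M.disc_nonneg t),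
        abs_of_nonneg (M.meanReward_nonneg π t s)]
      exact mul_le_of_le_one_right (pow_nonneg M.disc_nonneg _) (M.meanReward_le_one π t s)
  rw [h1, h2, h3, MDP.value_eq_tsum, (M.summable_meanReward π s).tsum_eq_zero_add, ← tsum_mul_left]
  congr 1
  · simp [MDP.meanReward, MDP.law]
  · exact tsum_congr fun t => by rw [pow_succ]; ring

/-! ### Approximate policy improvement -/

theorem MDP.integrable_qValue (s : S) (μ : Measure A) [IsFiniteMeasure μ] :
    Integrable (fun a => M.qValue π s a) μ :=
  integrable_of_abs_le ((M.measurable_qValue π).comp measurable_prodMk_left)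
    fun a => M.abs_qValue_le π s a

theorem MDP.integrable_value (μ : Measure S) [IsFiniteMeasure μ] : Integrable (M.value π) μ :=
  integrable_of_abs_le (M.measurable_value π) (M.abs_value_le π)

variable {M π}

theorem MDP.qValue_sub_le {π' : Policy S A} {B : ℝ} (h : ∀ s, M.value π s - M.value π' s ≤ B)
    (s : S) (a : A) : M.qValue π s a ≤ M.qValue π' s a + M.disc * B := by
  have h1 : ∫ s', M.value π s' ∂(M.trans (s, a)) ≤ ∫ s', (M.value π' s' + B) ∂(M.trans (s, a)) :=
    integral_mono (M.integrable_value π _) ((M.integrable_value π' _).add (integrable_const _))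
      fun s' => by linarith [h s']
  rw [integral_add (M.integrable_value π' _) (integrable_const _)] at h1
  simp only [integral_const, probReal_univ, smul_eq_mul, one_mul] at h1
  have h2 := mul_le_mul_of_nonneg_left h1 M.disc_nonneg
  unfold MDP.qValue
  linarith

theorem MDP.integral_qValue_sub_le {π' : Policy S A} {B : ℝ}
    (h : ∀ s, M.value π s - M.value π' s ≤ B) (s : S) (μ : Measure A) [IsProbabilityMeasure μ] :
    ∫ a, M.qValue π s a ∂μ ≤ ∫ a, M.qValue π' s a ∂μ + M.disc * B := by
  have h1 : ∫ a, M.qValue π s a ∂μ ≤ ∫ a, (M.qValue π' s a + M.disc * B) ∂μ :=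
    integral_mono (M.integrable_qValue π s _)
      ((M.integrable_qValue π' s _).add (integrable_const _)) fun a => MDP.qValue_sub_le h s a
  rwa [integral_add (M.integrable_qValue π' s _) (integrable_const _), integral_const,
    probReal_univ, one_smul] at h1

/-- If `π'` improves on `π` in one step up to `c`, then its value is smaller by at most
`c / (1 - γ)`. -/
theorem MDP.value_sub_le_of_one_step {π' : Policy S A} {c : ℝ}
    (h : ∀ s, M.value π s ≤ ∫ a, M.qValue π s a ∂(π'.kernel s) + c) (s : S) :
    M.value π s - M.value π' s ≤ c / (1 - M.disc) := by
  have hbdd : BddAbove (Set.range fun s => M.value π s - M.value π' s) := by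
    refine ⟨1 / (1 - M.disc), ?_⟩
    rintro _ ⟨s, rfl⟩
    linarith [M.value_le π s, M.value_nonneg π' s]
  set B := ⨆ s, (M.value π s - M.value π' s) with hB
  have h1 : ∀ s, M.value π s - M.value π' s ≤ B := fun s => le_ciSup hbdd s
  have : Nonempty S := ⟨s⟩
  -- The supremum B of the value differences is finite, and one step under π' reproduces it with the
  -- factor γ; solving for B gives c / (1 - γ).
  have h2 : B ≤ c + M.disc * B := ciSup_le fun s => by
    have := MDP.integral_qValue_sub_le h1 s (π'.kernel s)
    rw [← M.value_eq_integral_qValue π'] at this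
    linarith [h s]
  refine (h1 s).trans ?_
  rw [le_div_iff₀ M.one_sub_disc_pos]
  linarith

/-- Approximate policy improvement: if `π'` is greedy with respect to `Q_π` up to `c`, then the
distance to the best policy contracts up to `c / (1 - γ)`. -/
theorem MDP.gap_of_approx_greedy {π' : Policy S A} {c D : ℝ}
    (h : ∀ s a, M.qValue π s a ≤ ∫ a', M.qValue π s a' ∂(π'.kernel s) + c)
    (hD : ∀ (π₂ : Policy S A) s, M.value π₂ s - M.value π s ≤ D) (π₂ : Policy S A) (s : S) :
    M.value π₂ s - M.value π' s ≤ M.disc * D + c / (1 - M.disc) := by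
  have hle : ∀ s (μ : Measure A) [IsProbabilityMeasure μ],
      ∫ a, M.qValue π s a ∂μ ≤ ∫ a', M.qValue π s a' ∂(π'.kernel s) + c := fun s μ _ => by
    have := integral_mono (M.integrable_qValue π s μ) (integrable_const _) fun a => h s a
    simpa using this
  have h1 := MDP.value_sub_le_of_one_step (π := π) (π' := π') (c := c) fun s => by
    rw [M.value_eq_integral_qValue π]; exact hle s _
  -- Replacing Q_π' by Q_π under π' loses γ c/(1-γ), passing from the action law of π' to that of π₂
  -- loses c, and replacing Q_π by Q_π₂ loses γ D.
  have h2 := MDP.integral_qValue_sub_le h1 s (π'.kernel s)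
  rw [← M.value_eq_integral_qValue π'] at h2
  have h3 := MDP.integral_qValue_sub_le (hD π₂) s (π₂.kernel s)
  rw [← M.value_eq_integral_qValue π₂] at h3
  have h4 := hle s (π₂.kernel s)
  have h5 : c + M.disc * (c / (1 - M.disc)) = c / (1 - M.disc) := by
    have := M.one_sub_disc_pos.ne'
    field_simp; ring
  linarith

/-- All gap bounds hold against an arbitrary competitor, so the existence of an optimal policy is
never needed. -/
theorem MDP.optValue_sub_le [Nonempty (Policy S A)] {s : S} {D x : ℝ}
    (h : ∀ π₂ : Policy S A, M.value π₂ s - x ≤ D) : M.optValue s - x ≤ D := by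
  have : M.optValue s ≤ D + x := ciSup_le fun π₂ => by linarith [h π₂]
  linarith

end Values

open Matrix

/-! ### Regularized Gram matrices: rank-one updates, determinant growth, ridge regression -/

section LinearAlgebra

variable {d : ℕ}

theorem abs_dotProduct_le {n : ℕ} (x y : Fin n → ℝ) : |x ⬝ᵥ y| ≤ √(x ⬝ᵥ x) * √(y ⬝ᵥ y) := by
  rw [← Real.sqrt_mul (by simpa using dotProduct_star_self_nonneg x)]
  refine Real.abs_le_sqrt ?_
  have := Finset.sum_mul_sq_le_sq_mul_sq Finset.univ x y
  simpa [dotProduct, pow_two] using this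

/-- The matrix `∑ x xᵀ + λ I`. -/
noncomputable def gram (lam : ℝ) (L : List (Fin d → ℝ)) : Matrix (Fin d) (Fin d) ℝ :=
  (L.map fun x => vecMulVec x x).sum + lam • 1

theorem gram_append (lam : ℝ) (L : List (Fin d → ℝ)) (x : Fin d → ℝ) :
    gram lam (L ++ [x]) = gram lam L + vecMulVec x x := by
  simp [gram, add_right_comm]

theorem gram_cons (lam : ℝ) (L : List (Fin d → ℝ)) (x : Fin d → ℝ) :
    gram lam (x :: L) = vecMulVec x x + gram lam L := by
  simp [gram, add_assoc]

theorem gram_posDef {lam : ℝ} (hlam : 0 < lam) (L : List (Fin d → ℝ)) : (gram lam L).PosDef := by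
  induction L with
  | nil => simpa [gram] using PosDef.one.smul hlam
  | cons x L ih =>
    rw [gram_cons]
    exact PosDef.posSemidef_add (by simpa using posSemidef_vecMulVec_self_star x) ih

theorem gram_isSymm {lam : ℝ} (hlam : 0 < lam) (L : List (Fin d → ℝ)) : (gram lam L)ᵀ = gram lam L :=
  by simpa using (gram_posDef hlam L).isHermitian.eq

theorem isUnit_det_gram {lam : ℝ} (hlam : 0 < lam) (L : List (Fin d → ℝ)) :
    IsUnit (gram lam L).det :=
  (isUnit_iff_isUnit_det _).1 (gram_posDef hlam L).isUnit

theorem dotProduct_gram_mulVec (lam : ℝ) (L : List (Fin d → ℝ)) (u w : Fin d → ℝ) :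
    u ⬝ᵥ gram lam L *ᵥ w = (L.map fun x => (x ⬝ᵥ u) * (x ⬝ᵥ w)).sum + lam * (u ⬝ᵥ w) := by
  induction L with
  | nil => simp [gram, smul_mulVec]
  | cons x L ih =>
    rw [gram_cons, add_mulVec, dotProduct_add, ih, vecMulVec_mulVec]
    simp [dotProduct_comm u x, add_assoc, mul_comm]

theorem gram_inv_nonneg {lam : ℝ} (hlam : 0 < lam) (L : List (Fin d → ℝ)) (x : Fin d → ℝ) :
    0 ≤ x ⬝ᵥ (gram lam L)⁻¹ *ᵥ x := by
  simpa using (gram_posDef hlam L).inv.posSemidef.dotProduct_mulVec_nonneg x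

theorem dotProduct_mulVec_comm {B : Matrix (Fin d) (Fin d) ℝ} (hB : Bᵀ = B) (x y : Fin d → ℝ) :
    x ⬝ᵥ B *ᵥ y = (B *ᵥ x) ⬝ᵥ y := by
  rw [dotProduct_mulVec, ← mulVec_transpose, hB]

theorem gram_inv_isSymm {lam : ℝ} (hlam : 0 < lam) (L : List (Fin d → ℝ)) :
    ((gram lam L)⁻¹)ᵀ = (gram lam L)⁻¹ := by
  rw [transpose_nonsing_inv, gram_isSymm hlam]

theorem of_rankOneUpdate (B : Fin d → Fin d → ℝ) (x : Fin d → ℝ) :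
    of (rankOneUpdate B x) =
      of B - (1 + x ⬝ᵥ of B *ᵥ x)⁻¹ • vecMulVec (of B *ᵥ x) (of B *ᵥ x) := by
  ext i j
  simp [rankOneUpdate, vecMulVec_apply, div_eq_inv_mul]

/-- The Sherman-Morrison formula. -/
theorem of_rankOneUpdate_eq_inv {lam : ℝ} (hlam : 0 < lam) {L : List (Fin d → ℝ)}
    {B : Fin d → Fin d → ℝ} (hB : of B = (gram lam L)⁻¹) (x : Fin d → ℝ) :
    of (rankOneUpdate B x) = (gram lam (L ++ [x]))⁻¹ := by
  symm
  apply inv_eq_right_inv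
  rw [of_rankOneUpdate, gram_append, hB]
  have hpos : 1 + x ⬝ᵥ (gram lam L)⁻¹ *ᵥ x ≠ 0 := by
    have := gram_inv_nonneg hlam L x
    positivity
  set y := (gram lam L)⁻¹ *ᵥ x with hy
  have h1 : gram lam L *ᵥ y = x := by
    rw [hy, mulVec_mulVec, mul_nonsing_inv _ (isUnit_det_gram hlam L), one_mulVec]
  have h2 : vecMulVec x x * (gram lam L)⁻¹ = vecMulVec x y := by
    rw [vecMulVec_mul, ← mulVec_transpose, gram_inv_isSymm hlam]
  have h3 : gram lam L * vecMulVec y y = vecMulVec x y := by rw [mul_vecMulVec, h1]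
  have h4 : vecMulVec x x * vecMulVec y y = (x ⬝ᵥ y) • vecMulVec x y := by
    rw [vecMulVec_mul_vecMulVec]
    ext i j; simp [vecMulVec_apply]; ring
  rw [add_mul, mul_sub, mul_sub, mul_smul_comm, mul_smul_comm,
    mul_nonsing_inv _ (isUnit_det_gram hlam L), h2, h3, h4, smul_smul]
  have h5 : (1 + x ⬝ᵥ y)⁻¹ * (x ⬝ᵥ y) = 1 - (1 + x ⬝ᵥ y)⁻¹ := by field_simp; ring
  rw [h5, sub_smul, one_smul]
  abel

/-- The update subtracts a nonnegative multiple of a square. Uncertainty thus only decreases as the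
core set grows, and certain states remain certain. -/
theorem rankOneUpdate_quadratic_le {lam : ℝ} (hlam : 0 < lam) {L : List (Fin d → ℝ)}
    {B : Fin d → Fin d → ℝ} (hB : of B = (gram lam L)⁻¹) (x v : Fin d → ℝ) :
    v ⬝ᵥ of (rankOneUpdate B x) *ᵥ v ≤ v ⬝ᵥ of B *ᵥ v := by
  have hpos : 0 ≤ (1 + x ⬝ᵥ of B *ᵥ x)⁻¹ := by
    have := gram_inv_nonneg hlam L x
    rw [hB]; positivity
  rw [of_rankOneUpdate, sub_mulVec, dotProduct_sub, smul_mulVec, dotProduct_smul, vecMulVec_mulVec]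
  simp only [smul_eq_mul, op_smul_eq_smul, dotProduct_smul]
  rw [dotProduct_comm _ v]
  have := mul_nonneg hpos (mul_self_nonneg (v ⬝ᵥ of B *ᵥ x))
  linarith

/-- Matrix determinant lemma. For uncertainty above 1 the factor exceeds 2. -/
theorem det_gram_append {lam : ℝ} (hlam : 0 < lam) (L : List (Fin d → ℝ)) (x : Fin d → ℝ) :
    (gram lam (L ++ [x])).det = (gram lam L).det * (1 + x ⬝ᵥ (gram lam L)⁻¹ *ᵥ x) := by
  rw [gram_append, vecMulVec_eq Unit, det_add_replicateCol_mul_replicateRow (isUnit_det_gram hlam L)]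
  congr 1
  rw [det_unique]
  simp [Matrix.mul_assoc, Matrix.mul_apply, dotProduct, mulVec, Finset.mul_sum]

theorem trace_gram_le {lam : ℝ} {L : List (Fin d → ℝ)} (hL : ∀ x ∈ L, x ⬝ᵥ x ≤ 1) :
    (gram lam L).trace ≤ L.length + d * lam := by
  induction L with
  | nil => simp [gram, trace_smul, mul_comm]
  | cons x L ih =>
    have h1 := hL x (by simp)
    have h2 := ih fun y hy => hL y (by simp [hy])
    rw [gram_cons, trace_add, trace_vecMulVec, List.length_cons]
    push_cast
    linarith

/-- AM-GM for the eigenvalues. -/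
theorem _root_.Matrix.PosDef.det_le_trace_pow {V : Matrix (Fin d) (Fin d) ℝ} (hV : V.PosDef) (hd : 1 ≤ d) :
    V.det ≤ (V.trace / d) ^ d := by
  have hd' : (0 : ℝ) < d := by exact_mod_cast hd
  have h0 : ∀ i, 0 ≤ hV.isHermitian.eigenvalues i := fun i => (hV.eigenvalues_pos i).le
  have h1 := Real.geom_mean_le_arith_mean_weighted Finset.univ (fun _ : Fin d => (1 / d : ℝ))
    hV.isHermitian.eigenvalues (fun _ _ => by positivity) (by simp [hd'.ne']) fun i _ => h0 i
  have h2 := pow_le_pow_left₀ (Finset.prod_nonneg fun i _ => Real.rpow_nonneg (h0 i) _) h1 d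
  rw [← Finset.prod_pow, ← Finset.mul_sum] at h2
  have h3 : ∀ i, (hV.isHermitian.eigenvalues i ^ (1 / d : ℝ)) ^ d = hV.isHermitian.eigenvalues i :=
    fun i => by
      rw [← Real.rpow_natCast, ← Real.rpow_mul (h0 i), one_div, inv_mul_cancel₀ hd'.ne', Real.rpow_one]
  rw [Finset.prod_congr rfl fun i _ => h3 i] at h2
  rw [hV.isHermitian.det_eq_prod_eigenvalues, hV.isHermitian.trace_eq_sum_eigenvalues]
  simpa [div_eq_inv_mul] using h2

/-- With x = n/d and u = 1 + 1/λ the hypothesis reads 2^(n-1) ≤ (1 + x/λ)^d. If n exceeded the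
bound, then 1 + x/λ ≤ x u, where x ≤ exp(x/e) and 2u < exp((1/2 - 1/(2e)) x). The exponents add up
to (1/2 + 1/(2e)) x, which is below x log 2. So 1 + x/λ < 2^x / 2, and the d-th power of this
contradicts the hypothesis. -/
theorem le_coreBound_of_two_pow_le {lam : ℝ} (hlam : 0 < lam) {n : ℕ} (hd : 1 ≤ d) (hn : 1 ≤ n)
    (h : lam ^ d * 2 ^ (n - 1) ≤ ((n + d * lam) / d) ^ d) : (n : ℝ) ≤ coreBound d 1 lam := by
  by_contra hlt
  push Not at hlt
  have hd' : (0 : ℝ) < d := by exact_mod_cast hd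
  have he : 2 < Real.exp 1 := by linarith [Real.exp_one_gt_d9]
  have he' := Real.exp_one_gt_d9
  set e := Real.exp 1 with he_def
  set x : ℝ := n / d with hx
  set u : ℝ := 1 + 1 / lam with hu
  have hu1 : 1 ≤ u := by rw [hu]; have : 0 < 1 / lam := by positivity
                         linarith
  have hlogu : 0 ≤ Real.log u := Real.log_nonneg hu1
  have hx1 : 2 * e / (e - 1) * (Real.log 2 + Real.log u) < x := by
    rw [hx, lt_div_iff₀ hd']
    refine lt_of_eq_of_lt ?_ hlt
    rw [hu]
    unfold coreBound
    rw [← he_def]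
    norm_num
    ring
  have hx2 : 1 ≤ x := by
    have h1 : 2 ≤ 2 * e / (e - 1) := by rw [le_div_iff₀ (by linarith)]; linarith
    have h2 : 0.6 ≤ Real.log 2 + Real.log u := by linarith [Real.log_two_gt_d9]
    nlinarith
  -- The coefficient (e - 1)/(2e) is the reciprocal of the factor 2e/(e - 1) in `coreBound`.
  have hx3 : Real.log (2 * u) < (1 / 2 - 1 / (2 * e)) * x := by
    rw [Real.log_mul (by norm_num) (by linarith)]
    rw [div_mul_eq_mul_div, div_lt_iff₀ (by linarith)] at hx1
    have : (1 / 2 - 1 / (2 * e)) * x = x * (e - 1) / (2 * e) := by field_simp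
    rw [this, lt_div_iff₀ (by linarith)]
    linarith
  have hu2 : 2 * u < Real.exp ((1 / 2 - 1 / (2 * e)) * x) :=
    (Real.log_lt_iff_lt_exp (by linarith)).1 hx3
  have hx4 : x ≤ Real.exp (x / e) := by
    have h1 := Real.add_one_le_exp (x / e - 1)
    rw [Real.exp_sub, ← he_def, sub_add_cancel] at h1
    exact (div_le_div_iff_of_pos_right (by linarith)).1 h1
  have hkey : 1 + x / lam < 2 ^ x / 2 := by
    have h1 : 1 + x / lam = 1 + x * (u - 1) := by rw [hu]; ring
    have h2 : x * Real.exp ((1 / 2 - 1 / (2 * e)) * x) ≤ 2 ^ x := by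
      rw [Real.rpow_def_of_pos (by norm_num)]
      calc _ ≤ Real.exp (x / e) * Real.exp ((1 / 2 - 1 / (2 * e)) * x) := by gcongr
        _ = Real.exp ((1 / 2 + 1 / (2 * e)) * x) := by rw [← Real.exp_add]; congr 1; field_simp; ring
        _ ≤ Real.exp (Real.log 2 * x) := by
          refine Real.exp_le_exp.2 (mul_le_mul_of_nonneg_right ?_ (by linarith))
          have : 1 / (2 * e) ≤ 0.19 := by rw [div_le_iff₀ (by linarith)]; linarith
          linarith [Real.log_two_gt_d9]
    rw [h1]
    nlinarith
  have h5 : (1 + x / lam) ^ d < 2 ^ (n - 1) := by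
    have h6 : (1 + x / lam) ^ d < (2 ^ x / 2) ^ d :=
      pow_lt_pow_left₀ hkey (by positivity) (by omega)
    have h7 : ((2 : ℝ) ^ x / 2) ^ d = 2 ^ n / 2 ^ d := by
      rw [div_pow, ← Real.rpow_natCast (2 ^ x) d, ← Real.rpow_mul (by norm_num), hx,
        div_mul_cancel₀ _ hd'.ne', Real.rpow_natCast]
    have h8 : (2 : ℝ) ^ n / 2 ^ d ≤ 2 ^ (n - 1) := by
      rw [div_le_iff₀ (by positivity), ← pow_add]
      exact pow_le_pow_right₀ (by norm_num) (by omega)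
    rw [h7] at h6
    exact h6.trans_le h8
  have h9 : ((n + d * lam) / d) ^ d = lam ^ d * (1 + x / lam) ^ d := by
    rw [← mul_pow]; congr 1; rw [hx]; field_simp; ring
  rw [h9] at h
  exact absurd (le_of_mul_le_mul_left h (by positivity)) (not_le.2 h5)

/-! ### Least squares -/

theorem sq_list_sum_abs_le {α : Type*} (l : List α) (f : α → ℝ) :
    (l.map fun p => |f p|).sum ^ 2 ≤ l.length * (l.map fun p => f p ^ 2).sum := by
  induction l with
  | nil => simp
  | cons p l ih =>
    simp only [List.map_cons, List.sum_cons, List.length_cons]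
    set s := (l.map fun p => |f p|).sum
    set T := (l.map fun p => f p ^ 2).sum with hT
    have hT0 : 0 ≤ T := List.sum_nonneg (by
      intro x hx
      obtain ⟨p, -, rfl⟩ := List.mem_map.1 hx
      positivity)
    -- Cross term of the expanded square, by AM-GM after inserting the induction hypothesis s² ≤
    -- (length) · T.
    have h1 : 2 * |f p| * s ≤ l.length * f p ^ 2 + T := by
      refine abs_le_of_sq_le_sq' ?_ (by positivity) |>.2
      have h2 : (2 * |f p| * s) ^ 2 = 4 * f p ^ 2 * s ^ 2 := by rw [mul_pow, mul_pow, sq_abs]; ring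
      rw [h2]
      have h3 := mul_le_mul_of_nonneg_left ih (by positivity : 0 ≤ 4 * f p ^ 2)
      nlinarith [sq_nonneg ((l.length : ℝ) * f p ^ 2 - T)]
    push_cast
    have := sq_abs (f p)
    nlinarith

theorem abs_list_sum_mul_le {α : Type*} (l : List α) (f g : α → ℝ) {e : ℝ}
    (hf : ∀ p ∈ l, |f p| ≤ e) :
    |(l.map fun p => f p * g p).sum| ≤ e * (l.map fun p => |g p|).sum := by
  induction l with
  | nil => simp
  | cons p l ih =>
    simp only [List.map_cons, List.sum_cons, mul_add]
    refine (abs_add_le _ _).trans (add_le_add ?_ (ih fun q hq => hf q (by simp [hq])))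
    rw [abs_mul]
    exact mul_le_mul_of_nonneg_right (hf p (by simp)) (abs_nonneg _)

/-- With u = V⁻¹x the error equals Σ (q_p - p·w)(p·u) - λ w·u. Moreover Σ (p·u)² + λ‖u‖² = uᵀVu =
xᵀV⁻¹x ≤ 1, which bounds Σ |p·u| by √C through Cauchy-Schwarz and √λ‖u‖ by 1. -/
theorem abs_leastSquares_sub_le {lam : ℝ} (hlam : 0 < lam) (L : List ((Fin d → ℝ) × ℝ))
    {w x : Fin d → ℝ} {b e C : ℝ} (hb : 0 ≤ b) (he : 0 ≤ e) (hw : w ⬝ᵥ w ≤ b ^ 2)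
    (hL : ∀ p ∈ L, |p.2 - p.1 ⬝ᵥ w| ≤ e) (hC : L.length ≤ C)
    (hx : x ⬝ᵥ (gram lam (L.map Prod.fst))⁻¹ *ᵥ x ≤ 1) :
    |x ⬝ᵥ (gram lam (L.map Prod.fst))⁻¹ *ᵥ (L.map fun p => p.2 • p.1).sum - x ⬝ᵥ w| ≤
      √C * e + √lam * b := by
  set V := gram lam (L.map Prod.fst) with hV
  set u := V⁻¹ *ᵥ x with hu
  have hVu : V *ᵥ u = x := by
    rw [hu, mulVec_mulVec, mul_nonsing_inv _ (isUnit_det_gram hlam _), one_mulVec]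
  have h1 : u ⬝ᵥ V *ᵥ u ≤ 1 := by
    rw [hVu, dotProduct_comm]; exact hx
  rw [hV, dotProduct_gram_mulVec, List.map_map] at h1
  have h2 : x ⬝ᵥ w = (L.map fun p => (p.1 ⬝ᵥ w) * (p.1 ⬝ᵥ u)).sum + lam * (w ⬝ᵥ u) := by
    rw [← hVu, dotProduct_comm, hV, dotProduct_gram_mulVec, List.map_map]; rfl
  have h3 : x ⬝ᵥ V⁻¹ *ᵥ (L.map fun p => p.2 • p.1).sum = (L.map fun p => p.2 * (p.1 ⬝ᵥ u)).sum := by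
    rw [dotProduct_mulVec_comm (gram_inv_isSymm hlam _), ← hu]
    -- Detaches u from its definition through L; otherwise the induction on L would change u.
    generalize u = u
    clear * -
    induction L with
    | nil => simp
    | cons p L ih => simp [dotProduct_add, ih, dotProduct_comm u p.1]
  have h4 : (L.map fun p => p.2 * (p.1 ⬝ᵥ u)).sum - (L.map fun p => (p.1 ⬝ᵥ w) * (p.1 ⬝ᵥ u)).sum =
      (L.map fun p => (p.2 - p.1 ⬝ᵥ w) * (p.1 ⬝ᵥ u)).sum := by
    generalize u = u
    clear * -
    induction L with
    | nil => simp
    | cons p L ih => simp only [List.map_cons, List.sum_cons, ← ih]; ring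
  rw [h3, h2, ← sub_sub, h4]
  set T := (L.map fun p => (p.1 ⬝ᵥ u) ^ 2).sum with hT
  have hT0 : 0 ≤ T := List.sum_nonneg (by
    intro x hx
    obtain ⟨p, -, rfl⟩ := List.mem_map.1 hx
    positivity)
  have huu : 0 ≤ u ⬝ᵥ u := by simpa using dotProduct_star_self_nonneg u
  have h5 : T + lam * (u ⬝ᵥ u) ≤ 1 := by
    refine le_trans (le_of_eq ?_) h1
    rw [hT]
    congr 3
    funext p
    simp [pow_two]
  have hC0 : 0 ≤ C := le_trans (Nat.cast_nonneg _) hC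
  have h6 : (L.map fun p => |p.1 ⬝ᵥ u|).sum ≤ √C := by
    refine Real.le_sqrt_of_sq_le ((sq_list_sum_abs_le L fun p => p.1 ⬝ᵥ u).trans ?_)
    have : 0 ≤ lam * (u ⬝ᵥ u) := by positivity
    calc (L.length : ℝ) * T ≤ C * 1 := by
          exact mul_le_mul hC (by linarith) hT0 hC0
      _ = C := mul_one C
  have h7 : |lam * (w ⬝ᵥ u)| ≤ √lam * b := by
    rw [abs_mul, abs_of_pos hlam]
    have h8 : √(w ⬝ᵥ w) ≤ b := Real.sqrt_le_iff.2 ⟨hb, hw⟩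
    have h9 : √lam * √(u ⬝ᵥ u) ≤ 1 := by
      rw [← Real.sqrt_mul hlam.le]
      exact Real.sqrt_le_one.2 (by linarith)
    calc lam * |w ⬝ᵥ u| ≤ lam * (√(w ⬝ᵥ w) * √(u ⬝ᵥ u)) :=
          mul_le_mul_of_nonneg_left (abs_dotProduct_le w u) hlam.le
      _ = (√lam * √(w ⬝ᵥ w)) * (√lam * √(u ⬝ᵥ u)) := by
          nth_rewrite 1 [← Real.mul_self_sqrt hlam.le]; ring
      _ ≤ (√lam * b) * 1 := by gcongr
      _ = √lam * b := mul_one _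
  have h10 := abs_list_sum_mul_le L (fun p => p.2 - p.1 ⬝ᵥ w) (fun p => p.1 ⬝ᵥ u) hL
  calc _ ≤ |(L.map fun p => (p.2 - p.1 ⬝ᵥ w) * (p.1 ⬝ᵥ u)).sum| + |lam * (w ⬝ᵥ u)| := abs_sub _ _
    _ ≤ e * √C + √lam * b := add_le_add (h10.trans (mul_le_mul_of_nonneg_left h6 he)) h7
    _ = _ := by ring

end LinearAlgebra

/-! ### Core sets that satisfy the invariant of the algorithm -/

section CoreSets

variable {S : Type u} {m : ℕ} {N : Fin m → ℕ} {d : ℕ}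

/-- The invariant of core sets: the stored matrix is the inverse of `Φᵀ Φ + λ I`, whose determinant
has grown by a factor `2` with every element but the first. -/
structure CoreSet.Valid (φ : Features S N d) (lam : ℝ) (C : CoreSet S N d) : Prop where
  inv_eq : of C.inv = (gram lam (C.elems.map CoreElem.feat))⁻¹
  feat_eq : ∀ z ∈ C.elems, z.feat = φ.vec z.state z.action
  le_det : lam ^ d * 2 ^ (C.elems.length - 1) ≤ (gram lam (C.elems.map CoreElem.feat)).det
  one_le : 1 ≤ C.elems.length

variable {φ : Features S N d} {lam : ℝ} {C : CoreSet S N d}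

theorem Features.vec_eq_total (s : S) (a : Act N) (j : Fin d) : φ.vec s a j = φ.total s a j := by
  simp [Features.vec, Features.total]

theorem inner_total (w : EuclideanSpace ℝ (Fin d)) (s : S) (a : Act N) :
    inner ℝ w (φ.total s a) = φ.vec s a ⬝ᵥ (w : Fin d → ℝ) := by
  simp [PiLp.inner_apply, dotProduct, Features.vec_eq_total]

theorem Features.Bounded.vec_le (hφ : φ.Bounded) (s : S) (a : Act N) :
    φ.vec s a ⬝ᵥ φ.vec s a ≤ 1 := by
  have h := hφ s a
  rw [EuclideanSpace.norm_eq, Real.sqrt_le_one] at h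
  refine le_trans (le_of_eq ?_) h
  simp [dotProduct, Features.vec_eq_total, pow_two]

/-- The determinant is at least λ^d 2^(n-1) by the invariant and at most ((n + dλ)/d)^d through the
trace. -/
theorem CoreSet.Valid.length_le (hC : C.Valid φ lam) (hφ : φ.Bounded) (hlam : 0 < lam)
    (hd : 1 ≤ d) : (C.elems.length : ℝ) ≤ coreBound d 1 lam := by
  refine le_coreBound_of_two_pow_le hlam hd hC.one_le (hC.le_det.trans ?_)
  refine ((gram_posDef hlam _).det_le_trace_pow hd).trans ?_
  have h1 : (gram lam (C.elems.map CoreElem.feat)).trace ≤ C.elems.length + d * lam := by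
    simpa using trace_gram_le (lam := lam) (L := C.elems.map CoreElem.feat) (by
      intro x hx
      obtain ⟨z, hz, rfl⟩ := List.mem_map.1 hx
      rw [hC.feat_eq z hz]
      exact hφ.vec_le _ _)
  have h2 : 0 ≤ (gram lam (C.elems.map CoreElem.feat)).trace :=
    (gram_posDef hlam _).posSemidef.trace_nonneg
  gcongr

theorem CoreSet.Valid.push (hC : C.Valid φ lam) (hlam : 0 < lam) {z : CoreElem S N d}
    (hz : IsUncertain φ 1 C z) : (C.push z).Valid φ lam where
  inv_eq := by
    simpa [CoreSet.push] using of_rankOneUpdate_eq_inv hlam hC.inv_eq z.feat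
  feat_eq := by
    intro z' hz'
    rcases List.mem_append.1 hz' with h | h
    · exact hC.feat_eq z' h
    · rw [List.mem_singleton.1 h]; exact hz.1
  le_det := by
    have h := hz.2
    rw [hC.inv_eq] at h
    simp only [CoreSet.push, List.map_append, List.map_cons, List.map_nil, List.length_append,
      List.length_singleton, Nat.add_sub_cancel]
    rw [det_gram_append hlam]
    have h1 : C.elems.length = C.elems.length - 1 + 1 := by have := hC.one_le; omega
    rw [h1, pow_succ, ← mul_assoc]
    exact mul_le_mul hC.le_det (by linarith) (by norm_num) (gram_posDef hlam _).det_pos.le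
  one_le := by simp [CoreSet.push]

theorem CoreSet.Valid.certain_push (hC : C.Valid φ lam) (hlam : 0 < lam) {z : CoreElem S N d}
    {abar : Act N} {τ : ℝ} {s : S} (hs : Certain φ abar τ C s) : Certain φ abar τ (C.push z) s :=
  fun i a => (rankOneUpdate_quadratic_le hlam hC.inv_eq z.feat _).trans (hs i a)

/-- The first pair enters without a check, so its determinant factor is only known to be at least 1.
This accounts for the exponent `length - 1` in the invariant. -/
theorem CoreSet.valid_singleton (hlam : 0 < lam) {B : Fin d → Fin d → ℝ}
    (hB : of B = lam⁻¹ • (1 : Matrix (Fin d) (Fin d) ℝ)) (s : S) (a : Act N) :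
    (CoreSet.push ⟨[], B⟩ ⟨s, a, φ.vec s a⟩).Valid φ lam where
  inv_eq := by
    have h : of B = (gram lam ([] : List (Fin d → ℝ)))⁻¹ := by
      rw [hB]
      symm
      apply inv_eq_left_inv
      simp [gram, smul_smul, hlam.ne']
    simpa [CoreSet.push] using of_rankOneUpdate_eq_inv hlam h (φ.vec s a)
  feat_eq := by
    intro z hz
    rw [List.mem_singleton.1 hz]
  le_det := by
    have h1 := det_gram_append hlam [] (φ.vec s a)
    have h2 := gram_inv_nonneg hlam [] (φ.vec s a)
    have h3 : (gram lam ([] : List (Fin d → ℝ))).det = lam ^ d := by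
      simp [gram]
    simp only [CoreSet.push, List.nil_append] at h1 ⊢
    rw [List.map_singleton, h1, h3]
    refine mul_le_mul_of_nonneg_left ?_ (by positivity)
    simpa using h2
  one_le := by simp [CoreSet.push]

end CoreSets

/-! ### Laws of truncated returns -/

section Returns

variable {S : Type u} {A : Type v} [MeasurableSpace S] [MeasurableSpace A] (M : MDP S A)
  (π : Policy S A)

/-- The law of the reward at a state-action pair plus a discounted quantity whose law depends on the
next state. -/
noncomputable def MDP.backup (κ : Kernel S ℝ) : Kernel (S × A) ℝ :=
  (Kernel.id ×ₖ (κ ∘ₖ M.trans)).map fun p => M.reward p.1 + M.disc * p.2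

theorem MDP.measurable_backup_fun :
    Measurable fun p : (S × A) × ℝ => M.reward p.1 + M.disc * p.2 :=
  (M.measurable_reward.comp measurable_fst).add (measurable_snd.const_mul _)

instance (κ : Kernel S ℝ) [IsMarkovKernel κ] : IsMarkovKernel (M.backup κ) :=
  Kernel.IsMarkovKernel.map _ M.measurable_backup_fun

theorem MDP.backup_apply (κ : Kernel S ℝ) [IsMarkovKernel κ] (x : S × A) :
    M.backup κ x = ((κ ∘ₖ M.trans) x).map fun y => M.reward x + M.disc * y := by
  rw [MDP.backup, Kernel.map_apply _ M.measurable_backup_fun, Kernel.prod_apply, Kernel.id_apply,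
    Measure.dirac_prod, Measure.map_map M.measurable_backup_fun (by fun_prop)]
  rfl

theorem MDP.lintegral_backup (κ : Kernel S ℝ) [IsMarkovKernel κ] (x : S × A) {f : ℝ → ℝ≥0∞}
    (hf : Measurable f) : ∫⁻ y, f y ∂(M.backup κ x) =
      ∫⁻ s', ∫⁻ y, f (M.reward x + M.disc * y) ∂(κ s') ∂(M.trans x) := by
  rw [MDP.backup_apply, lintegral_map hf (by fun_prop), Kernel.lintegral_comp _ _ _ (by fun_prop)]

/-- The law of the discounted return of `h` steps from a state. -/
noncomputable def MDP.returnLaw : ℕ → Kernel S ℝ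
  | 0 => Kernel.const S (Measure.dirac 0)
  | h + 1 => M.backup (MDP.returnLaw h) ∘ₖ π.pair

instance (h : ℕ) : IsMarkovKernel (M.returnLaw π h) := by
  induction h with
  | zero => unfold MDP.returnLaw; infer_instance
  | succ h ih => unfold MDP.returnLaw; infer_instance

theorem Policy.lintegral_pair (s : S) {f : S × A → ℝ≥0∞} (hf : Measurable f) :
    ∫⁻ x, f x ∂(π.pair s) = ∫⁻ a, f (s, a) ∂(π.kernel s) := by
  rw [Policy.pair_apply, lintegral_map hf (by fun_prop)]

theorem MDP.lintegral_returnLaw_succ (h : ℕ) (s : S) {f : ℝ → ℝ≥0∞} (hf : Measurable f) :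
    ∫⁻ y, f y ∂(M.returnLaw π (h + 1) s) = ∫⁻ a, ∫⁻ s', ∫⁻ y,
      f (M.reward (s, a) + M.disc * y) ∂(M.returnLaw π h s') ∂(M.trans (s, a)) ∂(π.kernel s) := by
  rw [MDP.returnLaw, Kernel.lintegral_comp _ _ _ hf, Policy.lintegral_pair _ _ hf.lintegral_kernel]
  exact lintegral_congr fun a => M.lintegral_backup _ _ hf

/-- The interval is invariant under a backup and hence carries all truncated returns; its length
enters Hoeffding's inequality. -/
theorem MDP.reward_add_mem {x : S × A} {y : ℝ} (hy : y ∈ Set.Icc 0 (1 / (1 - M.disc))) :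
    M.reward x + M.disc * y ∈ Set.Icc 0 (1 / (1 - M.disc)) := by
  have h1 := mul_le_mul_of_nonneg_left hy.2 M.disc_nonneg
  have h3 : 1 + M.disc * (1 / (1 - M.disc)) = 1 / (1 - M.disc) := by
    have := M.one_sub_disc_pos.ne'
    field_simp; ring
  exact ⟨add_nonneg (M.reward_nonneg _) (mul_nonneg M.disc_nonneg hy.1),
    by linarith [M.reward_le_one x]⟩

theorem MDP.backup_compl_Icc {κ : Kernel S ℝ} [IsMarkovKernel κ]
    (hκ : ∀ s, κ s (Set.Icc 0 (1 / (1 - M.disc)))ᶜ = 0) (x : S × A) :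
    M.backup κ x (Set.Icc 0 (1 / (1 - M.disc)))ᶜ = 0 := by
  rw [MDP.backup_apply, Measure.map_apply (by fun_prop) measurableSet_Icc.compl,
    Kernel.comp_apply' _ _ _ (measurableSet_Icc.compl.preimage (by fun_prop))]
  refine lintegral_eq_zero_of_ae_eq_zero (Filter.Eventually.of_forall fun s' => ?_)
  exact measure_mono_null (fun y hy hmem => hy (M.reward_add_mem hmem)) (hκ s')

theorem MDP.returnLaw_compl_Icc (h : ℕ) (s : S) :
    M.returnLaw π h s (Set.Icc 0 (1 / (1 - M.disc)))ᶜ = 0 := by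
  induction h generalizing s with
  | zero =>
    simp only [MDP.returnLaw, Kernel.const_apply]
    rw [Measure.dirac_apply' _ measurableSet_Icc.compl]
    simp
    exact M.disc_lt_one.le
  | succ h ih =>
    rw [MDP.returnLaw, Kernel.comp_apply' _ _ _ measurableSet_Icc.compl]
    exact lintegral_eq_zero_of_ae_eq_zero (Filter.Eventually.of_forall fun x =>
      M.backup_compl_Icc ih x)

theorem integrable_id_of_compl_Icc {μ : Measure ℝ} [IsFiniteMeasure μ] {a b : ℝ}
    (h : μ (Set.Icc a b)ᶜ = 0) : Integrable (fun y : ℝ => y) μ :=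
  Integrable.of_mem_Icc a b aemeasurable_id (measure_eq_zero_iff_ae_notMem.1 h |>.mono
    fun y hy => by simpa using hy)

/-- The mean of the truncated return. -/
noncomputable def MDP.returnMean (h : ℕ) (s : S) : ℝ := ∫ y, y ∂(M.returnLaw π h s)

theorem MDP.measurable_returnMean (h : ℕ) : Measurable (M.returnMean π h) :=
  (stronglyMeasurable_id.integral_kernel).measurable

theorem MDP.returnMean_mem (h : ℕ) (s : S) : M.returnMean π h s ∈ Set.Icc 0 (1 / (1 - M.disc)) := by
  have hae : ∀ᵐ y ∂(M.returnLaw π h s), y ∈ Set.Icc 0 (1 / (1 - M.disc)) :=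
    measure_eq_zero_iff_ae_notMem.1 (M.returnLaw_compl_Icc π h s) |>.mono
      fun y hy => by simpa using hy
  constructor
  · exact integral_nonneg_of_ae (hae.mono fun y hy => hy.1)
  · have := integral_mono_ae (integrable_id_of_compl_Icc (M.returnLaw_compl_Icc π h s))
      (integrable_const (1 / (1 - M.disc))) (hae.mono fun y hy => hy.2)
    simpa [MDP.returnMean] using this

theorem MDP.comp_trans_compl_Icc (h : ℕ) (x : S × A) :
    (M.returnLaw π h ∘ₖ M.trans) x (Set.Icc 0 (1 / (1 - M.disc)))ᶜ = 0 := by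
  rw [Kernel.comp_apply' _ _ _ measurableSet_Icc.compl]
  exact lintegral_eq_zero_of_ae_eq_zero (Filter.Eventually.of_forall fun s =>
    M.returnLaw_compl_Icc π h s)

theorem MDP.integral_backup (h : ℕ) (x : S × A) : ∫ y, y ∂(M.backup (M.returnLaw π h) x) =
    M.reward x + M.disc * ∫ s', M.returnMean π h s' ∂(M.trans x) := by
  have h1 := integrable_id_of_compl_Icc (M.comp_trans_compl_Icc π h x)
  rw [MDP.backup_apply, integral_map (by fun_prop) (by fun_prop),
    integral_add (integrable_const _) (h1.const_mul _), integral_const_mul, Kernel.integral_comp h1]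
  simp [MDP.returnMean]

theorem MDP.backup_returnLaw_compl_Icc (h : ℕ) (x : S × A) :
    M.backup (M.returnLaw π h) x (Set.Icc 0 (1 / (1 - M.disc)))ᶜ = 0 :=
  M.backup_compl_Icc (M.returnLaw_compl_Icc π h) x

theorem MDP.abs_integral_backup_sub_qValue_le {h : ℕ} {B : ℝ}
    (hB : ∀ s, |M.returnMean π h s - M.value π s| ≤ B) (x : S × A) :
    |∫ y, y ∂(M.backup (M.returnLaw π h) x) - M.qValue π x.1 x.2| ≤ M.disc * B := by
  have h1 : ∫ y, y ∂(M.backup (M.returnLaw π h) x) - M.qValue π x.1 x.2 =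
      M.disc * ∫ s', (M.returnMean π h s' - M.value π s') ∂(M.trans x) := by
    rw [MDP.integral_backup, MDP.qValue, integral_sub _ (M.integrable_value π _)]
    · ring
    · refine integrable_of_abs_le (B := 1 / (1 - M.disc)) (M.measurable_returnMean π h) fun s => ?_
      rw [abs_of_nonneg (M.returnMean_mem π h s).1]
      exact (M.returnMean_mem π h s).2
  rw [h1, abs_mul, abs_of_nonneg M.disc_nonneg]
  exact mul_le_mul_of_nonneg_left (abs_integral_le_of_abs_le hB) M.disc_nonneg

/-- The return of zero steps misses the value by at most 1/(1-γ), and each backup contracts the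
error by γ. -/
theorem MDP.abs_returnMean_sub_value_le (h : ℕ) (s : S) :
    |M.returnMean π h s - M.value π s| ≤ M.disc ^ h * (1 / (1 - M.disc)) := by
  induction h generalizing s with
  | zero =>
    have : M.returnMean π 0 s = 0 := by simp [MDP.returnMean, MDP.returnLaw]
    rw [this, zero_sub, abs_neg, pow_zero, one_mul]
    exact M.abs_value_le π s
  | succ h ih =>
    have h1 : Integrable (fun y : ℝ => y) (M.returnLaw π (h + 1) s) :=
      integrable_id_of_compl_Icc (M.returnLaw_compl_Icc π (h + 1) s)
    have hm : Measurable fun x => ∫ y, y ∂(M.backup (M.returnLaw π h) x) :=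
      (stronglyMeasurable_id.integral_kernel).measurable
    have h2 : M.returnMean π (h + 1) s - M.value π s =
        ∫ a, (∫ y, y ∂(M.backup (M.returnLaw π h) (s, a)) - M.qValue π s a) ∂(π.kernel s) := by
      have hint : Integrable (fun x => ∫ y, y ∂(M.backup (M.returnLaw π h) x)) (π.pair s) := by
        have := h1
        rw [MDP.returnLaw] at this
        exact this.integral_comp
      rw [MDP.returnMean, MDP.returnLaw, Kernel.integral_comp (by simpa [MDP.returnLaw] using h1),
        Policy.pair_apply, integral_map (by fun_prop) hm.aestronglyMeasurable,
        M.value_eq_integral_qValue, integral_sub _ (M.integrable_qValue π s _)]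
      rw [Policy.pair_apply, integrable_map_measure hm.aestronglyMeasurable (by fun_prop)] at hint
      exact hint
    rw [h2, pow_succ', mul_assoc]
    exact abs_integral_le_of_abs_le fun a => M.abs_integral_backup_sub_qValue_le π ih (s, a)

end Returns

/-! ### Sums of independent bounded variables -/

section Sums

/-- The law of the sum of `n` independent variables with law `μ`. -/
noncomputable def sumLaw (μ : Measure ℝ) : ℕ → Measure ℝ
  | 0 => Measure.dirac 0
  | n + 1 => (μ.prod (sumLaw μ n)).map fun p => p.1 + p.2

variable (μ : Measure ℝ) [IsProbabilityMeasure μ]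

instance (n : ℕ) : IsProbabilityMeasure (sumLaw μ n) := by
  induction n with
  | zero => unfold sumLaw; infer_instance
  | succ n ih => exact Measure.isProbabilityMeasure_map (by fun_prop)

theorem lintegral_sumLaw_succ (n : ℕ) {f : ℝ → ℝ≥0∞} (hf : Measurable f) :
    ∫⁻ y, f y ∂(sumLaw μ (n + 1)) = ∫⁻ x, ∫⁻ y, f (x + y) ∂(sumLaw μ n) ∂μ := by
  rw [sumLaw, lintegral_map hf (by fun_prop)]
  exact lintegral_prod _ (by fun_prop)

variable {μ}

/-- The product measure in `sumLaw` supplies independence, under which sub-Gaussian parameters add.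
-/
theorem hasSubgaussianMGF_sumLaw {c : NNReal} {e : ℝ} (h : HasSubgaussianMGF (fun x => x - e) c μ)
    (n : ℕ) : HasSubgaussianMGF (fun x => x - n * e) (n * c) (sumLaw μ n) := by
  induction n with
  | zero =>
    have h0 : HasSubgaussianMGF (fun _ : ℝ => (0 : ℝ)) 0 (sumLaw μ 0) := HasSubgaussianMGF.fun_zero
    simpa using h0.congr (Y := fun x => x) (by
      simp only [sumLaw]
      exact ((ae_dirac_iff (measurableSet_eq_fun measurable_const measurable_id)).2 rfl))
  | succ n ih =>
    have h1 : HasSubgaussianMGF (fun p : ℝ × ℝ => p.1 - e) c (μ.prod (sumLaw μ n)) :=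
      HasSubgaussianMGF.of_map (X := fun x => x - e) (Y := Prod.fst) (by fun_prop)
        (by rw [Measure.map_fst_prod]; simpa using h)
    have h2 : HasSubgaussianMGF (fun p : ℝ × ℝ => p.2 - n * e) (n * c) (μ.prod (sumLaw μ n)) :=
      HasSubgaussianMGF.of_map (X := fun x => x - n * e) (Y := Prod.snd) (by fun_prop)
        (by rw [Measure.map_snd_prod]; simpa using ih)
    have h3 := h1.add_of_indepFun h2
      (indepFun_prod (X := fun x : ℝ => x - e) (Y := fun x : ℝ => x - n * e) (by fun_prop) (by fun_prop))
    have h4 := (HasSubgaussianMGF.id_map_iff h3.aemeasurable).2 h3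
    -- Both sides are the law of the centred sum, so the bound passes from the product space to
    -- `sumLaw`.
    have h5 : (μ.prod (sumLaw μ n)).map (fun p => p.1 - e + (p.2 - n * e)) =
        (sumLaw μ (n + 1)).map fun x => x - (n + 1 : ℕ) * e := by
      rw [sumLaw, Measure.map_map (by fun_prop) (by fun_prop)]
      congr 1
      funext p
      simp only [Function.comp]
      push_cast
      ring
    rw [h5] at h4
    have h6 := (HasSubgaussianMGF.id_map_iff (by fun_prop)).1 h4
    convert h6 using 1
    push_cast
    ring

/-- Hoeffding's inequality. -/
theorem sumLaw_abs_sub_gt_le {B θ : ℝ} (hB : 0 < B) (hμ : μ (Set.Icc 0 B)ᶜ = 0) {n : ℕ} (hn : 1 ≤ n)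
    (hθ : 0 ≤ θ) : (sumLaw μ n) {x | |x / n - ∫ y, y ∂μ| ≤ θ}ᶜ ≤
      ENNReal.ofReal (2 * Real.exp (-(2 * n * θ ^ 2 / B ^ 2))) := by
  have hn' : (0 : ℝ) < n := by exact_mod_cast hn
  set e := ∫ y, y ∂μ with he
  -- Hoeffding's lemma for a variable in an interval of length B. The two one-sided tails produce
  -- the factor 2.
  have h1 : HasSubgaussianMGF (fun x => x - e) ((‖B - 0‖₊ / 2) ^ 2) μ :=
    hasSubgaussianMGF_of_mem_Icc (X := fun x => x) (by fun_prop)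
      (measure_eq_zero_iff_ae_notMem.1 hμ |>.mono fun y hy => by simpa using hy)
  have h2 := hasSubgaussianMGF_sumLaw h1 n
  have hc : ((n * (‖B - 0‖₊ / 2) ^ 2 : NNReal) : ℝ) = n * (B / 2) ^ 2 := by
    simp [abs_of_pos hB]
  have hexp : -(n * θ) ^ 2 / (2 * (n * (B / 2) ^ 2)) = -(2 * n * θ ^ 2 / B ^ 2) := by
    field_simp
  have h3 := h2.measure_ge_le (ε := n * θ) (by positivity)
  have h4 := h2.neg.measure_ge_le (ε := n * θ) (by positivity)
  rw [hc, hexp] at h3 h4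
  have h5 : {x : ℝ | |x / n - e| ≤ θ}ᶜ ⊆ {x | n * θ ≤ x - n * e} ∪ {x | n * θ ≤ (-fun x => x - n * e) x} := by
    intro x hx
    simp only [Set.mem_compl_iff, Set.mem_ofPred_eq, not_le] at hx
    have hx1 : x - n * e = n * (x / n - e) := by field_simp
    rcases lt_abs.1 hx with h | h
    · left
      simp only [Set.mem_ofPred_eq, hx1]
      exact mul_le_mul_of_nonneg_left h.le hn'.le
    · right
      simp only [Set.mem_ofPred_eq, Pi.neg_apply, hx1, ← mul_neg]
      exact mul_le_mul_of_nonneg_left h.le hn'.le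
  refine (measure_mono h5).trans ((measure_union_le _ _).trans ?_)
  rw [two_mul, ENNReal.ofReal_add (Real.exp_nonneg _) (Real.exp_nonneg _)]
  refine add_le_add ?_ ?_
  · rw [← ofReal_measureReal]; exact ENNReal.ofReal_le_ofReal h3
  · rw [← ofReal_measureReal]; exact ENNReal.ofReal_le_ofReal h4

end Sums

open Prog

section Rollouts

variable {S : Type u} [MeasurableSpace S] {m : ℕ} {N : Fin m → ℕ} {d : ℕ} [∀ i, NeZero (N i)]
  {M : MDP S (Act N)} {φ : Features S N d} {abar : Act N} {P : Params}

/-! ### Costs -/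

/-- The number of instructions for one step of a rollout, when there are `A` actions. -/
def stepCost (m d A : ℕ) : ℕ := checkCost m d A + (greedyCost m d A + 1) + 5

/-- What the algorithm requires of the outcome of a subroutine. -/
def Outcome (φ : Features S N d) (C : CoreSet S N d) {α : Type v} (R : α → Prop) :
    Status (CoreElem S N d) α → Prop
  | .uncertain z => IsUncertain φ 1 C z
  | .done x => R x

theorem spec_rolloutFrom {A : ℕ} (hA : ∀ i, N i ≤ A) (hτ : P.τ = 1) (π : PolicyCode d)
    (C : CoreSet S N d) (h : ℕ) (s : S) (g G : ℝ) :
    (rolloutFrom abar P π C h s g G).Spec M φ (h * stepCost m d A) h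
      (Outcome φ C fun _ => True) := by
  induction h generalizing s g G with
  | zero => exact spec_ret trivial _ _
  | succ h ih =>
    refine Spec.mono (T := checkCost m d A + (greedyCost m d A + 1 + (h * stepCost m d A + 1 + 1 + 1 + 1)) + 1)
      (Q := 0 + (0 + (h + 1)))
      (Spec.step ((spec_uncertaintyCheck hA abar P.τ C s).bind ?_))
      (by simp only [stepCost]; ring_nf; exact le_rfl) (by omega) fun _ h => h
    rintro o (⟨rfl, -⟩ | ⟨z, rfl, hz, -⟩)
    · refine (spec_draw hA π s).bind fun a _ => ?_
      exact spec_simulate fun s' => spec_arith (spec_arith (spec_arith (ih _ _ _)))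
    · exact spec_ret (by rw [hτ] at hz; exact hz) _ _

theorem spec_rolloutSum {A : ℕ} (hA : ∀ i, N i ≤ A) (hτ : P.τ = 1) (π : PolicyCode d)
    (C : CoreSet S N d) (z : CoreElem S N d) (n : ℕ) (G : ℝ) :
    (rolloutSum abar P π C z n G).Spec M φ (n * (P.H * stepCost m d A + 3)) (n * (P.H + 1))
      (Outcome φ C fun _ => True) := by
  induction n generalizing G with
  | zero => exact spec_ret trivial _ _
  | succ n ih =>
    refine Spec.mono (T := P.H * stepCost m d A + (n * (P.H * stepCost m d A + 3) + 1) + 1 + 1)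
      (Q := P.H + n * (P.H + 1) + 1)
      (Spec.step (spec_simulate fun s' => (spec_rolloutFrom hA hτ π C P.H s' 1 _).bind ?_))
      (by ring_nf; exact le_rfl) (by ring_nf; exact le_rfl) fun _ h => h
    intro o ho
    match o, ho with
    | .uncertain z', ho => exact spec_ret (M := M) (φ := φ) (x := Status.uncertain z') ho _ _
    | .done x, _ => exact spec_arith (ih _)

/-- The number of instructions for the rollouts from one element. -/
def rolloutCost (m d A n H : ℕ) : ℕ := n * (H * stepCost m d A + 3) + 1

theorem spec_rollout {A : ℕ} (hA : ∀ i, N i ≤ A) (hτ : P.τ = 1) (π : PolicyCode d)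
    (C : CoreSet S N d) (z : CoreElem S N d) :
    (rollout abar P π C z).Spec M φ (rolloutCost m d A P.n P.H) (P.n * (P.H + 1))
      (Outcome φ C fun _ => True) := by
  refine (spec_rolloutSum hA hτ π C z P.n 0).bind (T' := 1) (Q' := 0) ?_
  intro o ho
  match o, ho with
  | .uncertain z', ho => exact spec_ret (M := M) (φ := φ) (x := Status.uncertain z') ho _ _
  | .done x, _ => exact spec_arith (spec_ret trivial 0 0)

/-- The postcondition records that the estimates are attached to the core set elements in their
order, which lets the stored inverse serve for the regression. -/
theorem spec_evaluate {A : ℕ} (hA : ∀ i, N i ≤ A) (hτ : P.τ = 1) (π : PolicyCode d)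
    (C : CoreSet S N d) (l : List (CoreElem S N d)) :
    (evaluate abar P π C l).Spec M φ (l.length * (rolloutCost m d A P.n P.H + 1))
      (l.length * (P.n * (P.H + 1))) (Outcome φ C fun l' => l'.map Prod.fst = l) := by
  induction l with
  | nil => exact spec_ret (by exact rfl) _ _
  | cons z l ih =>
    refine Spec.mono (T := rolloutCost m d A P.n P.H +
        (l.length * (rolloutCost m d A P.n P.H + 1) + 0) + 1)
      (Q := P.n * (P.H + 1) + (l.length * (P.n * (P.H + 1)) + 0))
      (Spec.step ((spec_rollout hA hτ π C z).bind ?_))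
      (by simp only [List.length_cons]; ring_nf; exact le_rfl)
      (by simp only [List.length_cons]; ring_nf; exact le_rfl) fun _ h => h
    intro o ho
    match o, ho with
    | .uncertain z', ho => exact spec_ret (M := M) (φ := φ) (x := Status.uncertain z') ho _ _
    | .done q, _ =>
      refine ih.bind ?_
      intro o' ho'
      match o', ho' with
      | .uncertain z', ho' => exact spec_ret (M := M) (φ := φ) (x := Status.uncertain z') ho' _ _
      | .done l', ho' => exact spec_ret (by simpa [Outcome] using ho') _ _

/-- The number of instructions for one iteration of policy iteration with a core set of size `L`. -/
def iterationCost (m d A n H L : ℕ) : ℕ :=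
  L * (rolloutCost m d A n H + 1) + (d + L * (d * 3 + 1)) + d * (d * 3 + 1) + 1

theorem spec_policyIteration {A : ℕ} (hA : ∀ i, N i ≤ A) (hτ : P.τ = 1) (C : CoreSet S N d)
    (k : ℕ) (prev cur : PolicyCode d) :
    (policyIteration abar P C k prev cur).Spec M φ
      (k * iterationCost m d A P.n P.H C.elems.length) (k * (C.elems.length * (P.n * (P.H + 1))))
      (Outcome φ C fun _ => True) := by
  induction k generalizing prev cur with
  | zero => exact spec_ret trivial _ _
  | succ k ih =>
    set L := C.elems.length
    refine Spec.mono (T := L * (rolloutCost m d A P.n P.H + 1) + ((d + L * (d * 3 + 1)) +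
        (d * (d * 3 + 1) + k * iterationCost m d A P.n P.H L)) + 1)
      (Q := L * (P.n * (P.H + 1)) + (0 + (0 + k * (L * (P.n * (P.H + 1))))))
      (Spec.step ((spec_evaluate hA hτ cur C C.elems).bind ?_))
      (by simp only [iterationCost]; ring_nf; exact le_rfl) (by ring_nf; exact le_rfl) fun _ h => h
    intro o ho
    match o, ho with
    | .uncertain z', ho => exact spec_ret (M := M) (φ := φ) (x := Status.uncertain z') ho _ _
    | .done l, ho =>
      have hl : l.length = L := by
        have := congrArg List.length ho
        simpa using this
      refine (hl ▸ spec_momentVec l).bind fun y _ => ?_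
      exact (spec_mulVec C.inv y).bind fun w _ => ih _ _

/-! ### Lower bounds on expectations -/

variable {hφ : ∀ i a, Measurable fun s => φ i s a} {π₀ : Policy S (Act N)}

/-- Here the program meets the policy it stands for: a draw integrates against the kernel of the
policy, for the greedy code because `greedyProg` computes `greedyAction` exactly. -/
theorem wp_draw (π : PolicyCode d) (s : S) (F : Act N → ℝ≥0∞) :
    (π.draw s).wp M φ π₀ F = ∫⁻ a, F a ∂((π.policy φ hφ π₀).kernel s) := by
  cases π with
  | init => rfl
  | greedy w =>
    have hA : ∀ i, N i ≤ ∑ i, N i := fun i => Finset.single_le_sum (fun _ _ => Nat.zero_le _)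
      (Finset.mem_univ i)
    change (greedyProg w s).wp M φ π₀ F = _
    rw [wp_eq_of_always (spec_greedyProg hA w s).always]
    simp [PolicyCode.policy, Kernel.deterministic_apply]

/-- The policy `π'` agrees with `π` in the states where `C` is certain. -/
def Agree (φ : Features S N d) (abar : Act N) (C : CoreSet S N d) (π π' : Policy S (Act N)) : Prop :=
  ∀ s, Certain φ abar 1 C s → π.kernel s = π'.kernel s

/-- Replaces a coupling of the real policy with π'. In a certain state the check returns `none` and
both policies have the same action law, so the recursions match. In any other state the rollout
stops with an outcome worth at least 1, hence at least f. The argument of f contains g·γ because the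
next reward is weighted only after g has been multiplied by the discount factor. -/
theorem le_wp_rolloutFrom {π : PolicyCode d} {C : CoreSet S N d} {π' : Policy S (Act N)}
    (hag : Agree φ abar C (π.policy φ hφ π₀) π') (hτ : P.τ = 1) (hdisc : P.disc = M.disc)
    {f : ℝ → ℝ≥0∞} (hf : Measurable f) (hf1 : ∀ x, f x ≤ 1)
    {F : Status (CoreElem S N d) ℝ → ℝ≥0∞} (hF : ∀ z, 1 ≤ F (.uncertain z))
    (hF' : ∀ x, f x ≤ F (.done x)) (h : ℕ) (s : S) (g G : ℝ) :
    ∫⁻ y, f (G + g * M.disc * y) ∂(M.returnLaw π' h s) ≤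
      (rolloutFrom abar P π C h s g G).wp M φ π₀ F := by
  induction h generalizing s g G with
  | zero =>
    simp only [MDP.returnLaw, Kernel.const_apply]
    rw [lintegral_dirac' _ (by fun_prop)]
    simpa [rolloutFrom, wp] using hF' G
  | succ h ih =>
    have hA : ∀ i, N i ≤ ∑ i, N i := fun i => Finset.single_le_sum (fun _ _ => Nat.zero_le _)
      (Finset.mem_univ i)
    have hcheck := (spec_uncertaintyCheck (M := M) (φ := φ) hA abar P.τ C s).always
    rw [hτ] at hcheck
    by_cases hs : Certain φ abar 1 C s
    · have h1 : (uncertaintyCheck abar P.τ C s).Always M φ fun _ _ o => o = none := by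
        rw [hτ]
        refine hcheck.mono ?_
        rintro _ _ o (⟨rfl, -⟩ | ⟨z, -, -, h2⟩)
        · rfl
        · exact absurd hs h2
      rw [rolloutFrom, wp, wp_bind, wp_eq_of_always h1, wp_bind, wp_draw (hφ := hφ),
        M.lintegral_returnLaw_succ _ _ _ (by fun_prop), hag s hs]
      refine lintegral_mono fun a => lintegral_mono fun s' => ?_
      refine le_trans (le_of_eq ?_) (ih s' (g * P.disc) (G + g * P.disc * M.reward (s, a)))
      refine lintegral_congr fun y => ?_
      rw [hdisc]
      congr 1
      ring
    · have h1 : (uncertaintyCheck abar P.τ C s).Always M φ fun _ _ o => ∃ z, o = some z := by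
        rw [hτ]
        refine hcheck.mono ?_
        rintro _ _ o (⟨-, h2⟩ | ⟨z, rfl, -, -⟩)
        · exact absurd h2 hs
        · exact ⟨z, rfl⟩
      rw [rolloutFrom, wp, wp_bind]
      calc _ ≤ ∫⁻ _, 1 ∂(M.returnLaw π' (h + 1) s) := lintegral_mono fun y => hf1 _
        _ = 1 := by simp
        _ = (uncertaintyCheck abar P.τ C s).wp M φ π₀ fun _ => 1 := (wp_const _ _).symm
        _ ≤ _ := wp_mono_of_always h1 (by rintro _ ⟨z, rfl⟩; exact hF z)

theorem le_wp_rolloutSum {π : PolicyCode d} {C : CoreSet S N d} {π' : Policy S (Act N)}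
    (hag : Agree φ abar C (π.policy φ hφ π₀) π') (hτ : P.τ = 1) (hdisc : P.disc = M.disc)
    {f : ℝ → ℝ≥0∞} (hf : Measurable f) (hf1 : ∀ x, f x ≤ 1)
    {F : Status (CoreElem S N d) ℝ → ℝ≥0∞} (hF : ∀ z, 1 ≤ F (.uncertain z))
    (hF' : ∀ x, f x ≤ F (.done x)) (z : CoreElem S N d) (n : ℕ) (G : ℝ) :
    ∫⁻ y, f (G + y) ∂(sumLaw (M.backup (M.returnLaw π' P.H) (z.state, z.action)) n) ≤
      (rolloutSum abar P π C z n G).wp M φ π₀ F := by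
  induction n generalizing G with
  | zero =>
    rw [sumLaw, lintegral_dirac' _ (by fun_prop)]
    simpa [rolloutSum, wp] using hF' G
  | succ n ih =>
    set μ := M.backup (M.returnLaw π' P.H) (z.state, z.action) with hμ
    have hmeas : Measurable fun x => ∫⁻ y, f (G + x + y) ∂(sumLaw μ n) :=
      Measurable.lintegral_prod_right' (f := fun p : ℝ × ℝ => f (G + p.1 + p.2)) (by fun_prop)
    rw [lintegral_sumLaw_succ _ _ (f := fun x => f (G + x)) (by fun_prop), rolloutSum, wp, wp]
    simp only [← add_assoc]
    rw [hμ, M.lintegral_backup _ _ hmeas]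
    refine lintegral_mono fun s' => ?_
    simp only [wp_bind]
    -- One rollout is peeled off. Its test function is the expectation over the n remaining
    -- rollouts, and the induction hypothesis is the required bound at the outcome `.done`.
    refine le_trans (le_of_eq ?_) (le_wp_rolloutFrom (hφ := hφ) hag hτ hdisc hmeas
      (fun x => ?_) (fun z' => ?_) (fun x => ?_) P.H s' 1 (M.reward (z.state, z.action)))
    · simp only [one_mul]
    · calc _ ≤ ∫⁻ _, 1 ∂(sumLaw μ n) := lintegral_mono fun y => hf1 _
        _ = 1 := by simp
    · exact hF z'
    · exact ih (G + x)

/-- With high probability, the rollouts meet an uncertain state or give an accurate estimate of the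
value of every policy that agrees with the current one in the certain states. -/
theorem likely_rollout {π : PolicyCode d} {C : CoreSet S N d} {π' : Policy S (Act N)}
    (hag : Agree φ abar C (π.policy φ hφ π₀) π') (hτ : P.τ = 1) (hdisc : P.disc = M.disc)
    (hn : 1 ≤ P.n) {θ : ℝ} (hθ : 0 ≤ θ) (hH : M.disc ^ (P.H + 1) * (1 / (1 - M.disc)) ≤ θ)
    (z : CoreElem S N d) :
    (rollout abar P π C z).Likely M φ π₀ (2 * Real.exp (-(2 * P.n * θ ^ 2 * (1 - M.disc) ^ 2)))
      fun o => ∀ q, o = .done q → |q - M.qValue π' z.state z.action| ≤ 2 * θ := by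
  set μ := M.backup (M.returnLaw π' P.H) (z.state, z.action) with hμ
  have hB : 0 < 1 / (1 - M.disc) := by have := M.one_sub_disc_pos; positivity
  have hoeff := sumLaw_abs_sub_gt_le hB (M.backup_returnLaw_compl_Icc π' P.H (z.state, z.action))
    hn hθ
  rw [← hμ] at hoeff
  have hexp : -(2 * P.n * θ ^ 2 / (1 / (1 - M.disc)) ^ 2) =
      -(2 * P.n * θ ^ 2 * (1 - M.disc) ^ 2) := by
    rw [one_div, inv_pow, div_inv_eq_mul]
  rw [hexp] at hoeff
  set E : Set ℝ := {x | |x / P.n - ∫ y, y ∂μ| ≤ θ} with hE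
  have hEm : MeasurableSet E := measurableSet_le (by fun_prop) measurable_const
  -- The truncation bias uses the second θ. A rollout collects H + 1 rewards, the first one at z
  -- itself, whence the exponent.
  have hbias : |∫ y, y ∂μ - M.qValue π' z.state z.action| ≤ θ :=
    (M.abs_integral_backup_sub_qValue_le π' (M.abs_returnMean_sub_value_le π' P.H)
      (z.state, z.action)).trans (by rw [← mul_assoc, ← pow_succ']; exact hH)
  unfold Likely
  have h1 : ENNReal.ofReal (1 - 2 * Real.exp (-(2 * P.n * θ ^ 2 * (1 - M.disc) ^ 2))) ≤
      ∫⁻ y, E.indicator 1 (0 + y) ∂(sumLaw μ P.n) := by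
    simp only [zero_add]
    rw [lintegral_indicator_one hEm, ENNReal.ofReal_sub _ (by positivity), ENNReal.ofReal_one]
    rw [prob_compl_eq_one_sub hEm] at hoeff
    exact tsub_le_iff_tsub_le.1 hoeff
  refine h1.trans ?_
  rw [rollout, wp_bind]
  refine le_wp_rolloutSum (hφ := hφ) hag hτ hdisc (measurable_one.indicator hEm) (fun x => ?_)
    (fun z' => ?_) (fun x => ?_) z P.n 0
  · exact Set.indicator_le (fun _ _ => le_rfl) x |>.trans le_rfl
  · simp [wp]
  · by_cases hx : x ∈ E
    · have h2 : |x / P.n - M.qValue π' z.state z.action| ≤ 2 * θ := by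
        have := abs_add_le (x / P.n - ∫ y, y ∂μ) (∫ y, y ∂μ - M.qValue π' z.state z.action)
        rw [sub_add_sub_cancel] at this
        have h3 : |x / P.n - ∫ y, y ∂μ| ≤ θ := hx
        linarith
      simp [wp, Arith.eval, hx, h2]
    · simp [hx]

end Rollouts

/-! ### Consequences of additivity: componentwise maximization and the factor 2m - 1 -/

section AdditiveFeatures

variable {S : Type u} {m : ℕ} {N : Fin m → ℕ} {d : ℕ} {φ : Features S N d} {abar : Act N}

/-- The linear score is a sum of terms that depend on one component each, so componentwise
maximization is global. -/
theorem vec_le_greedyAction [∀ i, NeZero (N i)] (w : Fin d → ℝ) (s : S) (a : Act N) :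
    φ.vec s a ⬝ᵥ w ≤ φ.vec s (greedyAction φ w s) ⬝ᵥ w := by
  have h : ∀ a : Act N, φ.vec s a ⬝ᵥ w = ∑ i, ∑ j, w j * φ i s (a i) j := fun a => by
    simp only [dotProduct, Features.vec, Finset.sum_mul]
    rw [Finset.sum_comm]
    exact Finset.sum_congr rfl fun i _ => Finset.sum_congr rfl fun j _ => mul_comm _ _
  rw [h, h]
  exact Finset.sum_le_sum fun i _ => firstArgmax_spec (fun a => ∑ j, w j * φ i s a j) (a i)

/-- Changing component i of ā changes only the i-th summand. The m changes together turn φ(s, ā)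
into φ(s, a), and φ(s, ā) has been counted m - 1 times too often. -/
theorem Features.vec_eq_sum_update (abar : Act N) (s : S) (a : Act N) :
    φ.vec s a = ∑ i, φ.vec s (Function.update abar i (a i)) - ((m : ℝ) - 1) • φ.vec s abar := by
  ext j
  have h : ∀ i, φ.vec s (Function.update abar i (a i)) j =
      φ.vec s abar j + (φ i s (a i) j - φ i s (abar i) j) := fun i => by
    simp only [Features.vec]
    rw [← Finset.add_sum_erase _ _ (Finset.mem_univ i),
      ← Finset.add_sum_erase (f := fun k => (φ k s (abar k)) j) _ (Finset.mem_univ i)]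
    rw [Finset.sum_congr rfl fun k hk => by
      rw [Function.update_of_ne (Finset.ne_of_mem_erase hk)]]
    simp
    ring
  simp only [Pi.sub_apply, Finset.sum_apply, Pi.smul_apply, smul_eq_mul, h, Finset.sum_add_distrib,
    Finset.sum_sub_distrib]
  simp only [Finset.sum_const, Finset.card_univ, Fintype.card_fin, nsmul_eq_mul, Features.vec]
  ring

/-- The decomposition has total weight m + (m - 1). The default vector is itself among the checked
ones, as ā updated with its own entry. -/
theorem abs_vec_dotProduct_le (hm : 1 ≤ m) {s : S} {v : Fin d → ℝ} {β : ℝ}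
    (h : ∀ i a, |φ.vec s (Function.update abar i a) ⬝ᵥ v| ≤ β) (a : Act N) :
    |φ.vec s a ⬝ᵥ v| ≤ (2 * m - 1) * β := by
  have hm' : (1 : ℝ) ≤ m := by exact_mod_cast hm
  rw [Features.vec_eq_sum_update abar, sub_dotProduct, sum_dotProduct, smul_dotProduct, smul_eq_mul]
  have h1 : |∑ i, φ.vec s (Function.update abar i (a i)) ⬝ᵥ v| ≤ m * β :=
    (Finset.abs_sum_le_sum_abs _ _).trans
      ((Finset.sum_le_sum fun i _ => h i (a i)).trans (by simp))
  have h2 : |((m : ℝ) - 1) * (φ.vec s abar ⬝ᵥ v)| ≤ ((m : ℝ) - 1) * β := by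
    rw [abs_mul, abs_of_nonneg (by linarith)]
    refine mul_le_mul_of_nonneg_left ?_ (by linarith)
    have := h ⟨0, hm⟩ (abar ⟨0, hm⟩)
    rwa [Function.update_eq_self] at this
  refine (abs_sub _ _).trans ?_
  linarith

end AdditiveFeatures

section Estimates

variable {S : Type u} [MeasurableSpace S] {m : ℕ} {N : Fin m → ℕ} {d : ℕ}
  {M : MDP S (Act N)} {φ : Features S N d} {π₀ : Policy S (Act N)} {abar : Act N} {P : Params}

theorem Features.measurable_vec (hφ : ∀ i a, Measurable fun s => φ i s a) (a : Act N) (j : Fin d) :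
    Measurable fun s => φ.vec s a j :=
  Finset.measurable_sum _ fun i _ =>
    (by fun_prop : Measurable fun x : EuclideanSpace ℝ (Fin d) => x j).comp (hφ i (a i))

/-! ### The error of the least squares estimate -/

/-- The accuracy of the least squares estimate of `Q_π` in the certain states. -/
theorem abs_vec_dotProduct_sub_qValue_le (hm : 1 ≤ m) {lam b ε θ Cm : ℝ} (hlam : 0 < lam)
    (hb : 0 ≤ b) (hε : 0 ≤ ε) (hθ : 0 ≤ θ) {C : CoreSet S N d} (hC : C.Valid φ lam)
    (hCm : C.elems.length ≤ Cm) (hreal : Realizable M φ b ε) (π : Policy S (Act N))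
    {l : List (CoreElem S N d × ℝ)} (hl : l.map Prod.fst = C.elems)
    (hq : ∀ p ∈ l, |p.2 - M.qValue π p.1.state p.1.action| ≤ 2 * θ) {s : S}
    (hs : Certain φ abar 1 C s) (a : Act N) :
    |φ.vec s a ⬝ᵥ (of C.inv *ᵥ (l.map fun p => p.2 • p.1.feat).sum) - M.qValue π s a| ≤
      (2 * m - 1) * (√Cm * (2 * θ + ε) + √lam * b) + ε := by
  obtain ⟨w, hwb, hw⟩ := hreal π
  simp only [inner_total] at hw
  set L := l.map fun p => (p.1.feat, p.2) with hL
  have hL1 : L.map Prod.fst = C.elems.map CoreElem.feat := by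
    rw [hL, ← hl, List.map_map, List.map_map]; rfl
  have hL2 : (l.map fun p => p.2 • p.1.feat).sum = (L.map fun p => p.2 • p.1).sum := by
    rw [hL, List.map_map]; rfl
  have hlen : (L.length : ℝ) ≤ Cm := by
    have : L.length = C.elems.length := by rw [← hl, hL]; simp
    rw [this]; exact hCm
  have hww : (w : Fin d → ℝ) ⬝ᵥ (w : Fin d → ℝ) ≤ b ^ 2 := by
    have h1 : (w : Fin d → ℝ) ⬝ᵥ (w : Fin d → ℝ) = ‖w‖ ^ 2 := by
      rw [EuclideanSpace.norm_sq_eq]; simp [dotProduct, pow_two]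
    rw [h1]
    exact pow_le_pow_left₀ (norm_nonneg _) hwb 2
  -- The regression targets deviate by 2θ from Q_π, and Q_π deviates by ε from the linear function.
  have herr : ∀ p ∈ L, |p.2 - p.1 ⬝ᵥ (w : Fin d → ℝ)| ≤ 2 * θ + ε := by
    intro p hp
    obtain ⟨p', hp', rfl⟩ := List.mem_map.1 hp
    have hmem : p'.1 ∈ C.elems := by rw [← hl]; exact List.mem_map_of_mem hp'
    simp only [hC.feat_eq _ hmem]
    have h1 := hq p' hp'
    have h2 := hw p'.1.state p'.1.action
    have h3 := abs_add_le (p'.2 - M.qValue π p'.1.state p'.1.action)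
      (M.qValue π p'.1.state p'.1.action - φ.vec p'.1.state p'.1.action ⬝ᵥ (w : Fin d → ℝ))
    rw [sub_add_sub_cancel] at h3
    linarith
  have hnb : ∀ i a, |φ.vec s (Function.update abar i a) ⬝ᵥ
      (of C.inv *ᵥ (l.map fun p => p.2 • p.1.feat).sum - (w : Fin d → ℝ))| ≤
      √Cm * (2 * θ + ε) + √lam * b := by
    intro i a
    rw [dotProduct_sub, hC.inv_eq, hL2, ← hL1]
    refine abs_leastSquares_sub_le hlam L hb (by linarith) hww herr hlen ?_
    have := hs i a
    rwa [hC.inv_eq, ← hL1] at this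
  have h1 := abs_vec_dotProduct_le hm hnb a
  rw [dotProduct_sub] at h1
  have h2 := hw s a
  have h3 := abs_sub_le (φ.vec s a ⬝ᵥ (of C.inv *ᵥ (l.map fun p => p.2 • p.1.feat).sum))
    (φ.vec s a ⬝ᵥ (w : Fin d → ℝ)) (M.qValue π s a)
  rw [abs_sub_comm] at h2
  linarith

/-- At ρ both values are averages of the respective Q-functions over the same action law, and both
Q-functions are within η of the same linear function. -/
theorem value_sub_le_of_agree {w : Fin d → ℝ} {π π' : Policy S (Act N)}
    {η : ℝ} {ρ : S} (hkernel : π.kernel ρ = π'.kernel ρ)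
    (hw : ∀ a, |φ.vec ρ a ⬝ᵥ w - M.qValue π ρ a| ≤ η)
    (hw' : ∀ a, |φ.vec ρ a ⬝ᵥ w - M.qValue π' ρ a| ≤ η) :
    M.value π' ρ - M.value π ρ ≤ 2 * η := by
  rw [M.value_eq_integral_qValue, M.value_eq_integral_qValue, hkernel,
    ← integral_sub (M.integrable_qValue _ _ _) (M.integrable_qValue _ _ _)]
  refine (le_abs_self _).trans (abs_integral_le_of_abs_le fun a => ?_)
  have h1 := abs_sub_le (M.qValue π' ρ a) (φ.vec ρ a ⬝ᵥ w) (M.qValue π ρ a)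
  have h2 := hw' a
  rw [abs_sub_comm] at h2
  linarith [hw a]

theorem likely_ret {α : Type v} {x : α} {A : α → Prop} (h : A x) {ε : ℝ} (hε : 0 ≤ ε) :
    (ret x : Prog S N d α).Likely M φ π₀ ε A :=
  (likely_of_always (p := ret x) h).mono hε fun _ h => h

theorem Spec.likely {α : Type v} {p : Prog S N d α} {T Q : ℕ} {A : α → Prop}
    (h : p.Spec M φ T Q A) : p.Likely M φ π₀ 0 A :=
  likely_of_always h.always

/-- Each unsuccessful pass enlarges a valid core set, whose size cannot exceed n₀, so the fuel does
not run out. Checks need no queries. -/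
theorem spec_initCore {A : ℕ} (hA : ∀ i, N i ≤ A) (hτ : P.τ = 1) (hlam : 0 < P.lam) {n₀ : ℕ}
    (hn₀ : ∀ C : CoreSet S N d, C.Valid φ P.lam → C.elems.length ≤ n₀) (ρ : S) (fuel : ℕ)
    {C : CoreSet S N d} (hC : C.Valid φ P.lam) (hfuel : n₀ + 1 ≤ fuel + C.elems.length) :
    (initCore abar P ρ fuel C).Spec M φ
      ((n₀ + 1 - C.elems.length) * (checkCost m d A + insertCost d + 1)) 0
      fun o => ∃ C', o = some C' ∧ C'.Valid φ P.lam ∧ Certain φ abar 1 C' ρ := by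
  induction fuel generalizing C with
  | zero => have := hn₀ C hC; omega
  | succ fuel ih =>
    have hlen := hn₀ C hC
    have hlen' : n₀ + 1 - C.elems.length = (n₀ - C.elems.length) + 1 := by omega
    refine Spec.mono (T := checkCost m d A + (insertCost d +
        (n₀ - C.elems.length) * (checkCost m d A + insertCost d + 1)) + 1) (Q := 0 + (0 + 0))
      (Spec.step ((spec_uncertaintyCheck hA abar P.τ C ρ).bind ?_))
      (by rw [hlen']; ring_nf; exact le_rfl) le_rfl fun _ h => h
    rw [hτ]
    rintro o (⟨rfl, ho⟩ | ⟨z, rfl, hz, -⟩)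
    · exact spec_ret ⟨C, rfl, hC, ho⟩ _ _
    · refine (spec_insert C z).bind fun C' hC' => ?_
      subst hC'
      have hlen2 : (C.push z).elems.length = C.elems.length + 1 := by simp [CoreSet.push]
      have := ih (hC.push hlam hz) (by omega)
      rwa [hlen2, Nat.add_sub_add_right] at this

theorem spec_start (hlam : 0 < P.lam) {B : Fin d → Fin d → ℝ}
    (hB : of B = P.lam⁻¹ • (1 : Matrix (Fin d) (Fin d) ℝ)) (ρ : S) :
    (CoreSet.insert ⟨[], B⟩ ⟨ρ, abar, φ.vec ρ abar⟩ : Prog S N d _).Spec M φ (insertCost d) 0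
      fun C => C.Valid φ P.lam ∧ C.elems.length = 1 :=
  (spec_insert _ _).mono le_rfl le_rfl fun C hC => by
    rw [hC]; exact ⟨CoreSet.valid_singleton hlam hB ρ abar, by simp [CoreSet.push]⟩

/-- Needed for the virtual policy, defined by cases on certainty, to be a kernel. -/
theorem measurableSet_certain (hφ : ∀ i a, Measurable fun s => φ i s a) (τ : ℝ)
    (C : CoreSet S N d) : MeasurableSet {s | Certain φ abar τ C s} := by
  simp only [Certain, Set.ofPred_forall]
  refine MeasurableSet.iInter fun i => MeasurableSet.iInter fun a =>
    measurableSet_le ?_ measurable_const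
  simp only [dotProduct, Matrix.mulVec]
  exact Finset.measurable_sum _ fun j _ => (Features.measurable_vec hφ _ j).mul
    (Finset.measurable_sum _ fun k _ => (Features.measurable_vec hφ _ k).const_mul _)

end Estimates

/-! ### Virtual policies, which are nearly greedy in every state -/

section VirtualPolicy

variable {S : Type u} [MeasurableSpace S] {m : ℕ} {N : Fin m → ℕ} {d : ℕ} [∀ i, NeZero (N i)]
  {M : MDP S (Act N)} {φ : Features S N d} {abar : Act N}

instance : NeZero (Fintype.card (Act N)) := ⟨Fintype.card_ne_zero⟩

/-- An action vector that maximizes `Q_π(s, ·)`. -/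
noncomputable def bestAction (M : MDP S (Act N)) (π : Policy S (Act N)) (s : S) : Act N :=
  (Fintype.equivFin (Act N)).symm
    (firstArgmax fun i => M.qValue π s ((Fintype.equivFin (Act N)).symm i))

theorem qValue_le_bestAction (π : Policy S (Act N)) (s : S) (a : Act N) :
    M.qValue π s a ≤ M.qValue π s (bestAction M π s) := by
  have := firstArgmax_spec (fun i => M.qValue π s ((Fintype.equivFin (Act N)).symm i))
    (Fintype.equivFin (Act N) a)
  simpa [bestAction] using this

theorem measurable_bestAction (π : Policy S (Act N)) : Measurable (bestAction M π) :=
  (measurable_of_finite _).comp (measurable_firstArgmax.comp (measurable_pi_iff.2 fun _ =>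
    (M.measurable_qValue π).comp (measurable_id.prodMk measurable_const)))

open Classical in
/-- The virtual policy: greedy with respect to `wᵀ φ` in the certain states, and greedy with respect
to `Q_π` in the other ones. -/
noncomputable def virtualPolicy (M : MDP S (Act N)) (φ : Features S N d)
    (hφ : ∀ i a, Measurable fun s => φ i s a) (abar : Act N) (C : CoreSet S N d) (w : Fin d → ℝ)
    (π : Policy S (Act N)) : Policy S (Act N) :=
  ⟨Kernel.deterministic
    (fun s => if Certain φ abar 1 C s then greedyAction φ w s else bestAction M π s)
    (Measurable.ite (measurableSet_certain hφ 1 C) (measurable_greedyAction φ hφ w)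
      (measurable_bestAction π)), inferInstance⟩

variable {hφ : ∀ i a, Measurable fun s => φ i s a} {π₀ : Policy S (Act N)}

theorem agree_virtualPolicy (C : CoreSet S N d) (w : Fin d → ℝ) (π : Policy S (Act N)) :
    Agree φ abar C ((PolicyCode.greedy w).policy φ hφ π₀) (virtualPolicy M φ hφ abar C w π) := by
  intro s hs
  simp [PolicyCode.policy, virtualPolicy, Kernel.deterministic_apply, hs]

/-- In certain states the error η is paid twice, at the competing action and at the greedy one; in
the other states the maximization is exact. -/
theorem virtualPolicy_approx_greedy {C : CoreSet S N d} {w : Fin d → ℝ} {π : Policy S (Act N)}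
    {η : ℝ} (hη : 0 ≤ η)
    (hw : ∀ s, Certain φ abar 1 C s → ∀ a, |φ.vec s a ⬝ᵥ w - M.qValue π s a| ≤ η)
    (s : S) (a : Act N) : M.qValue π s a ≤
      ∫ a', M.qValue π s a' ∂((virtualPolicy M φ hφ abar C w π).kernel s) + 2 * η := by
  simp only [virtualPolicy, Kernel.deterministic_apply, integral_dirac]
  split_ifs with hs
  · have h1 := abs_le.1 (hw s hs a)
    have h2 := abs_le.1 (hw s hs (greedyAction φ w s))
    have h3 := vec_le_greedyAction (φ := φ) w s a
    linarith
  · have := qValue_le_bestAction (M := M) π s a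
    linarith

end VirtualPolicy

/-! ### Accuracy and cost of policy iteration with restarts -/

section Runs

variable {S : Type u} [MeasurableSpace S] {m : ℕ} {N : Fin m → ℕ} {d : ℕ} [∀ i, NeZero (N i)]
  {M : MDP S (Act N)} {φ : Features S N d} {abar : Act N} {P : Params}
  {hφ : ∀ i a, Measurable fun s => φ i s a} {π₀ : Policy S (Act N)}

theorem likely_evaluate {π : PolicyCode d} {C : CoreSet S N d} {A : CoreElem S N d → ℝ → Prop}
    {e : ℝ} (he : 0 ≤ e) (h : ∀ z, (rollout abar P π C z).Likely M φ π₀ e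
      fun o => ∀ q, o = .done q → A z q) (l : List (CoreElem S N d)) :
    (evaluate abar P π C l).Likely M φ π₀ (l.length * e)
      fun o => ∀ l', o = .done l' → ∀ p ∈ l', A p.1 p.2 := by
  induction l with
  | nil =>
    refine likely_ret ?_ (by simp)
    rintro l' h
    cases h
    simp
  | cons z l ih =>
    have h1 : (evaluate abar P π C (z :: l)).Likely M φ π₀ (e + (l.length * e + 0))
        fun o => ∀ l', o = .done l' → ∀ p ∈ l', A p.1 p.2 := by
      refine Likely.bind (h z) (fun o ho => ?_) he (by positivity)
      match o, ho with
      | .uncertain z', ho => exact likely_ret (by rintro l' ⟨⟩) (by positivity)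
      | .done q, ho =>
        refine Likely.bind ih (fun o' ho' => ?_) (by positivity) le_rfl
        match o', ho' with
        | .uncertain z', ho' => exact likely_ret (by rintro l' ⟨⟩) le_rfl
        | .done l', ho' =>
          refine likely_ret ?_ le_rfl
          rintro _ ⟨⟩ p hp
          rcases List.mem_cons.1 hp with rfl | hp
          · exact ho q rfl
          · exact ho' l' rfl p hp
    refine h1.mono (le_of_eq ?_) fun _ h => h
    rw [List.length_cons]
    push_cast
    ring

/-- The failure probability of the rollouts from one core set element. -/
noncomputable def rolloutFail (n : ℕ) (θ γ : ℝ) : ℝ :=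
  2 * (2 * Real.exp (-(2 * n * θ ^ 2 * (1 - γ) ^ 2)))

theorem rolloutFail_nonneg (n : ℕ) (θ γ : ℝ) : 0 ≤ rolloutFail n θ γ := by
  unfold rolloutFail; positivity

/-- The conditions on the parameters under which the policy that the algorithm returns is optimal up
to `target`. Here `Cm` is a bound on the size of the core set and `η` a bound on the error of the
estimates in certain states. -/
structure Accurate (M : MDP S (Act N)) (φ : Features S N d) (P : Params)
    (b ε θ Cm η target : ℝ) : Prop where
  one_le_m : 1 ≤ m
  lam_pos : 0 < P.lam
  b_nonneg : 0 ≤ b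
  ε_nonneg : 0 ≤ ε
  θ_nonneg : 0 ≤ θ
  η_nonneg : 0 ≤ η
  τ_eq : P.τ = 1
  disc_eq : P.disc = M.disc
  one_le_n : 1 ≤ P.n
  one_le_K : 1 ≤ P.K
  bias_le : M.disc ^ (P.H + 1) * (1 / (1 - M.disc)) ≤ θ
  realizable : Realizable M φ b ε
  error_le : (2 * m - 1) * (√Cm * (2 * θ + ε) + √P.lam * b) + ε ≤ η
  gap_le : M.disc ^ (P.K - 1) / (1 - M.disc) + 2 * η / (1 - M.disc) ^ 2 + 2 * η ≤ target
  length_le : ∀ C : CoreSet S N d, C.Valid φ P.lam → (C.elems.length : ℝ) ≤ Cm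

variable {b ε θ Cm η target : ℝ}

/-- Induction over the remaining iterations, carrying a virtual policy π that agrees with the
current one in certain states and has the gap bound after j steps against every competitor, in all
states. The real policies have no such bound outside the certain states; they are compared with π at
ρ only. -/
theorem likely_policyIteration (hacc : Accurate M φ P b ε θ Cm η target) {C : CoreSet S N d}
    (hC : C.Valid φ P.lam) {ρ : S} (hρ : Certain φ abar 1 C ρ) (k j : ℕ) (hjk : j + k = P.K)
    (prev cur : PolicyCode d) (π : Policy S (Act N)) (hag : Agree φ abar C (cur.policy φ hφ π₀) π)
    (hgap : ∀ (π₂ : Policy S (Act N)) s, M.value π₂ s - M.value π s ≤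
      M.disc ^ j / (1 - M.disc) + 2 * η / (1 - M.disc) ^ 2)
    (hprev : k = 0 → M.optValue ρ - M.value (prev.policy φ hφ π₀) ρ ≤ target) :
    (policyIteration abar P C k prev cur).Likely M φ π₀
      (k * (C.elems.length * rolloutFail P.n θ M.disc))
      fun o => ∀ c, o = .done c → M.optValue ρ - M.value (c.policy φ hφ π₀) ρ ≤ target := by
  induction k generalizing j prev cur π with
  | zero =>
    refine likely_ret ?_ (by simp)
    rintro _ ⟨⟩
    exact hprev rfl
  | succ k ih =>
    have hfail := rolloutFail_nonneg P.n θ M.disc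
    have hA : ∀ i, N i ≤ ∑ i, N i := fun i => Finset.single_le_sum (fun _ _ => Nat.zero_le _)
      (Finset.mem_univ i)
    -- The same averages are tested against the Q-functions of the real and of the virtual policy,
    -- hence the outer factor 2 in `rolloutFail`.
    have hrollout : ∀ z, (rollout abar P cur C z).Likely M φ π₀ (rolloutFail P.n θ M.disc)
        fun o => ∀ q, o = .done q →
          |q - M.qValue (cur.policy φ hφ π₀) z.state z.action| ≤ 2 * θ ∧
          |q - M.qValue π z.state z.action| ≤ 2 * θ := by
      intro z
      have h1 := likely_rollout (hφ := hφ) (π₀ := π₀) (π := cur)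
        (π' := cur.policy φ hφ π₀) (C := C) (abar := abar) (fun _ _ => rfl) hacc.τ_eq
        hacc.disc_eq hacc.one_le_n hacc.θ_nonneg hacc.bias_le z
      have h2 := likely_rollout (hφ := hφ) hag hacc.τ_eq
        hacc.disc_eq hacc.one_le_n hacc.θ_nonneg hacc.bias_le z
      refine (h1.and h2 (by positivity) (by positivity)).mono ?_ fun o ho q hq =>
        ⟨ho.1 q hq, ho.2 q hq⟩
      rw [rolloutFail]
      exact (two_mul _).ge
    have heval := (likely_evaluate hfail hrollout C.elems).and_always
      (spec_evaluate (abar := abar) (P := P) hA hacc.τ_eq cur C C.elems).always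
    have hstep : (policyIteration abar P C (k + 1) prev cur).Likely M φ π₀
        (C.elems.length * rolloutFail P.n θ M.disc +
          (0 + (0 + k * (C.elems.length * rolloutFail P.n θ M.disc))))
        fun o => ∀ c, o = .done c → M.optValue ρ - M.value (c.policy φ hφ π₀) ρ ≤ target := by
      refine Likely.bind heval (fun o ho => ?_) (by positivity) (by positivity)
      match o, ho with
      | .uncertain z', ho => exact likely_ret (by rintro l' ⟨⟩) (by positivity)
      | .done l, ho =>
        have hl : l.map Prod.fst = C.elems := ho.2
        have hq := ho.1 l rfl
        refine Likely.bind (Spec.likely (spec_momentVec l)) (fun y hy => ?_) le_rfl (by positivity)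
        refine Likely.bind (Spec.likely (spec_mulVec C.inv y)) (fun w hw => ?_) le_rfl
          (by positivity)
        rw [hy] at hw
        have herr : ∀ π' : Policy S (Act N),
            (∀ p ∈ l, |p.2 - M.qValue π' p.1.state p.1.action| ≤ 2 * θ) →
            ∀ s, Certain φ abar 1 C s → ∀ a, |φ.vec s a ⬝ᵥ w - M.qValue π' s a| ≤ η := by
          intro π' hq' s hs a
          rw [hw]
          exact (abs_vec_dotProduct_sub_qValue_le hacc.one_le_m hacc.lam_pos hacc.b_nonneg
            hacc.ε_nonneg hacc.θ_nonneg hC (hacc.length_le C hC) hacc.realizable π' hl hq' hs a).trans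
            hacc.error_le
        have herr1 := herr (cur.policy φ hφ π₀) fun p hp => (hq p hp).1
        have herr2 := herr π fun p hp => (hq p hp).2
        -- The new virtual policy improves on the virtual π, not on the real `cur`, so that the
        -- contraction applies.
        refine ih (j + 1) (by omega) cur (.greedy w) (virtualPolicy M φ hφ abar C w π)
          (agree_virtualPolicy C w π) (fun π₂ s => ?_) fun hk => ?_
        · refine (MDP.gap_of_approx_greedy (virtualPolicy_approx_greedy (hφ := hφ) hacc.η_nonneg
            herr2) hgap π₂ s).trans (le_of_eq ?_)
          have := M.one_sub_disc_pos.ne'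
          rw [pow_succ]
          field_simp
          ring
        -- The last iteration serves only to produce a w that is accurate for both Q-functions,
        -- which transfers the gap from π to the real policy at ρ.
        · have h1 := value_sub_le_of_agree (hag ρ hρ) (herr1 ρ hρ) (herr2 ρ hρ)
          have hj : j = P.K - 1 := by omega
          have : Nonempty (Policy S (Act N)) := ⟨π₀⟩
          refine MDP.optValue_sub_le fun π₂ => ?_
          have h2 := hgap π₂ ρ
          rw [hj] at h2
          linarith [hacc.gap_le]
    refine hstep.mono (le_of_eq ?_) fun _ h => h
    push_cast
    ring

/-- A restart enlarges a core set of at most n₀ elements, so at most n₀ + 1 - |C| runs remain. The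
run that completes is good by `likely_policyIteration`; ρ stays certain because uncertainties only
decrease. -/
theorem likely_mainLoop (hacc : Accurate M φ P b ε θ Cm η target) {n₀ : ℕ}
    (hn₀ : ∀ C : CoreSet S N d, C.Valid φ P.lam → C.elems.length ≤ n₀) {ρ : S} (fuel : ℕ)
    {C : CoreSet S N d} (hC : C.Valid φ P.lam) (hρ : Certain φ abar 1 C ρ)
    (hfuel : n₀ + 1 ≤ fuel + C.elems.length) :
    (mainLoop abar P fuel C).Likely M φ π₀
      (((n₀ + 1 - C.elems.length : ℕ) : ℝ) * (P.K * (n₀ * rolloutFail P.n θ M.disc)))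
      fun o => ∃ c, o = some c ∧ M.optValue ρ - M.value (c.policy φ hφ π₀) ρ ≤ target := by
  induction fuel generalizing C with
  | zero => have := hn₀ C hC; omega
  | succ fuel ih =>
    have hfail := rolloutFail_nonneg P.n θ M.disc
    have hA : ∀ i, N i ≤ ∑ i, N i := fun i => Finset.single_le_sum (fun _ _ => Nat.zero_le _)
      (Finset.mem_univ i)
    have hlen := hn₀ C hC
    have hη := hacc.η_nonneg
    have hpos := M.one_sub_disc_pos
    -- A run starts with π₀ as its own virtual policy, whose gap is at most 1/(1-γ). The initial
    -- `prev` is a dummy, as K ≥ 1.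
    have hrun := (likely_policyIteration (hφ := hφ) (π₀ := π₀) hacc hC hρ P.K 0 (by omega)
      .init .init π₀ (fun _ _ => rfl) (fun π₂ s => by
        have h1 := M.value_le π₂ s
        have h2 := M.value_nonneg π₀ s
        have h3 : 0 ≤ 2 * η / (1 - M.disc) ^ 2 := by positivity
        rw [pow_zero]
        linarith) (fun h => by have := hacc.one_le_K; omega)).and_always
      (spec_policyIteration (abar := abar) (P := P) hA hacc.τ_eq C P.K .init .init).always
    have hlen' : n₀ + 1 - C.elems.length = (n₀ - C.elems.length) + 1 := by omega
    have hstep : (mainLoop abar P (fuel + 1) C).Likely M φ π₀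
        (P.K * (n₀ * rolloutFail P.n θ M.disc) + (0 + ((n₀ - C.elems.length : ℕ) : ℝ) *
          (P.K * (n₀ * rolloutFail P.n θ M.disc))))
        fun o => ∃ c, o = some c ∧ M.optValue ρ - M.value (c.policy φ hφ π₀) ρ ≤ target := by
      refine Likely.bind (hrun.mono ?_ fun _ h => h) (fun o ho => ?_) (by positivity)
        (by positivity)
      · have : (C.elems.length : ℝ) ≤ n₀ := by exact_mod_cast hlen
        gcongr
      match o, ho with
      | .uncertain z, ho =>
        refine Likely.bind (Spec.likely (spec_insert C z)) (fun C' hC' => ?_) le_rfl (by positivity)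
        subst hC'
        have hz : IsUncertain φ 1 C z := ho.2
        have hlen2 : (C.push z).elems.length = C.elems.length + 1 := by simp [CoreSet.push]
        refine (ih (hC.push hacc.lam_pos hz) (hC.certain_push hacc.lam_pos hρ)
          (by omega)).mono (le_of_eq ?_) fun _ h => h
        rw [hlen2, Nat.add_sub_add_right]
      | .done c, ho => exact likely_ret ⟨c, rfl, ho.1 c rfl⟩ (by positivity)
    refine hstep.mono (le_of_eq ?_) fun _ h => h
    rw [hlen']
    push_cast
    ring

theorem iterationCost_mono {m d A n H L L' : ℕ} (h : L ≤ L') :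
    iterationCost m d A n H L ≤ iterationCost m d A n H L' := by
  unfold iterationCost; gcongr

/-- The number of instructions for one run of policy iteration and the insertion of an element. -/
def runCost (m d A n₀ : ℕ) (P : Params) : ℕ :=
  P.K * iterationCost m d A P.n P.H n₀ + insertCost d + 1

theorem spec_mainLoop {A : ℕ} (hA : ∀ i, N i ≤ A) (hτ : P.τ = 1) (hlam : 0 < P.lam) {n₀ : ℕ}
    (hn₀ : ∀ C : CoreSet S N d, C.Valid φ P.lam → C.elems.length ≤ n₀) (fuel : ℕ)
    {C : CoreSet S N d} (hC : C.Valid φ P.lam) (hfuel : n₀ + 1 ≤ fuel + C.elems.length) :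
    (mainLoop abar P fuel C).Spec M φ ((n₀ + 1 - C.elems.length) * runCost m d A n₀ P)
      ((n₀ + 1 - C.elems.length) * (P.K * (n₀ * (P.n * (P.H + 1))))) fun o => o.isSome := by
  induction fuel generalizing C with
  | zero => have := hn₀ C hC; omega
  | succ fuel ih =>
    have hlen := hn₀ C hC
    have hlen' : n₀ + 1 - C.elems.length = (n₀ - C.elems.length) + 1 := by omega
    refine Spec.mono (T := P.K * iterationCost m d A P.n P.H n₀ + (insertCost d +
        (n₀ - C.elems.length) * runCost m d A n₀ P) + 1)
      (Q := P.K * (n₀ * (P.n * (P.H + 1))) +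
        (0 + (n₀ - C.elems.length) * (P.K * (n₀ * (P.n * (P.H + 1))))))
      (Spec.step (((spec_policyIteration hA hτ C P.K .init .init).mono
        (Nat.mul_le_mul_left _ (iterationCost_mono hlen))
        (Nat.mul_le_mul_left _ (Nat.mul_le_mul_right _ hlen)) fun _ h => h).bind ?_))
      (by rw [hlen', runCost]; ring_nf; exact le_rfl) (by rw [hlen']; ring_nf; exact le_rfl)
      fun _ h => h
    intro o ho
    match o, ho with
    | .uncertain z, ho =>
      refine (spec_insert C z).bind fun C' hC' => ?_
      subst hC'
      have hlen2 : (C.push z).elems.length = C.elems.length + 1 := by simp [CoreSet.push]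
      have := ih (hC.push hlam ho) (by omega)
      rwa [hlen2, Nat.add_sub_add_right] at this
    | .done c, _ => exact spec_ret (M := M) (φ := φ) (x := some c) (A := fun o => o.isSome) rfl _ _

/-- The number of instructions of the whole algorithm. -/
def totalCost (m d A n₀ : ℕ) (P : Params) : ℕ :=
  (d * (d * 2 + 1) + 1) + (d * (m * 3 + 1) + (insertCost d +
    (n₀ * (checkCost m d A + insertCost d + 1) + n₀ * runCost m d A n₀ P)))

theorem spec_confidentMCLSPI {A : ℕ} (hA : ∀ i, N i ≤ A) (hτ : P.τ = 1) (hlam : 0 < P.lam)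
    {n₀ : ℕ} (hn₀ : ∀ C : CoreSet S N d, C.Valid φ P.lam → C.elems.length ≤ n₀) (ρ : S) (fuel : ℕ)
    (hfuel : n₀ ≤ fuel) :
    (confidentMCLSPI abar P ρ fuel).Spec M φ (totalCost m d A n₀ P)
      (n₀ * (P.K * (n₀ * (P.n * (P.H + 1))))) fun o => o.isSome := by
  have hn1 : ∀ C : CoreSet S N d, C.Valid φ P.lam → n₀ + 1 - C.elems.length ≤ n₀ := fun C hC => by
    have := hC.one_le; omega
  refine Spec.mono (T := totalCost m d A n₀ P)
    (Q := 0 + (0 + (0 + (0 + n₀ * (P.K * (n₀ * (P.n * (P.H + 1)))))))) ?_ le_rfl (by simp)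
    fun _ h => h
  refine Spec.bind (spec_scalarInv P.lam) fun B hB => ?_
  refine Spec.bind (spec_featureVec ρ abar) fun x hx => ?_
  subst hx
  refine Spec.bind (spec_start hlam hB ρ) fun C hC => ?_
  refine Spec.bind ((spec_initCore hA hτ hlam hn₀ ρ fuel hC.1 (by omega)).mono
    (Nat.mul_le_mul_right _ (hn1 C hC.1)) le_rfl fun _ h => h) ?_
  rintro _ ⟨C', rfl, hC', hρ⟩
  have := hC'.one_le
  exact (spec_mainLoop hA hτ hlam hn₀ fuel hC' (by omega)).mono
    (Nat.mul_le_mul_right _ (hn1 C' hC')) (Nat.mul_le_mul_right _ (hn1 C' hC')) fun _ h => h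

theorem likely_confidentMCLSPI (hacc : Accurate M φ P b ε θ Cm η target) {n₀ : ℕ}
    (hn₀ : ∀ C : CoreSet S N d, C.Valid φ P.lam → C.elems.length ≤ n₀) (ρ : S) (fuel : ℕ)
    (hfuel : n₀ ≤ fuel) :
    (confidentMCLSPI abar P ρ fuel).Likely M φ π₀
      (n₀ * (P.K * (n₀ * rolloutFail P.n θ M.disc)))
      fun o => ∃ c, o = some c ∧ M.optValue ρ - M.value (c.policy φ hφ π₀) ρ ≤ target := by
  have hfail := rolloutFail_nonneg P.n θ M.disc
  have hA : ∀ i, N i ≤ ∑ i, N i := fun i => Finset.single_le_sum (fun _ _ => Nat.zero_le _)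
    (Finset.mem_univ i)
  refine Likely.mono (ε := 0 + (0 + (0 + (0 + n₀ * (P.K * (n₀ * rolloutFail P.n θ M.disc))))))
    ?_ (by simp) fun _ h => h
  refine Likely.bind (Spec.likely (spec_scalarInv P.lam)) (fun B hB => ?_) le_rfl (by positivity)
  refine Likely.bind (Spec.likely (spec_featureVec ρ abar)) (fun x hx => ?_) le_rfl (by positivity)
  subst hx
  refine Likely.bind (Spec.likely (spec_start hacc.lam_pos hB ρ)) (fun C hC => ?_) le_rfl
    (by positivity)
  refine Likely.bind (Spec.likely (spec_initCore hA hacc.τ_eq hacc.lam_pos hn₀ ρ fuel hC.1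
    (by omega))) ?_ le_rfl (by positivity)
  rintro _ ⟨C', rfl, hC', hρ⟩
  have h1 := hC'.one_le
  refine (likely_mainLoop (hφ := hφ) hacc hn₀ fuel hC' hρ (by omega)).mono ?_ fun _ h => h
  have : ((n₀ + 1 - C'.elems.length : ℕ) : ℝ) ≤ n₀ := by
    have : n₀ + 1 - C'.elems.length ≤ n₀ := by omega
    exact_mod_cast this
  gcongr

end Runs

/-! ### Bounds on the parameters -/

section Parameters

variable {m d : ℕ} {b γ κ δ : ℝ}

theorem coreBound_le (d : ℕ) {lam : ℝ} (hlam : 0 < lam) :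
    coreBound d 1 lam ≤ 3.2 * d * (Real.log 2 + Real.log (1 + 1 / lam)) := by
  have he := Real.exp_one_gt_d9
  have h1 : Real.exp 1 / (Real.exp 1 - 1) ≤ 1.6 := by
    rw [div_le_iff₀ (by linarith)]; linarith
  have h2 : 0 ≤ Real.log 2 + Real.log (1 + 1 / lam) := by
    have : 0 < 1 / lam := by positivity
    exact add_nonneg (Real.log_nonneg (by norm_num)) (Real.log_nonneg (by linarith))
  unfold coreBound
  norm_num at *
  -- The factor 2 is (1 + τ)/τ at τ = 1.
  have h3 : Real.exp 1 / (Real.exp 1 - 1) * 2 ≤ 16 / 5 := by linarith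
  gcongr

theorem le_coreBound {lam : ℝ} (hd : 1 ≤ d) (hlam : 0 < lam) : 1 ≤ coreBound d 1 lam := by
  have he := Real.exp_one_gt_d9
  have h1 : 1 ≤ Real.exp 1 / (Real.exp 1 - 1) := by
    rw [le_div_iff₀ (by linarith)]; linarith
  have h2 : 0 ≤ Real.log (1 + 1 / lam) := by
    have : 0 < 1 / lam := by positivity
    exact Real.log_nonneg (by linarith)
  have h3 := Real.log_two_gt_d9
  unfold coreBound
  norm_num at *
  have hd' : (1 : ℝ) ≤ d := by exact_mod_cast hd
  calc (1 : ℝ) ≤ 1 * 2 * 1 * (1 / 2 : ℝ) := by norm_num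
    _ ≤ _ := by gcongr; linarith

/-- From γ ≤ exp(-(1 - γ)). It turns the logarithmic choices of H and K into geometric decay. -/
theorem pow_le_of_log_le (hγ : 0 ≤ γ) {x : ℝ} (hx : 0 < x) {T : ℕ}
    (hT : -Real.log x ≤ (1 - γ) * T) : γ ^ T ≤ x := by
  have h1 : γ ≤ Real.exp (-(1 - γ)) := by linarith [Real.add_one_le_exp (-(1 - γ))]
  calc γ ^ T ≤ Real.exp (-(1 - γ)) ^ T := by gcongr
    _ = Real.exp (-((1 - γ) * T)) := by rw [← Real.exp_nat_mul]; congr 1; ring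
    _ ≤ Real.exp (Real.log x) := Real.exp_le_exp.2 (by linarith)
    _ = x := Real.exp_log hx

theorem one_le_two_mul_sub_one (hm : 1 ≤ m) : (1 : ℝ) ≤ 2 * m - 1 := by
  have : (1 : ℝ) ≤ m := by exact_mod_cast hm
  linarith

theorem lamOf_pos (hm : 1 ≤ m) (hb : 0 < b) (hγ : γ < 1) (hκ : 0 < κ) : 0 < lamOf m b γ κ := by
  have h1 := one_le_two_mul_sub_one hm
  have h2 : 0 < 1 - γ := by linarith
  unfold lamOf
  positivity

/-- λ is chosen to make the regularization bias, amplified by 2m - 1, equal to one share κ(1-γ)²/32.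
The choice of θ does the same for the estimation error. -/
theorem sqrt_lamOf (hm : 1 ≤ m) (hb : 0 < b) (hγ : γ < 1) (hκ : 0 < κ) :
    (2 * m - 1) * (√(lamOf m b γ κ) * b) = κ * (1 - γ) ^ 2 / 32 := by
  have h1 := one_le_two_mul_sub_one hm
  have h2 : 0 < 1 - γ := by linarith
  have h3 : lamOf m b γ κ = (κ * (1 - γ) ^ 2 / (32 * b * (2 * m - 1))) ^ 2 := by
    unfold lamOf; field_simp; norm_num
  rw [h3, Real.sqrt_sq (by positivity)]
  field_simp

theorem one_le_cmaxOf (hm : 1 ≤ m) (hd : 1 ≤ d) (hb : 0 < b) (hγ : γ < 1) (hκ : 0 < κ) :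
    1 ≤ cmaxOf m d b γ κ :=
  le_coreBound hd (lamOf_pos hm hb hγ hκ)

theorem thetaOf_pos (hm : 1 ≤ m) (hd : 1 ≤ d) (hb : 0 < b) (hγ : γ < 1) (hκ : 0 < κ) :
    0 < thetaOf m d b γ κ := by
  have h1 := one_le_two_mul_sub_one hm
  have h2 : 0 < 1 - γ := by linarith
  have h3 := one_le_cmaxOf hm hd hb hγ hκ
  unfold thetaOf
  positivity

theorem sqrt_cmaxOf_mul_thetaOf (hm : 1 ≤ m) (hd : 1 ≤ d) (hb : 0 < b) (hγ : γ < 1) (hκ : 0 < κ) :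
    (2 * m - 1) * (√(cmaxOf m d b γ κ) * thetaOf m d b γ κ) = κ * (1 - γ) ^ 2 / 32 := by
  have h1 := one_le_two_mul_sub_one hm
  have h3 := one_le_cmaxOf hm hd hb hγ hκ
  have h4 : 0 < √(cmaxOf m d b γ κ) := by positivity
  unfold thetaOf
  field_simp

theorem bias_le_thetaOf (hm : 1 ≤ m) (hd : 1 ≤ d) (hb : 0 < b) (hγ0 : 0 ≤ γ) (hγ : γ < 1)
    (hκ : 0 < κ) : γ ^ ((settings m d b γ κ δ).H + 1) * (1 / (1 - γ)) ≤ thetaOf m d b γ κ := by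
  have h1 := one_le_two_mul_sub_one hm
  have h2 : 0 < 1 - γ := by linarith
  have h3 := one_le_cmaxOf hm hd hb hγ hκ
  have h4 : 0 < √(cmaxOf m d b γ κ) := by positivity
  have h5 := thetaOf_pos hm hd hb hγ hκ
  rw [mul_one_div, div_le_iff₀ h2]
  refine pow_le_of_log_le hγ0 (by positivity) ?_
  have h6 : thetaOf m d b γ κ * (1 - γ) =
      κ * (1 - γ) ^ 3 / (32 * √(cmaxOf m d b γ κ) * (2 * m - 1)) := by
    unfold thetaOf; field_simp
  rw [h6, Real.log_div (by positivity) (by positivity), neg_sub]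
  have h7 := Nat.le_ceil ((Real.log (32 * √(cmaxOf m d b γ κ) * (2 * (m : ℝ) - 1)) -
    Real.log (κ * (1 - γ) ^ 3)) / (1 - γ) - 1)
  have h8 : (settings m d b γ κ δ).H = ⌈(Real.log (32 * √(cmaxOf m d b γ κ) * (2 * (m : ℝ) - 1)) -
    Real.log (κ * (1 - γ) ^ 3)) / (1 - γ) - 1⌉₊ := rfl
  rw [← h8, sub_le_iff_le_add, div_le_iff₀ h2] at h7
  push_cast
  linarith

theorem pow_itersOf_le (hγ0 : 0 ≤ γ) (hγ : γ < 1) (hκ : 0 < κ) :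
    γ ^ (itersOf γ κ - 1) / (1 - γ) ≤ κ / 8 := by
  have h2 : 0 < 1 - γ := by linarith
  have h1 : γ ^ (itersOf γ κ - 1) ≤ κ * (1 - γ) ^ 2 / 8 := by
    refine pow_le_of_log_le hγ0 (by positivity) ?_
    have h3 : ((itersOf γ κ - 1 : ℕ) : ℝ) = itersOf γ κ - 1 := by
      rw [Nat.cast_sub (show 1 ≤ itersOf γ κ from le_max_left _ _), Nat.cast_one]
    have h4 : (Real.log (1 / (κ * (1 - γ) ^ 2)) + Real.log 8) / (1 - γ) + 1 ≤ itersOf γ κ :=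
      (Nat.le_ceil _).trans (by unfold itersOf; exact_mod_cast le_max_right _ _)
    rw [← le_sub_iff_add_le, div_le_iff₀ h2] at h4
    rw [h3, Real.log_div (by positivity) (by norm_num)]
    rw [one_div, Real.log_inv] at h4
    linarith
  rw [div_le_iff₀ h2]
  refine h1.trans ?_
  have : (1 - γ) ^ 2 ≤ 1 - γ := by nlinarith
  nlinarith

/-- Guarantees n ≥ 1, without which the average and Hoeffding's inequality are void. -/
theorem log_num_pos (hm : 1 ≤ m) (hd : 1 ≤ d) (hb : 0 < b) (hγ : γ < 1) (hκ : 0 < κ)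
    (hδ : 0 < δ) (hδ1 : δ < 1) :
    0 < Real.log (4 * itersOf γ κ * cmaxOf m d b γ κ ^ 2) - Real.log δ := by
  have h3 := one_le_cmaxOf hm hd hb hγ hκ
  have h4 : (1 : ℝ) ≤ itersOf γ κ := by exact_mod_cast le_max_left _ _
  have h5 : (1 : ℝ) ≤ itersOf γ κ * cmaxOf m d b γ κ ^ 2 := by nlinarith
  have h6 : 0 < Real.log (4 * itersOf γ κ * cmaxOf m d b γ κ ^ 2) := Real.log_pos (by linarith)
  linarith [Real.log_neg hδ hδ1]

/-- Two policies and two tails give the 4 in n; runs, elements and iterations give K C_max². -/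
theorem fail_le (hm : 1 ≤ m) (hd : 1 ≤ d) (hb : 0 < b) (hγ : γ < 1) (hκ : 0 < κ) (hδ : 0 < δ) :
    cmaxOf m d b γ κ * ((settings m d b γ κ δ).K * (cmaxOf m d b γ κ *
      rolloutFail (settings m d b γ κ δ).n (thetaOf m d b γ κ) γ)) ≤ δ := by
  have h3 := one_le_cmaxOf hm hd hb hγ hκ
  have h4 : (1 : ℝ) ≤ itersOf γ κ := by exact_mod_cast le_max_left _ _
  have h5 := thetaOf_pos hm hd hb hγ hκ
  have h2 : 0 < 1 - γ := by linarith
  set C := cmaxOf m d b γ κ with hC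
  set K := itersOf γ κ with hK
  have h6 : (Real.log (4 * K * C ^ 2) - Real.log δ) /
      (2 * thetaOf m d b γ κ ^ 2 * (1 - γ) ^ 2) ≤ (settings m d b γ κ δ).n := Nat.le_ceil _
  rw [div_le_iff₀ (by positivity)] at h6
  have h7 : Real.exp (-(2 * (settings m d b γ κ δ).n * thetaOf m d b γ κ ^ 2 * (1 - γ) ^ 2)) ≤
      δ / (4 * K * C ^ 2) := by
    rw [← Real.exp_log (show 0 < δ / (4 * K * C ^ 2) by positivity), Real.exp_le_exp,
      Real.log_div hδ.ne' (by positivity)]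
    linarith
  have h8 : ((settings m d b γ κ δ).K : ℝ) = K := rfl
  rw [h8]
  unfold rolloutFail
  calc _ ≤ C * (K * (C * (2 * (2 * (δ / (4 * K * C ^ 2)))))) := by gcongr
    _ = δ := by field_simp; norm_num

theorem log_le_sub {x y : ℝ} (hx : 0 < x) (h : x ≤ y) {L : ℝ} (hy : Real.log y ≤ L) :
    Real.log x ≤ L := (Real.log_le_log hx h).trans hy

/-- Shared by both parts of the theorem: all that matters is a Λ dominating the logarithms and a Z
dominating θ⁻². -/
theorem params_le (hm : 1 ≤ m) (hd : 1 ≤ d) (hb : 0 < b) (hγ0 : 0 ≤ γ) (hγ : γ < 1) (hκ : 0 < κ)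
    (hδ : 0 < δ) (hδ1 : δ < 1) {Λ Z : ℝ}
    (hΛ : 1 + Real.log d + Real.log (1 / (1 - γ)) + Real.log (1 / δ) ≤ Λ)
    (hC : cmaxOf m d b γ κ ≤ 32 * d * Λ)
    (hK : Real.log (1 / (κ * (1 - γ) ^ 2)) + Real.log 8 ≤ 3 * Λ)
    (hH : Real.log (32 * √(cmaxOf m d b γ κ) * (2 * (m : ℝ) - 1)) - Real.log (κ * (1 - γ) ^ 3) ≤
      7 * Λ)
    (hθ : 1 / thetaOf m d b γ κ ^ 2 ≤ Z) :
    ((settings m d b γ κ δ).K : ℝ) ≤ 5 * Λ / (1 - γ) ∧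
    ((settings m d b γ κ δ).H : ℝ) + 1 ≤ 8 * Λ / (1 - γ) ∧
    ((settings m d b γ κ δ).n : ℝ) ≤ 6 * Λ * Z / (1 - γ) ^ 2 + 1 := by
  have h2 : 0 < 1 - γ := by linarith
  have hd' : (1 : ℝ) ≤ d := by exact_mod_cast hd
  have hu : 1 ≤ 1 / (1 - γ) := by rw [le_div_iff₀ h2]; linarith
  have hlogd : 0 ≤ Real.log d := Real.log_nonneg hd'
  have hlogu : 0 ≤ Real.log (1 / (1 - γ)) := Real.log_nonneg hu
  have hlogδ : 0 ≤ Real.log (1 / δ) := Real.log_nonneg (by rw [le_div_iff₀ hδ]; linarith)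
  have hΛ1 : 1 ≤ Λ := by linarith
  have h3 := one_le_cmaxOf hm hd hb hγ hκ
  have h5 := thetaOf_pos hm hd hb hγ hκ
  have hΛu : 1 ≤ Λ * (1 / (1 - γ)) := by nlinarith
  -- 3Λ/(1-γ), plus the explicit 1, plus 1 for rounding, where Λ/(1-γ) ≥ 1.
  have hK1 : ((settings m d b γ κ δ).K : ℝ) ≤ 5 * Λ / (1 - γ) := by
    have h6 : ((settings m d b γ κ δ).K : ℝ) = max 1 (⌈(Real.log (1 / (κ * (1 - γ) ^ 2)) +
        Real.log 8) / (1 - γ) + 1⌉₊ : ℝ) := by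
      simp [settings, itersOf]
    rw [h6]
    have h7 : 5 * Λ / (1 - γ) = 5 * (Λ * (1 / (1 - γ))) := by ring
    refine max_le (by linarith) ?_
    have h8 : (Real.log (1 / (κ * (1 - γ) ^ 2)) + Real.log 8) / (1 - γ) + 1 ≤
        3 * (Λ * (1 / (1 - γ))) + 1 := by
      rw [← mul_assoc, mul_one_div]; gcongr
    refine (Nat.cast_le.2 (Nat.ceil_mono h8)).trans ?_
    have := (Nat.ceil_lt_add_one (show 0 ≤ 3 * (Λ * (1 / (1 - γ))) + 1 by linarith)).le
    linarith
  have hlogC : Real.log (cmaxOf m d b γ κ) ≤ 3.5 + Real.log d + (Λ - 1) := by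
    refine log_le_sub (by linarith) hC ?_
    rw [Real.log_mul (by positivity) (by positivity), Real.log_mul (by norm_num) (by positivity)]
    have h6 : Real.log 32 = 5 * Real.log 2 := by
      rw [show (32 : ℝ) = 2 ^ 5 by norm_num, Real.log_pow]; norm_num
    linarith [Real.log_le_sub_one_of_pos (show 0 < Λ by linarith), Real.log_two_lt_d9]
  refine ⟨hK1, ?_, ?_⟩
  · have h7 : 8 * Λ / (1 - γ) = 8 * (Λ * (1 / (1 - γ))) := by ring
    have h8 : (Real.log (32 * √(cmaxOf m d b γ κ) * (2 * (m : ℝ) - 1)) -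
        Real.log (κ * (1 - γ) ^ 3)) / (1 - γ) - 1 ≤ 7 * (Λ * (1 / (1 - γ))) - 1 := by
      rw [← mul_assoc, mul_one_div]; gcongr
    have h9 : ((settings m d b γ κ δ).H : ℝ) ≤ (⌈7 * (Λ * (1 / (1 - γ))) - 1⌉₊ : ℝ) :=
      Nat.cast_le.2 (Nat.ceil_mono h8)
    have := (Nat.ceil_lt_add_one (show 0 ≤ 7 * (Λ * (1 / (1 - γ))) - 1 by linarith)).le
    linarith
  · have h4 : (1 : ℝ) ≤ itersOf γ κ := by exact_mod_cast le_max_left _ _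
    have hlogK : Real.log (itersOf γ κ) ≤ 1.7 + (Λ - 1) + Real.log (1 / (1 - γ)) := by
      refine log_le_sub (by linarith) (show (itersOf γ κ : ℝ) ≤ 5 * Λ / (1 - γ) from hK1) ?_
      rw [← mul_one_div, Real.log_mul (by positivity) (by positivity),
        Real.log_mul (by norm_num) (by positivity)]
      have h6 : Real.log 5 ≤ 1.7 := by
        have h7 : Real.log 5 = Real.log (5 / 4) + 2 * Real.log 2 := by
          rw [← Real.log_rpow (by norm_num), ← Real.log_mul (by norm_num) (by norm_num)]
          norm_num
        have h8 := Real.log_le_sub_one_of_pos (show (0 : ℝ) < 5 / 4 by norm_num)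
        linarith [Real.log_two_lt_d9]
      linarith [Real.log_le_sub_one_of_pos (show 0 < Λ by linarith)]
    have hnum : Real.log (4 * itersOf γ κ * cmaxOf m d b γ κ ^ 2) - Real.log δ ≤ 12 * Λ := by
      rw [Real.log_mul (by positivity) (by positivity), Real.log_mul (by norm_num) (by positivity),
        Real.log_pow]
      have h6 : Real.log 4 = 2 * Real.log 2 := by
        rw [show (4 : ℝ) = 2 ^ 2 by norm_num, Real.log_pow]; norm_num
      have h7 : Real.log (1 / δ) = -Real.log δ := by rw [one_div, Real.log_inv]
      have h8 := Real.log_two_lt_d9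
      push_cast
      linarith
    have hpos := log_num_pos hm hd hb hγ hκ hδ hδ1
    have h6 : ((settings m d b γ κ δ).n : ℝ) ≤ (Real.log (4 * itersOf γ κ * cmaxOf m d b γ κ ^ 2) -
        Real.log δ) / (2 * thetaOf m d b γ κ ^ 2 * (1 - γ) ^ 2) + 1 :=
      (Nat.ceil_lt_add_one (by positivity)).le
    refine h6.trans (add_le_add ?_ le_rfl)
    have h7 : (Real.log (4 * itersOf γ κ * cmaxOf m d b γ κ ^ 2) - Real.log δ) /
        (2 * thetaOf m d b γ κ ^ 2 * (1 - γ) ^ 2) =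
        (Real.log (4 * itersOf γ κ * cmaxOf m d b γ κ ^ 2) - Real.log δ) / 2 *
        (1 / thetaOf m d b γ κ ^ 2) / (1 - γ) ^ 2 := by field_simp
    rw [h7]
    have h8 : (Real.log (4 * itersOf γ κ * cmaxOf m d b γ κ ^ 2) - Real.log δ) / 2 ≤ 6 * Λ := by
      linarith
    gcongr

end Parameters

/-! ### Logarithmic factors and parameter bounds for the two cases -/

section Settings

variable {m d : ℕ} {b γ κ δ ε : ℝ}

theorem inv_lamOf : 1 / lamOf m b γ κ =
    1024 * b ^ 2 * (2 * (m : ℝ) - 1) ^ 2 / (κ ^ 2 * (1 - γ) ^ 4) := by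
  unfold lamOf; rw [one_div_div]

theorem inv_sq_thetaOf (hm : 1 ≤ m) (hd : 1 ≤ d) (hb : 0 < b) (hγ : γ < 1) (hκ : 0 < κ) :
    1 / thetaOf m d b γ κ ^ 2 =
      1024 * (2 * (m : ℝ) - 1) ^ 2 * cmaxOf m d b γ κ / (κ ^ 2 * (1 - γ) ^ 4) := by
  have h3 := one_le_cmaxOf hm hd hb hγ hκ
  unfold thetaOf
  rw [div_pow, one_div_div, mul_pow, mul_pow, Real.sq_sqrt (by linarith)]
  congr 1 <;> ring

/-- The logarithmic factor of the realizable case. -/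
noncomputable def logFactor (m d : ℕ) (b κ γ δ : ℝ) : ℝ :=
  1 + Real.log m + Real.log d + Real.log (1 + b) + Real.log (1 + 1 / κ) +
    Real.log (1 / (1 - γ)) + Real.log (1 / δ)

/-- The logarithmic factor of the misspecified case. -/
noncomputable def missLogFactor (d : ℕ) (b ε γ δ : ℝ) : ℝ :=
  1 + Real.log d + Real.log (1 + b) + Real.log (1 + 1 / ε) +
    Real.log (1 / (1 - γ)) + Real.log (1 / δ)

theorem log_one_div_one_sub_nonneg (hγ0 : 0 ≤ γ) (hγ : γ < 1) : 0 ≤ Real.log (1 / (1 - γ)) :=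
  Real.log_nonneg (by rw [le_div_iff₀ (by linarith)]; linarith)

theorem log_one_div_nonneg (hδ : 0 < δ) (hδ1 : δ < 1) : 0 ≤ Real.log (1 / δ) :=
  Real.log_nonneg (by rw [le_div_iff₀ hδ]; linarith)

theorem log_one_add_nonneg {x : ℝ} (hx : 0 < x) : 0 ≤ Real.log (1 + x) :=
  Real.log_nonneg (by linarith)

theorem log_natCast_nonneg_of_le (hd : 1 ≤ d) : 0 ≤ Real.log d :=
  Real.log_nonneg (by exact_mod_cast hd)

/-- 1/λ is at most 4096 (m (1+b)(1+1/κ)/(1-γ)²)², so its logarithm is linear in the logarithmic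
factor; 32 = 3.2 · 10. -/
theorem cmaxOf_le_logFactor (hm : 1 ≤ m) (hd : 1 ≤ d) (hb : 0 < b) (hγ0 : 0 ≤ γ) (hγ : γ < 1)
    (hκ : 0 < κ) (hδ : 0 < δ) (hδ1 : δ < 1) :
    cmaxOf m d b γ κ ≤ 32 * d * logFactor m d b κ γ δ := by
  have h2 : 0 < 1 - γ := by linarith
  have hm' : (1 : ℝ) ≤ m := by exact_mod_cast hm
  have hκ' : 0 < 1 / κ := by positivity
  have hu1 : (1 - γ) ^ 4 ≤ 1 := pow_le_one₀ h2.le (by linarith)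
  have hlog : Real.log (1 + 1 / lamOf m b γ κ) ≤
      13 * Real.log 2 + 2 * (Real.log m + Real.log (1 + b) + Real.log (1 + 1 / κ) +
        2 * Real.log (1 / (1 - γ))) := by
    have h3 : (13 : ℝ) * Real.log 2 + 2 * (Real.log m + Real.log (1 + b) + Real.log (1 + 1 / κ) +
        2 * Real.log (1 / (1 - γ))) =
        Real.log (2 ^ 13 * (m * (1 + b) * (1 + 1 / κ) * (1 / (1 - γ)) ^ 2) ^ 2) := by
      rw [Real.log_mul (by positivity) (by positivity), Real.log_pow, Real.log_pow,
        Real.log_mul (by positivity) (by positivity), Real.log_mul (by positivity) (by positivity),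
        Real.log_mul (by positivity) (by positivity), Real.log_pow]
      push_cast; ring
    rw [h3, inv_lamOf]
    have hpos : (0 : ℝ) ≤ 2 * m - 1 := by linarith
    refine Real.log_le_log (by positivity) ?_
    have h4 : 1024 * b ^ 2 * (2 * (m : ℝ) - 1) ^ 2 / (κ ^ 2 * (1 - γ) ^ 4) ≤
        4096 * (m * (1 + b) * (1 + 1 / κ) * (1 / (1 - γ)) ^ 2) ^ 2 := by
      calc _ = 1024 * ((2 * (m : ℝ) - 1) * b * (1 / κ) * (1 / (1 - γ)) ^ 2) ^ 2 := by
            field_simp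
        _ ≤ 1024 * ((2 * (m : ℝ)) * (1 + b) * (1 + 1 / κ) * (1 / (1 - γ)) ^ 2) ^ 2 := by
            gcongr <;> linarith
        _ = _ := by ring
    have h5 : 1 ≤ m * (1 + b) * (1 + 1 / κ) * (1 / (1 - γ)) ^ 2 := by
      have : 1 ≤ 1 / (1 - γ) := by rw [le_div_iff₀ h2]; linarith
      calc (1 : ℝ) = 1 * 1 * 1 * 1 ^ 2 := by norm_num
        _ ≤ _ := by gcongr <;> linarith
    have h6 := one_le_pow₀ h5 (n := 2)
    linarith
  refine (coreBound_le d (lamOf_pos hm hb hγ hκ)).trans ?_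
  have h7 := log_one_div_one_sub_nonneg hγ0 hγ
  have h8 := log_one_div_nonneg hδ hδ1
  have h9 := log_one_add_nonneg hb
  have h10 := log_one_add_nonneg hκ'
  have h11 := log_natCast_nonneg_of_le hm
  have h12 := log_natCast_nonneg_of_le hd
  have h13 := Real.log_two_lt_d9
  have h14 : Real.log 2 + Real.log (1 + 1 / lamOf m b γ κ) ≤ 10 * logFactor m d b κ γ δ := by
    unfold logFactor; linarith
  calc _ ≤ 3.2 * d * (10 * logFactor m d b κ γ δ) := by gcongr
    _ = _ := by ring

theorem one_le_missFactor (hb : 0 < b) (hε : 0 < ε) (hd : 1 ≤ d) : 1 ≤ missFactor d b ε := by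
  have : (1 : ℝ) ≤ d := by exact_mod_cast hd
  refine Real.one_le_sqrt.2 (le_add_of_nonneg_right (log_one_add_nonneg (by positivity)))

theorem sq_missFactor (hb : 0 < b) (hε : 0 < ε) (hd : 1 ≤ d) :
    missFactor d b ε ^ 2 = 1 + Real.log (1 + b ^ 2 / (ε ^ 2 * d)) := by
  have : (1 : ℝ) ≤ d := by exact_mod_cast hd
  have := log_one_add_nonneg (show 0 < b ^ 2 / (ε ^ 2 * d) by positivity)
  exact Real.sq_sqrt (by linarith)

theorem kappaOf_pos (hm : 1 ≤ m) (hd : 1 ≤ d) (hb : 0 < b) (hγ : γ < 1) (hε : 0 < ε) :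
    0 < kappaOf m d b γ ε := by
  have h1 := one_le_missFactor hb hε hd
  have h2 : 0 < 1 - γ := by linarith
  have hm' : (1 : ℝ) ≤ m := by exact_mod_cast hm
  have hd' : (1 : ℝ) ≤ d := by exact_mod_cast hd
  unfold kappaOf
  positivity

theorem kappaOf_mul (hγ : γ < 1) :
    kappaOf m d b γ ε * (1 - γ) ^ 2 = 32 * ε * √d * m * missFactor d b ε := by
  have h2 : 1 - γ ≠ 0 := by linarith
  unfold kappaOf
  field_simp

theorem sq_kappaOf_mul (hγ : γ < 1) :
    kappaOf m d b γ ε ^ 2 * (1 - γ) ^ 4 =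
      1024 * ε ^ 2 * d * (m : ℝ) ^ 2 * missFactor d b ε ^ 2 := by
  have h : kappaOf m d b γ ε ^ 2 * (1 - γ) ^ 4 = (kappaOf m d b γ ε * (1 - γ) ^ 2) ^ 2 := by ring
  rw [h, kappaOf_mul hγ, mul_pow, mul_pow, mul_pow, mul_pow, Real.sq_sqrt (Nat.cast_nonneg d)]
  ring

/-- For this κ the powers of m and 1-γ cancel in 1/λ up to (2m - 1)² ≤ 4m², which leaves 4b²/(ε²d).
So C_max is of order d times exactly the logarithm that enters κ. -/
theorem cmaxOf_kappaOf_le (hm : 1 ≤ m) (hd : 1 ≤ d) (hb : 0 < b) (hγ : γ < 1) (hε : 0 < ε) :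
    cmaxOf m d b γ (kappaOf m d b γ ε) ≤ 7 * d * missFactor d b ε ^ 2 := by
  have hF := one_le_missFactor hb hε hd
  have hm' : (1 : ℝ) ≤ m := by exact_mod_cast hm
  have hd' : (1 : ℝ) ≤ d := by exact_mod_cast hd
  have hpos : (0 : ℝ) ≤ 2 * m - 1 := by linarith
  have hinv : 1 / lamOf m b γ (kappaOf m d b γ ε) ≤ 4 * (b ^ 2 / (ε ^ 2 * d)) := by
    rw [inv_lamOf, sq_kappaOf_mul hγ]
    calc _ ≤ 1024 * b ^ 2 * (2 * (m : ℝ)) ^ 2 / (1024 * ε ^ 2 * d * (m : ℝ) ^ 2 * 1 ^ 2) := by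
          gcongr; linarith
      _ = _ := by field_simp; norm_num
  have hlam := lamOf_pos hm hb hγ (kappaOf_pos hm hd hb hγ hε)
  have hy : 0 < b ^ 2 / (ε ^ 2 * d) := by positivity
  have hlog : Real.log (1 + 1 / lamOf m b γ (kappaOf m d b γ ε)) ≤
      2 * Real.log 2 + Real.log (1 + b ^ 2 / (ε ^ 2 * d)) := by
    have h3 : 2 * Real.log 2 + Real.log (1 + b ^ 2 / (ε ^ 2 * d)) =
        Real.log (2 ^ 2 * (1 + b ^ 2 / (ε ^ 2 * d))) := by
      rw [Real.log_mul (by positivity) (by positivity), Real.log_pow]; norm_num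
    rw [h3]
    exact Real.log_le_log (by positivity) (by linarith)
  refine (coreBound_le d hlam).trans ?_
  have h4 := Real.log_two_lt_d9
  have h5 := log_one_add_nonneg hy
  have h6 : Real.log 2 + Real.log (1 + 1 / lamOf m b γ (kappaOf m d b γ ε)) ≤
      2.08 * missFactor d b ε ^ 2 := by
    rw [sq_missFactor hb hε hd]; linarith
  calc _ ≤ 3.2 * d * (2.08 * missFactor d b ε ^ 2) := by gcongr
    _ = 6.656 * (d * missFactor d b ε ^ 2) := by ring
    _ ≤ 7 * (d * missFactor d b ε ^ 2) := by gcongr; norm_num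
    _ = _ := by ring

theorem sqrt_cmaxOf_kappaOf_le (hm : 1 ≤ m) (hd : 1 ≤ d) (hb : 0 < b) (hγ : γ < 1) (hε : 0 < ε) :
    (2 * m - 1) * √(cmaxOf m d b γ (kappaOf m d b γ ε)) ≤ 6 * √d * m * missFactor d b ε := by
  have hF := one_le_missFactor hb hε hd
  have hm' : (1 : ℝ) ≤ m := by exact_mod_cast hm
  have h1 : √(cmaxOf m d b γ (kappaOf m d b γ ε)) ≤ 3 * √d * missFactor d b ε := by
    refine Real.sqrt_le_iff.2 ⟨by positivity, (cmaxOf_kappaOf_le hm hd hb hγ hε).trans ?_⟩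
    rw [mul_pow, mul_pow, Real.sq_sqrt (Nat.cast_nonneg d)]
    gcongr
    norm_num
  calc _ ≤ (2 * m) * (3 * √d * missFactor d b ε) := by gcongr; linarith
    _ = _ := by ring

theorem sq_missFactor_le (hd : 1 ≤ d) (hb : 0 < b) (hε : 0 < ε) (hγ0 : 0 ≤ γ) (hγ : γ < 1)
    (hδ : 0 < δ) (hδ1 : δ < 1) :
    missFactor d b ε ^ 2 ≤ 2 * missLogFactor d b ε γ δ := by
  have hd' : (1 : ℝ) ≤ d := by exact_mod_cast hd
  have hε' : 0 < 1 / ε := by positivity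
  have h7 := log_one_div_one_sub_nonneg hγ0 hγ
  have h8 := log_one_div_nonneg hδ hδ1
  have h9 := log_one_add_nonneg hb
  have h10 := log_one_add_nonneg hε'
  have h12 := log_natCast_nonneg_of_le hd
  rw [sq_missFactor hb hε hd]
  have h1 : Real.log (1 + b ^ 2 / (ε ^ 2 * d)) ≤
      2 * (Real.log (1 + b) + Real.log (1 + 1 / ε)) := by
    have h3 : 2 * (Real.log (1 + b) + Real.log (1 + 1 / ε)) =
        Real.log (((1 + b) * (1 + 1 / ε)) ^ 2) := by
      rw [Real.log_pow, Real.log_mul (by positivity) (by positivity)]; norm_num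
    rw [h3]
    refine Real.log_le_log (by positivity) ?_
    calc 1 + b ^ 2 / (ε ^ 2 * d) ≤ 1 + b ^ 2 / (ε ^ 2 * 1) := by gcongr
      _ = 1 + (b * (1 / ε)) ^ 2 := by field_simp
      _ ≤ (1 + b * (1 / ε)) ^ 2 := by nlinarith [mul_pos hb hε']
      _ ≤ _ := by gcongr; nlinarith [mul_pos hb hε']
  unfold missLogFactor
  linarith

theorem realizable_params_le (hm : 1 ≤ m) (hd : 1 ≤ d) (hb : 0 < b) (hγ0 : 0 ≤ γ) (hγ : γ < 1)
    (hκ : 0 < κ) (hδ : 0 < δ) (hδ1 : δ < 1) :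
    ((settings m d b γ κ δ).K : ℝ) ≤ 5 * logFactor m d b κ γ δ / (1 - γ) ∧
    ((settings m d b γ κ δ).H : ℝ) + 1 ≤ 8 * logFactor m d b κ γ δ / (1 - γ) ∧
    ((settings m d b γ κ δ).n : ℝ) ≤ 6 * logFactor m d b κ γ δ *
      (131072 * m ^ 2 * d * logFactor m d b κ γ δ / (κ ^ 2 * (1 - γ) ^ 4)) / (1 - γ) ^ 2 + 1 := by
  have h2 : 0 < 1 - γ := by linarith
  have hm' : (1 : ℝ) ≤ m := by exact_mod_cast hm
  have hd' : (1 : ℝ) ≤ d := by exact_mod_cast hd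
  have hκ' : 0 < 1 / κ := by positivity
  have hpos : (0 : ℝ) < 2 * m - 1 := by linarith
  have h7 := log_one_div_one_sub_nonneg hγ0 hγ
  have h8 := log_one_div_nonneg hδ hδ1
  have h9 := log_one_add_nonneg hb
  have h10 := log_one_add_nonneg hκ'
  have h11 := log_natCast_nonneg_of_le hm
  have h12 := log_natCast_nonneg_of_le hd
  have h13 := Real.log_two_lt_d9
  have hC := cmaxOf_le_logFactor hm hd hb hγ0 hγ hκ hδ hδ1
  have hC1 := one_le_cmaxOf hm hd hb hγ hκ
  set Λ := logFactor m d b κ γ δ with hΛ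
  unfold logFactor at hΛ
  have hlogκ : -Real.log κ ≤ Real.log (1 + 1 / κ) := by
    rw [← Real.log_inv, ← one_div]; exact Real.log_le_log hκ' (by linarith)
  have hlogu : Real.log (1 / (1 - γ)) = -Real.log (1 - γ) := by rw [one_div, Real.log_inv]
  refine params_le hm hd hb hγ0 hγ hκ hδ hδ1 (by linarith) hC ?_ ?_ ?_
  · have h14 : Real.log 8 = 3 * Real.log 2 := by
      rw [show (8 : ℝ) = 2 ^ 3 by norm_num, Real.log_pow]; norm_num
    rw [one_div, Real.log_inv, Real.log_mul (by positivity) (by positivity), Real.log_pow, h14]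
    push_cast
    linarith
  · have h14 : Real.log (cmaxOf m d b γ κ) ≤ 3.5 + Real.log d + (Λ - 1) := by
      refine log_le_sub (by linarith) hC ?_
      rw [Real.log_mul (by positivity) (by linarith), Real.log_mul (by norm_num) (by positivity)]
      have h6 : Real.log 32 = 5 * Real.log 2 := by
        rw [show (32 : ℝ) = 2 ^ 5 by norm_num, Real.log_pow]; norm_num
      linarith [Real.log_le_sub_one_of_pos (show 0 < Λ by linarith)]
    have h15 : Real.log (2 * (m : ℝ) - 1) ≤ Real.log 2 + Real.log m := by
      rw [← Real.log_mul (by norm_num) (by positivity)]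
      exact Real.log_le_log hpos (by linarith)
    have h6 : Real.log 32 = 5 * Real.log 2 := by
      rw [show (32 : ℝ) = 2 ^ 5 by norm_num, Real.log_pow]; norm_num
    rw [Real.log_mul (by positivity) (by positivity), Real.log_mul (by norm_num) (by positivity),
      Real.log_sqrt (by linarith), Real.log_mul (by positivity) (by positivity), Real.log_pow, h6]
    push_cast
    linarith
  · rw [inv_sq_thetaOf hm hd hb hγ hκ]
    refine div_le_div_of_nonneg_right ?_ (by positivity)
    calc 1024 * (2 * (m : ℝ) - 1) ^ 2 * cmaxOf m d b γ κ ≤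
        1024 * (2 * (m : ℝ)) ^ 2 * (32 * d * Λ) := by gcongr; linarith
      _ = _ := by ring

theorem misspecified_params_le (hm : 1 ≤ m) (hd : 1 ≤ d) (hb : 0 < b) (hγ0 : 0 ≤ γ) (hγ : γ < 1)
    (hε : 0 < ε) (hδ : 0 < δ) (hδ1 : δ < 1) :
    ((settings m d b γ (kappaOf m d b γ ε) δ).K : ℝ) ≤ 5 * missLogFactor d b ε γ δ / (1 - γ) ∧
    ((settings m d b γ (kappaOf m d b γ ε) δ).H : ℝ) + 1 ≤
      8 * missLogFactor d b ε γ δ / (1 - γ) ∧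
    ((settings m d b γ (kappaOf m d b γ ε) δ).n : ℝ) ≤
      6 * missLogFactor d b ε γ δ * (28 / ε ^ 2) / (1 - γ) ^ 2 + 1 := by
  have h2 : 0 < 1 - γ := by linarith
  have hm' : (1 : ℝ) ≤ m := by exact_mod_cast hm
  have hd' : (1 : ℝ) ≤ d := by exact_mod_cast hd
  have hε' : 0 < 1 / ε := by positivity
  have hpos : (0 : ℝ) < 2 * m - 1 := by linarith
  have hF := one_le_missFactor hb hε hd
  have hsd : 1 ≤ √(d : ℝ) := Real.one_le_sqrt.2 hd'
  have hκ := kappaOf_pos hm hd hb hγ hε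
  have h7 := log_one_div_one_sub_nonneg hγ0 hγ
  have h8 := log_one_div_nonneg hδ hδ1
  have h9 := log_one_add_nonneg hb
  have h10 := log_one_add_nonneg hε'
  have h12 := log_natCast_nonneg_of_le hd
  have h13 := Real.log_two_lt_d9
  have hC := cmaxOf_kappaOf_le hm hd hb hγ hε
  have hC2 := sqrt_cmaxOf_kappaOf_le hm hd hb hγ hε
  have hC1 := one_le_cmaxOf hm hd hb hγ hκ
  have hFL := sq_missFactor_le hd hb hε hγ0 hγ hδ hδ1
  have hκu := kappaOf_mul (m := m) (d := d) (b := b) (ε := ε) hγ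
  have hκu2 := sq_kappaOf_mul (m := m) (d := d) (b := b) (ε := ε) hγ
  set Λ := missLogFactor d b ε γ δ with hΛ
  unfold missLogFactor at hΛ
  set κ := kappaOf m d b γ ε
  have hlogε : -Real.log ε ≤ Real.log (1 + 1 / ε) := by
    rw [← Real.log_inv, ← one_div]; exact Real.log_le_log hε' (by linarith)
  have hlogu : Real.log (1 / (1 - γ)) = -Real.log (1 - γ) := by rw [one_div, Real.log_inv]
  refine params_le hm hd hb hγ0 hγ hκ hδ hδ1 (by linarith) ?_ ?_ ?_ ?_
  · calc _ ≤ 7 * d * (2 * Λ) := hC.trans (by gcongr)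
      _ = 14 * (d * Λ) := by ring
      _ ≤ 32 * (d * Λ) := by
        have : 0 ≤ Λ := by linarith
        gcongr; norm_num
      _ = _ := by ring
  · have h14 : Real.log 8 = 3 * Real.log 2 := by
      rw [show (8 : ℝ) = 2 ^ 3 by norm_num, Real.log_pow]; norm_num
    have h15 : ε ≤ κ * (1 - γ) ^ 2 := by
      rw [hκu]
      calc ε = 1 * ε * 1 * 1 * 1 := by ring
        _ ≤ _ := by gcongr; norm_num
    have h16 := Real.log_le_log hε h15
    rw [one_div, Real.log_inv, h14]
    linarith
  · rw [← Real.log_div (by positivity) (by positivity)]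
    have h14 : 32 * √(cmaxOf m d b γ κ) * (2 * (m : ℝ) - 1) / (κ * (1 - γ) ^ 3) ≤
        6 / (ε * (1 - γ)) := by
      rw [show κ * (1 - γ) ^ 3 = κ * (1 - γ) ^ 2 * (1 - γ) by ring, hκu,
        div_le_div_iff₀ (by positivity) (by positivity)]
      calc _ = 32 * ((2 * (m : ℝ) - 1) * √(cmaxOf m d b γ κ)) * (ε * (1 - γ)) := by ring
        _ ≤ 32 * (6 * √d * m * missFactor d b ε) * (ε * (1 - γ)) := by gcongr
        _ = _ := by ring
    have h6 : Real.log 6 ≤ 3 * Real.log 2 := by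
      have : 3 * Real.log 2 = Real.log 8 := by
        rw [show (8 : ℝ) = 2 ^ 3 by norm_num, Real.log_pow]; norm_num
      rw [this]; exact Real.log_le_log (by norm_num) (by norm_num)
    refine log_le_sub (by positivity) h14 ?_
    rw [Real.log_div (by norm_num) (by positivity), Real.log_mul (by positivity) (by positivity)]
    linarith
  -- Here m, d and the logarithm cancel, leaving 28 = 4 · 7. This is why the query bound of the
  -- misspecified case is free of m.
  · rw [inv_sq_thetaOf hm hd hb hγ hκ, hκu2]
    calc _ ≤ 1024 * (2 * (m : ℝ)) ^ 2 * (7 * d * missFactor d b ε ^ 2) /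
          (1024 * ε ^ 2 * d * (m : ℝ) ^ 2 * missFactor d b ε ^ 2) := by gcongr; linarith
      _ = _ := by field_simp; norm_num

end Settings

/-! ### A polynomial bound on the number of steps -/

section Cost

variable {R : Type*} [CommSemiring R]

/-- The polynomial expression behind `totalCost`. -/
def totalCostPoly (m d A n₀ K n H : R) : R :=
  let ins := d * (d * 3 + 1) + (d * 3 + (d * (d * 4 + 1) + 1))
  let chk := m * (A * (d * (m * 3 + 1) + (d * (d * 3 + 1) + (d * 3 + 1)) + 1) + 1)
  let greedy := m * (d * 4 + (A * (d * 4 + 1 + 1)) + 1)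
  let roll := n * (H * (chk + (greedy + 1) + 5) + 3) + 1
  let iter := n₀ * (roll + 1) + (d + n₀ * (d * 3 + 1)) + d * (d * 3 + 1) + 1
  (d * (d * 2 + 1) + 1) + (d * (m * 3 + 1) + (ins +
    (n₀ * (chk + ins + 1) + n₀ * (K * iter + ins + 1))))

theorem cast_totalCost (m d A n₀ : ℕ) (P : Params) :
    (totalCost m d A n₀ P : R) = totalCostPoly (m : R) d A n₀ P.K P.n P.H := by
  simp [totalCost, runCost, iterationCost, rolloutCost, stepCost, checkCost, greedyCost,
    insertCost, totalCostPoly]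

/-- A bound on the cost when all quantities are bounded in terms of `x`. -/
def budget (x : R) : R :=
  totalCostPoly x x x (32 * x ^ 2) (5 * x ^ 2) (917504 * x ^ 13) (8 * x ^ 2)

/-- `budget` uses semiring operations only, so one expression serves both as a real bound and, after
evaluation, as a polynomial. -/
theorem map_budget {R' : Type*} [CommSemiring R'] (f : R →+* R') (x : R) :
    f (budget x) = budget (f x) := by
  simp [budget, totalCostPoly, map_ofNat]

theorem totalCostPoly_mono {m d A n₀ K n H m' d' A' n₀' K' n' H' : ℝ} (hm0 : 0 ≤ m) (hd0 : 0 ≤ d)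
    (hA0 : 0 ≤ A) (hn₀0 : 0 ≤ n₀) (hK0 : 0 ≤ K) (hn0 : 0 ≤ n) (hH0 : 0 ≤ H) (hm : m ≤ m')
    (hd : d ≤ d') (hA : A ≤ A') (hn₀ : n₀ ≤ n₀') (hK : K ≤ K') (hn : n ≤ n') (hH : H ≤ H') :
    totalCostPoly m d A n₀ K n H ≤ totalCostPoly m' d' A' n₀' K' n' H' := by
  have := hm0.trans hm
  have := hd0.trans hd
  have := hA0.trans hA
  have := hn₀0.trans hn₀
  have := hK0.trans hK
  have := hn0.trans hn
  have := hH0.trans hH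
  unfold totalCostPoly
  dsimp only
  gcongr

/-- The runtime polynomial. -/
noncomputable def runtimePoly : MvPolynomial (Fin 6) ℝ :=
  budget (1 + ∑ i, MvPolynomial.X i)

theorem eval_runtimePoly (v : Fin 6 → ℝ) :
    MvPolynomial.eval v runtimePoly = budget (1 + ∑ i, v i) := by
  rw [runtimePoly, map_budget]
  simp

theorem cast_totalCost_le {m d A n₀ : ℕ} {P : Params} {Λ u X W : ℝ} (hu : 0 < u)
    (hX : 1 ≤ X) (hmX : (m : ℝ) ≤ X) (hdX : (d : ℝ) ≤ X) (hAX : (A : ℝ) ≤ X) (hΛ : 0 ≤ Λ)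
    (hΛX : Λ ≤ X) (huX : 1 / u ≤ X) (hWX : W ≤ 131072 * X ^ 13)
    (hn₀ : (n₀ : ℝ) ≤ 32 * d * Λ) (hK : (P.K : ℝ) ≤ 5 * Λ / u) (hH : (P.H : ℝ) + 1 ≤ 8 * Λ / u)
    (hn : (P.n : ℝ) ≤ 7 * W) : (totalCost m d A n₀ P : ℝ) ≤ budget X := by
  have h1 : Λ / u ≤ X ^ 2 := by
    calc Λ / u = Λ * (1 / u) := by ring
      _ ≤ X * X := by gcongr
      _ = X ^ 2 := by ring
  rw [cast_totalCost]
  refine totalCostPoly_mono (by positivity) (by positivity) (by positivity) (by positivity)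
    (by positivity) (by positivity) (by positivity) hmX hdX hAX ?_ ?_ (by linarith) ?_
  · calc (n₀ : ℝ) ≤ 32 * d * Λ := hn₀
      _ ≤ 32 * X * X := by gcongr
      _ = _ := by ring
  · rw [mul_div_assoc] at hK
    linarith
  · rw [mul_div_assoc] at hH
    linarith

end Cost

section Queries

/-- Runs, iterations, elements, rollouts and queries per rollout are multiplied; 286720 = 32 · 5 ·
32 · 7 · 8. -/
theorem queries_le {d n₀ : ℕ} {P : Params} {Λ u W : ℝ} (hu : 0 < u) (hΛ : 0 ≤ Λ)
    (hn₀ : (n₀ : ℝ) ≤ 32 * d * Λ) (hK : (P.K : ℝ) ≤ 5 * Λ / u) (hH : (P.H : ℝ) + 1 ≤ 8 * Λ / u)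
    (hn : (P.n : ℝ) ≤ 7 * W) :
    ((n₀ * (P.K * (n₀ * (P.n * (P.H + 1)))) : ℕ) : ℝ) ≤ 286720 * d ^ 2 * Λ ^ 4 * W / u ^ 2 := by
  have hW : 0 ≤ 7 * W := (Nat.cast_nonneg _).trans hn
  push_cast
  calc _ ≤ (32 * d * Λ) * (5 * Λ / u * ((32 * d * Λ) * (7 * W * (8 * Λ / u)))) := by gcongr
    _ = _ := by ring

theorem min_mul_le_one {x u : ℝ} (hu : 0 < u) : min x (1 / u) * u ≤ 1 := by
  calc min x (1 / u) * u ≤ 1 / u * u := by gcongr; exact min_le_right _ _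
    _ = 1 := by field_simp

theorem one_div_min_le {x u X : ℝ} (hxX : 1 / x ≤ X) (huX : u ≤ X) :
    1 / min x (1 / u) ≤ X := by
  rcases min_choice x (1 / u) with h | h <;> rw [h]
  · exact hxX
  · rwa [one_div_one_div]

end Queries

/-! ### Error budget and assembly -/

section Main

variable {S : Type u} [MeasurableSpace S] {m d : ℕ} {N : Fin m → ℕ}
  {M : MDP S (Act N)} {φ : Features S N d} {b κ δ ε : ℝ}

theorem accurate_settings (hm : 1 ≤ m) (hd : 1 ≤ d) (hφ : φ.Bounded) (hb : 0 < b) (hκ : 0 < κ)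
    (hδ : 0 < δ) (hδ1 : δ < 1) (hε : 0 ≤ ε) (hr : Realizable M φ b ε) {η target : ℝ} (hη : 0 ≤ η)
    (hη' : (2 * m - 1) * (√(cmaxOf m d b M.disc κ) * ε) + ε ≤ η)
    (htarget : κ / 2 + 4 * η / (1 - M.disc) ^ 2 ≤ target) :
    Accurate M φ (settings m d b M.disc κ δ) b ε (thetaOf m d b M.disc κ) (cmaxOf m d b M.disc κ)
      (3 * (κ * (1 - M.disc) ^ 2 / 32) + η) target := by
  have h0 := M.disc_nonneg
  have h1 := M.disc_lt_one
  have h2 : 0 < 1 - M.disc := by linarith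
  have hθ := thetaOf_pos hm hd hb h1 hκ
  exact {
    one_le_m := hm
    lam_pos := lamOf_pos hm hb h1 hκ
    b_nonneg := hb.le
    ε_nonneg := hε
    θ_nonneg := hθ.le
    η_nonneg := by positivity
    τ_eq := rfl
    disc_eq := rfl
    one_le_n := Nat.ceil_pos.2
      (div_pos (log_num_pos hm hd hb h1 hκ hδ hδ1) (by positivity))
    one_le_K := le_max_left _ _
    bias_le := bias_le_thetaOf hm hd hb h0 h1 hκ
    realizable := hr
    error_le := by
      have h3 := sqrt_cmaxOf_mul_thetaOf hm hd hb h1 hκ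
      have h4 : (2 * m - 1) * (√(settings m d b M.disc κ δ).lam * b) =
          κ * (1 - M.disc) ^ 2 / 32 := sqrt_lamOf hm hb h1 hκ
      -- The 2θ costs two shares of κ(1-γ)²/32 and the regularization one, whence the factor 3;
      -- misspecification is collected in η.
      linear_combination 2 * h3 + h4 + hη'
    gap_le := by
      have h3 : M.disc ^ ((settings m d b M.disc κ δ).K - 1) / (1 - M.disc) ≤ κ / 8 :=
        pow_itersOf_le h0 h1 hκ
      set x := 3 * (κ * (1 - M.disc) ^ 2 / 32) + η with hx
      have hx0 : 0 ≤ x := by positivity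
      -- Merges both terms in x into 4x/(1-γ)², whose part in κ is 3κ/8. With κ/8 from the finite
      -- number of iterations this is κ/2.
      have h4 : x ≤ x / (1 - M.disc) ^ 2 :=
        le_div_self hx0 (by positivity) (pow_le_one₀ h2.le (by linarith))
      have h5 : x / (1 - M.disc) ^ 2 = 3 * κ / 32 + η / (1 - M.disc) ^ 2 := by
        rw [hx]; field_simp
      rw [mul_div_assoc] at htarget ⊢
      linarith
    length_le := fun C hC => hC.length_le hφ (lamOf_pos hm hb h1 hκ) hd }

theorem valid_length_le_floor (hm : 1 ≤ m) (hd : 1 ≤ d) (hφ : φ.Bounded) (hb : 0 < b)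
    (hκ : 0 < κ) (C : CoreSet S N d) (hC : C.Valid φ (settings m d b M.disc κ δ).lam) :
    C.elems.length ≤ ⌊cmaxOf m d b M.disc κ⌋₊ :=
  Nat.le_floor (hC.length_le hφ (lamOf_pos hm hb M.disc_lt_one hκ) hd)

variable [∀ i, NeZero (N i)]

theorem prob_gap_le (hm : 1 ≤ m) (hd : 1 ≤ d) (hφb : φ.Bounded) (hb : 0 < b) (hκ : 0 < κ)
    (hδ : 0 < δ) (hφ : ∀ i a, Measurable fun s => φ i s a) (π₀ : Policy S (Act N)) (ρ : S)
    (abar : Act N) {η target : ℝ}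
    (hacc : Accurate M φ (settings m d b M.disc κ δ) b ε (thetaOf m d b M.disc κ)
      (cmaxOf m d b M.disc κ) η target) {fuel : ℕ} (hfuel : cmaxOf m d b M.disc κ ≤ fuel) :
    ENNReal.ofReal (1 - δ) ≤
      (confidentMCLSPI abar (settings m d b M.disc κ δ) ρ fuel).prob M φ π₀
        {o | ∃ π, o = some π ∧ M.optValue ρ - M.value (π.policy φ hφ π₀) ρ ≤ target} := by
  rw [prob_eq_wp]
  refine Likely.mono (likely_confidentMCLSPI hacc
    (valid_length_le_floor hm hd hφb hb hκ) ρ fuel (Nat.floor_le_of_le hfuel)) ?_ fun _ h => h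
  refine le_trans ?_ (fail_le hm hd hb M.disc_lt_one hκ hδ)
  have h1 := one_le_cmaxOf hm hd hb M.disc_lt_one hκ
  have h2 : (⌊cmaxOf m d b M.disc κ⌋₊ : ℝ) ≤ cmaxOf m d b M.disc κ := Nat.floor_le (by linarith)
  have h3 := rolloutFail_nonneg (settings m d b M.disc κ δ).n (thetaOf m d b M.disc κ) M.disc
  gcongr

theorem always_resources (hm : 1 ≤ m) (hd : 1 ≤ d) (hφ : φ.Bounded) (hb : 0 < b) (hκ : 0 < κ)
    (ρ : S) (abar : Act N) {fuel : ℕ} (hfuel : cmaxOf m d b M.disc κ ≤ fuel) {Λ W X : ℝ}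
    (hΛ : 0 ≤ Λ) (hC : cmaxOf m d b M.disc κ ≤ 32 * d * Λ)
    (hK : ((settings m d b M.disc κ δ).K : ℝ) ≤ 5 * Λ / (1 - M.disc))
    (hH : ((settings m d b M.disc κ δ).H : ℝ) + 1 ≤ 8 * Λ / (1 - M.disc))
    (hn : ((settings m d b M.disc κ δ).n : ℝ) ≤ 7 * W)
    (hX : 1 ≤ X) (hdX : (d : ℝ) ≤ X) (hAX : ∑ i, (N i : ℝ) ≤ X) (hΛX : Λ ≤ X)
    (huX : 1 / (1 - M.disc) ≤ X) (hWX : W ≤ 131072 * X ^ 13) :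
    (confidentMCLSPI abar (settings m d b M.disc κ δ) ρ fuel).Always M φ
      fun steps queries o => o.isSome ∧
        queries ≤ 286720 * d ^ 2 * Λ ^ 4 * W / (1 - M.disc) ^ 2 ∧ steps ≤ budget X := by
  have hu : 0 < 1 - M.disc := M.one_sub_disc_pos
  have hA : ∀ i, N i ≤ ∑ i, N i := fun i => Finset.single_le_sum (fun _ _ => Nat.zero_le _)
    (Finset.mem_univ i)
  have hmA : m ≤ ∑ i, N i := by
    calc m = ∑ _i : Fin m, 1 := by simp
      _ ≤ _ := Finset.sum_le_sum fun i _ => Nat.one_le_iff_ne_zero.2 (NeZero.ne _)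
  have hAX' : ((∑ i, N i : ℕ) : ℝ) ≤ X := by push_cast; exact hAX
  have hn₀ : (⌊cmaxOf m d b M.disc κ⌋₊ : ℝ) ≤ 32 * d * Λ := by
    have h1 := one_le_cmaxOf hm hd hb M.disc_lt_one hκ
    exact (Nat.floor_le (by linarith)).trans hC
  refine Always.mono (spec_confidentMCLSPI hA rfl (lamOf_pos hm hb M.disc_lt_one hκ)
    (valid_length_le_floor hm hd hφ hb hκ) ρ fuel (Nat.floor_le_of_le hfuel)) ?_
  rintro t q o ⟨ht, hq, ho⟩
  refine ⟨ho, ?_, ?_⟩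
  · exact (Nat.cast_le.2 hq).trans (queries_le hu hΛ hn₀ hK hH hn)
  · exact (Nat.cast_le.2 ht).trans (cast_totalCost_le hu hX
      ((Nat.cast_le.2 hmA).trans hAX') hdX hAX' hΛ hΛX huX hWX hn₀ hK hH hn)

end Main

end MCLSPI

open MCLSPI in
theorem theorem2 : ∃ (c : ℝ) (p : ℕ) (T₁ T₂ : MvPolynomial (Fin 6) ℝ),
    ∀ {m d : ℕ} (N : Fin m → ℕ) [∀ i, NeZero (N i)] {S : Type*} [MeasurableSpace S]
      (M : MDP S (Act N)) (φ : Features S N d) (hφ : ∀ i a, Measurable fun s => φ i s a)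
      (π₀ : Policy S (Act N)) (ρ : S) (abar : Act N) (b δ : ℝ),
      1 ≤ m → 1 ≤ d → φ.Bounded → 0 < b → 0 < δ → δ < 1 →
      -- realizable case
      (Realizable M φ b 0 → ∀ κ : ℝ, 0 < κ → ∀ fuel : ℕ, cmaxOf m d b M.disc κ ≤ fuel →
        ENNReal.ofReal (1 - δ) ≤
          (confidentMCLSPI abar (settings m d b M.disc κ δ) ρ fuel).prob M φ π₀
            {o | ∃ π, o = some π ∧ M.optValue ρ - M.value (π.policy φ hφ π₀) ρ ≤ κ} ∧
        (confidentMCLSPI abar (settings m d b M.disc κ δ) ρ fuel).Always M φ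
          fun steps queries o => o.isSome ∧
            queries ≤ c * (m ^ 2 * d ^ 3 / (min κ (1 / (1 - M.disc)) ^ 2 * (1 - M.disc) ^ 8)) *
              (1 + Real.log m + Real.log d + Real.log (1 + b) + Real.log (1 + 1 / κ) +
                Real.log (1 / (1 - M.disc)) + Real.log (1 / δ)) ^ p ∧
            steps ≤ MvPolynomial.eval ![∑ i, (N i : ℝ), (d : ℝ), 1 / (1 - M.disc), 1 / κ,
              Real.log (1 / δ), Real.log (1 + b)] T₁) ∧
      -- misspecified case
      (∀ ε : ℝ, 0 < ε → Realizable M φ b ε →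
        ∀ fuel : ℕ, cmaxOf m d b M.disc (kappaOf m d b M.disc ε) ≤ fuel →
        ENNReal.ofReal (1 - δ) ≤
          (confidentMCLSPI abar (settings m d b M.disc (kappaOf m d b M.disc ε) δ) ρ fuel).prob
            M φ π₀
            {o | ∃ π, o = some π ∧ M.optValue ρ - M.value (π.policy φ hφ π₀) ρ ≤
              128 * ε * √d * m / (1 - M.disc) ^ 2 *
                √(1 + Real.log (1 + b ^ 2 / (ε ^ 2 * d)))} ∧
        (confidentMCLSPI abar (settings m d b M.disc (kappaOf m d b M.disc ε) δ) ρ fuel).Always M φ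
          fun steps queries o => o.isSome ∧
            queries ≤ c * (d ^ 2 / (min ε (1 / (1 - M.disc)) ^ 2 * (1 - M.disc) ^ 4)) *
              (1 + Real.log d + Real.log (1 + b) + Real.log (1 + 1 / ε) +
                Real.log (1 / (1 - M.disc)) + Real.log (1 / δ)) ^ p ∧
            steps ≤ MvPolynomial.eval ![∑ i, (N i : ℝ), (d : ℝ), 1 / (1 - M.disc), 1 / ε,
              Real.log (1 / δ), Real.log (1 + b)] T₂) := by
  -- The factor of `queries_le` times that of the bound W on n, where 131072 = 1024 · 4 · 32. Four
  -- powers of Λ come from `queries_le` and two from W.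
  refine ⟨286720 * 131072, 6, runtimePoly, runtimePoly, ?_⟩
  intro m d N _ S _ M φ hφ π₀ ρ abar b δ hm hd hφb hb hδ hδ1
  have hγ0 := M.disc_nonneg
  have hγ := M.disc_lt_one
  have hu : 0 < 1 - M.disc := M.one_sub_disc_pos
  have hu1 : 1 - M.disc ≤ 1 := by linarith
  have hm' : (1 : ℝ) ≤ m := by exact_mod_cast hm
  have hd' : (1 : ℝ) ≤ d := by exact_mod_cast hd
  have hlu := log_one_div_one_sub_nonneg hγ0 hγ
  have hlδ := log_one_div_nonneg hδ hδ1
  have hlb := log_one_add_nonneg hb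
  have hlm := log_natCast_nonneg_of_le hm
  have hld := log_natCast_nonneg_of_le hd
  have hmA : (m : ℝ) ≤ ∑ i, (N i : ℝ) := by
    calc (m : ℝ) = ∑ _i : Fin m, 1 := by simp
      _ ≤ _ := Finset.sum_le_sum fun i _ => by exact_mod_cast Nat.one_le_iff_ne_zero.2 (NeZero.ne _)
  have hu' : 1 ≤ 1 / (1 - M.disc) := by rw [le_div_iff₀ hu]; linarith
  have hlm' := Real.log_le_sub_one_of_pos (show (0 : ℝ) < m by linarith)
  have hld' := Real.log_le_sub_one_of_pos (show (0 : ℝ) < d by linarith)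
  have hlu' := Real.log_le_sub_one_of_pos (show 0 < 1 / (1 - M.disc) by positivity)
  refine ⟨fun hr κ hκ fuel hfuel => ⟨?_, ?_⟩, fun ε hε hr fuel hfuel => ⟨?_, ?_⟩⟩
  · exact prob_gap_le hm hd hφb hb hκ hδ hφ π₀ ρ abar
      (accurate_settings hm hd hφb hb hκ hδ hδ1 le_rfl hr le_rfl (by simp)
        (by rw [mul_zero, zero_div]; linarith)) hfuel
  · obtain ⟨hK, hH, hn⟩ := realizable_params_le hm hd hb hγ0 hγ hκ hδ hδ1
    have hC := cmaxOf_le_logFactor hm hd hb hγ0 hγ hκ hδ hδ1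
    have hκ' : 0 < 1 / κ := by positivity
    have hlκ := log_one_add_nonneg hκ'
    have hlκ' := Real.log_le_sub_one_of_pos (show 0 < 1 + 1 / κ by linarith)
    have hΛ1 : 1 ≤ logFactor m d b κ M.disc δ := by unfold logFactor; linarith
    set Λ := logFactor m d b κ M.disc δ with hΛ
    set u := 1 - M.disc with hudef
    -- The number at which `eval_runtimePoly` evaluates `budget`. By log x ≤ x - 1 it also dominates
    -- Λ.
    set X := 1 + ∑ i, ![∑ i, (N i : ℝ), (d : ℝ), 1 / u, 1 / κ, Real.log (1 / δ),
      Real.log (1 + b)] i with hX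
    have hX' : X = 1 + (∑ i, (N i : ℝ) + d + 1 / u + 1 / κ + Real.log (1 / δ) +
        Real.log (1 + b)) := by
      rw [hX]; simp [Fin.sum_univ_succ]; ring
    set κ' := min κ (1 / u) with hκ'def
    have hκ'pos : 0 < κ' := lt_min hκ (by positivity)
    have hinv : 1 / κ' ≤ X := one_div_min_le (by linarith) (by linarith)
    have hX1 : 1 ≤ X := by linarith
    have hΛX : Λ ≤ X := by rw [hΛ, logFactor]; linarith
    -- The truncation of κ at 1/(1-γ) is needed here: κ' u ≤ 1 makes this quantity at least 1, so
    -- that rounding up n only turns the factor 6 into 7.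
    have hW1 : 1 ≤ 131072 * m ^ 2 * d * Λ ^ 2 / (κ' ^ 2 * u ^ 6) := by
      rw [one_le_div (by positivity)]
      calc κ' ^ 2 * u ^ 6 = (κ' * u) ^ 2 * u ^ 4 := by ring
        _ ≤ 1 ^ 2 * 1 ^ 4 := by gcongr; exact min_mul_le_one hu
        _ ≤ 131072 * 1 ^ 2 * 1 * 1 ^ 2 := by norm_num
        _ ≤ _ := by gcongr
    have hn' : ((settings m d b M.disc κ δ).n : ℝ) ≤
        7 * (131072 * m ^ 2 * d * Λ ^ 2 / (κ' ^ 2 * u ^ 6)) := by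
      have h1 : 6 * Λ * (131072 * m ^ 2 * d * Λ / (κ ^ 2 * u ^ 4)) / u ^ 2 ≤
          6 * (131072 * m ^ 2 * d * Λ ^ 2 / (κ' ^ 2 * u ^ 6)) := by
        calc _ = 6 * (131072 * m ^ 2 * d * Λ ^ 2 / (κ ^ 2 * u ^ 6)) := by field_simp
          _ ≤ _ := by gcongr; exact min_le_left _ _
      linarith
    have hWX : 131072 * m ^ 2 * d * Λ ^ 2 / (κ' ^ 2 * u ^ 6) ≤ 131072 * X ^ 13 := by
      calc _ = 131072 * (m ^ 2 * d * Λ ^ 2 * (1 / κ') ^ 2 * (1 / u) ^ 6) := by field_simp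
        _ ≤ 131072 * (X ^ 2 * X * X ^ 2 * X ^ 2 * X ^ 6) := by gcongr <;> linarith
        _ = _ := by ring
    refine Prog.Always.mono (always_resources (X := X) hm hd hφb hb hκ ρ abar hfuel (by linarith)
      hC hK hH hn' hX1 (by linarith) (by linarith) hΛX (by linarith) hWX) ?_
    rintro t q o ⟨ho, hq, ht⟩
    rw [← hudef] at hq
    refine ⟨ho, hq.trans (le_of_eq ?_), by rwa [eval_runtimePoly]⟩
    change _ = 286720 * 131072 * (m ^ 2 * d ^ 3 / (κ' ^ 2 * u ^ 8)) * Λ ^ 6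
    field_simp
  · have hκ := kappaOf_pos hm hd hb hγ hε
    have hsd : 1 ≤ √(d : ℝ) := Real.one_le_sqrt.2 hd'
    have hF := one_le_missFactor hb hε hd
    have hκu := kappaOf_mul (m := m) (d := d) (b := b) (ε := ε) hγ
    have htarget : 128 * ε * √d * m / (1 - M.disc) ^ 2 *
        √(1 + Real.log (1 + b ^ 2 / (ε ^ 2 * d))) = 4 * kappaOf m d b M.disc ε := by
      unfold kappaOf missFactor; ring
    rw [htarget]
    -- With 7/8 the bound κ/2 + 4η/(1-γ)² equals the target 4κ. The misspecification error needs
    -- only 7/32.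
    refine prob_gap_le hm hd hφb hb hκ hδ hφ π₀ ρ abar
      (accurate_settings (η := 7 / 8 * (kappaOf m d b M.disc ε * (1 - M.disc) ^ 2))
        hm hd hφb hb hκ hδ hδ1 hε.le hr (by positivity) ?_ (le_of_eq ?_)) hfuel
    · have h1 := sqrt_cmaxOf_kappaOf_le hm hd hb hγ hε
      have h2 : 1 ≤ √(d : ℝ) * m * missFactor d b ε := by
        calc (1 : ℝ) = 1 * 1 * 1 := by norm_num
          _ ≤ _ := by gcongr
      rw [hκu]
      calc _ = ((2 * m - 1) * √(cmaxOf m d b M.disc (kappaOf m d b M.disc ε))) * ε + ε * 1 := by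
            ring
        _ ≤ (6 * √d * m * missFactor d b ε) * ε + ε * (√d * m * missFactor d b ε) := by gcongr
        _ = 7 * (ε * √d * m * missFactor d b ε) := by ring
        _ ≤ 28 * (ε * √d * m * missFactor d b ε) := by gcongr; norm_num
        _ = _ := by ring
    · field_simp; norm_num
  · have hκ := kappaOf_pos hm hd hb hγ hε
    obtain ⟨hK, hH, hn⟩ := misspecified_params_le hm hd hb hγ0 hγ hε hδ hδ1
    have hε' : 0 < 1 / ε := by positivity
    have hlε := log_one_add_nonneg hε'
    have hlε' := Real.log_le_sub_one_of_pos (show 0 < 1 + 1 / ε by linarith)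
    have hΛ1 : 1 ≤ missLogFactor d b ε M.disc δ := by unfold missLogFactor; linarith
    have hC : cmaxOf m d b M.disc (kappaOf m d b M.disc ε) ≤
        32 * d * missLogFactor d b ε M.disc δ := by
      calc _ ≤ 7 * d * (2 * missLogFactor d b ε M.disc δ) :=
            (cmaxOf_kappaOf_le hm hd hb hγ hε).trans (by
              gcongr; exact sq_missFactor_le hd hb hε hγ0 hγ hδ hδ1)
        _ = 14 * (d * missLogFactor d b ε M.disc δ) := by ring
        _ ≤ 32 * (d * missLogFactor d b ε M.disc δ) := by gcongr; norm_num
        _ = _ := by ring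
    set Λ := missLogFactor d b ε M.disc δ with hΛ
    set u := 1 - M.disc with hudef
    set X := 1 + ∑ i, ![∑ i, (N i : ℝ), (d : ℝ), 1 / u, 1 / ε, Real.log (1 / δ),
      Real.log (1 + b)] i with hX
    have hX' : X = 1 + (∑ i, (N i : ℝ) + d + 1 / u + 1 / ε + Real.log (1 / δ) +
        Real.log (1 + b)) := by
      rw [hX]; simp [Fin.sum_univ_succ]; ring
    set ε' := min ε (1 / u) with hε'def
    have hε'pos : 0 < ε' := lt_min hε (by positivity)
    have hinv : 1 / ε' ≤ X := one_div_min_le (by linarith) (by linarith)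
    have hX1 : 1 ≤ X := by linarith
    have hΛX : Λ ≤ X := by rw [hΛ, missLogFactor]; linarith
    have hW1 : 1 ≤ 28 * Λ / (ε' ^ 2 * u ^ 2) := by
      rw [one_le_div (by positivity)]
      calc ε' ^ 2 * u ^ 2 = (ε' * u) ^ 2 := by ring
        _ ≤ 1 ^ 2 := by gcongr; exact min_mul_le_one hu
        _ ≤ _ := by linarith
    have hn' : ((settings m d b M.disc (kappaOf m d b M.disc ε) δ).n : ℝ) ≤
        7 * (28 * Λ / (ε' ^ 2 * u ^ 2)) := by
      have h1 : 6 * Λ * (28 / ε ^ 2) / u ^ 2 ≤ 6 * (28 * Λ / (ε' ^ 2 * u ^ 2)) := by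
        calc _ = 6 * (28 * Λ / (ε ^ 2 * u ^ 2)) := by field_simp
          _ ≤ _ := by gcongr; exact min_le_left _ _
      linarith
    have hWX : 28 * Λ / (ε' ^ 2 * u ^ 2) ≤ 131072 * X ^ 13 := by
      calc _ = 28 * (Λ * (1 / ε') ^ 2 * (1 / u) ^ 2) := by field_simp
        _ ≤ 28 * (X * X ^ 2 * X ^ 2) := by gcongr; linarith
        _ = 28 * X ^ 5 := by ring
        _ ≤ 131072 * X ^ 13 := by gcongr <;> norm_num [hX1]
    refine Prog.Always.mono (always_resources (X := X) hm hd hφb hb hκ ρ abar hfuel (by linarith)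
      hC hK hH hn' hX1 (by linarith) (by linarith) hΛX (by linarith) hWX) ?_
    rintro t q o ⟨ho, hq, ht⟩
    rw [← hudef] at hq
    refine ⟨ho, hq.trans ?_, by rwa [eval_runtimePoly]⟩
    change _ ≤ 286720 * 131072 * (d ^ 2 / (ε' ^ 2 * u ^ 4)) * Λ ^ 6
    -- Slack in the constant and one power of Λ ≥ 1 are given away to share c and p with the
    -- realizable case.
    calc _ = 286720 * 28 * (d ^ 2 / (ε' ^ 2 * u ^ 4)) * Λ ^ 5 := by field_simp
      _ ≤ _ := by gcongr <;> norm_num
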